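/- For $c\in\mathbb R$ let $M^{n+k}(c)$ denote the complete simply connected Riemannian manifold of dimension $n+k$ and constant sectional curvature $c$, i.e. the round sphere of radius $1/\sqrt c$ if $c>0$, Euclidean space if $c=0$, and hyperbolic space of curvature $c$ if $c<0$. For an isometric immersion $f:M^n\to M^{n+k}(c)$ with second fundamental form $\alpha$, a point $x\in M^n$ and a normal vector $\eta$ of $f$ at $x$, put $$E_\eta=\{X\in T_xM^n:\ \alpha(x)(X,Y)=\langle X,Y\rangle\,\eta\ \text{ for all } Y\in T_xM^n\}.$$ If $f$ has flat normal bundle, then at each $x$ there are unique pairwise distinct normal vectors $\eta_1(x),\dots,\eta_{s(x)}(x)$ (the principal normal vectors) with $E_{\eta_i(x)}\neq 0$ such that $T_xM^n$ is the orthogonal direct sum of the $E_{\eta_i(x)}$. The immersion $f$ is called proper if $s(x)$ does not depend on $x$, and $f$ has type $(l_1,\dots,l_s)$ if at every point $x$ there are $s$ principal normal vectors and, suitably numbered, they satisfy $\dim E_{\eta_i(x)}=l_i$ for $1\le i\le s$. Theorem. Let $M^n$, $n\ge 3$, be a connected, complete $C^\infty$ Riemannian manifold of constant scalar curvature $R$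 (the trace of the Ricci tensor), and let $f:M^n\to M^{n+k}(c)$ be a $C^\infty$ isometric immersion with flat normal bundle which is proper and has type $(1,n-1)$. Then: (i) if $c=0$, then $R\ge 0$, and $R>0$ if $M^n$ is compact; (ii) if $c>0$, then $R>(n-1)(n-2)c$; (iii) if $c<0$, then $R\ge n(n-1)c$, and $R>n(n-1)c$ if $M^n$ is compact. -/

import Mathlib

open Bundle
open scoped Manifold ContDiff Matrix

noncomputable section

/-! ### Scalar curvature of a Riemannian metric -/

/-- The model space `ℝⁿ` of coordinates. -/
abbrev Coord (n : ℕ) : Type := EuclideanSpace ℝ (Fin n)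

/-- The partial derivative `∂ᵢ h` at `u` of a function of the coordinates. -/
def partialD {n : ℕ} {W : Type*} [NormedAddCommGroup W] [NormedSpace ℝ W]
    (i : Fin n) (h : Coord n → W) (u : Coord n) : W :=
  fderiv ℝ h u (EuclideanSpace.single i 1)

/-- The Christoffel symbol `Γᵏᵢⱼ` at `u` of the metric with matrix `G = (gᵢⱼ)`. -/
def christoffel {n : ℕ} (G : Coord n → Matrix (Fin n) (Fin n) ℝ)
    (k i j : Fin n) (u : Coord n) : ℝ :=
  (1 / 2) * ∑ l, (G u)⁻¹ k l *
    (partialD i (fun p => G p j l) u + partialD j (fun p => G p i l) u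
      - partialD l (fun p => G p i j) u)

/-- The `l`-th component of `R(∂ᵢ, ∂ⱼ)∂ₖ`, where `R(X,Y)Z = ∇_X∇_Y Z - ∇_Y∇_X Z - ∇_[X,Y] Z`. -/
def riemannCoeff {n : ℕ} (G : Coord n → Matrix (Fin n) (Fin n) ℝ)
    (l k i j : Fin n) (u : Coord n) : ℝ :=
  partialD i (christoffel G l j k) u - partialD j (christoffel G l i k) u
    + ∑ p, (christoffel G l i p u * christoffel G p j k u
        - christoffel G l j p u * christoffel G p i k u)

/-- `Ric(∂ⱼ, ∂ₖ) = tr (X ↦ R(X, ∂ⱼ)∂ₖ)`. -/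
def ricciCoeff {n : ℕ} (G : Coord n → Matrix (Fin n) (Fin n) ℝ)
    (j k : Fin n) (u : Coord n) : ℝ :=
  ∑ i, riemannCoeff G i k i j u

/-- The trace of the Ricci tensor with respect to the metric `G`. -/
def scalarCoord {n : ℕ} (G : Coord n → Matrix (Fin n) (Fin n) ℝ) (u : Coord n) : ℝ :=
  ∑ j, ∑ k, (G u)⁻¹ j k * ricciCoeff G j k u

section Intrinsic

variable {n : ℕ} {M : Type*} [TopologicalSpace M] [ChartedSpace (Coord n) M]

/-- The matrix `gᵢⱼ = ⟨∂ᵢ, ∂ⱼ⟩` of the Riemannian metric of `M` in the preferred chart at `x`. -/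
def metricInChart [RiemannianBundle (fun y : M => TangentSpace (𝓡 n) y)]
    (x : M) (u : Coord n) : Matrix (Fin n) (Fin n) ℝ :=
  fun i j =>
    let d : Coord n →L[ℝ] TangentSpace (𝓡 n) ((extChartAt (𝓡 n) x).symm u) :=
      mfderiv 𝓘(ℝ, Coord n) (𝓡 n) (extChartAt (𝓡 n) x).symm u
    inner ℝ (d (EuclideanSpace.single i 1)) (d (EuclideanSpace.single j 1))

/-- The scalar curvature at `x`: the trace of the Ricci tensor, i.e. the sum of the sectional
curvatures `K(eᵢ, eⱼ)` over all ordered pairs `i ≠ j` from an orthonormal basis of `T_xM`. -/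
def scalarCurvature [RiemannianBundle (fun y : M => TangentSpace (𝓡 n) y)] (x : M) : ℝ :=
  scalarCoord (metricInChart x) (extChartAt (𝓡 n) x x)

end Intrinsic

/-! ### Space forms

The complete simply connected `m`-dimensional Riemannian manifold of constant sectional
curvature `c`, realised in `ℝ^(m+1)` as the round sphere of radius `1/√c` (`c > 0`), as the
Euclidean space `{p₀ = 0}` (`c = 0`), or as the upper sheet of the hyperboloid `⟨p, p⟩ = 1/c` in
Lorentz space (`c < 0`). -/

/-- The vector space `ℝ^(m+1)` containing the `m`-dimensional space form. -/
abbrev Ambient (m : ℕ) : Type := Fin (m + 1) → ℝ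

/-- The Euclidean (`c ≥ 0`) or Lorentzian (`c < 0`) scalar product of `ℝ^(m+1)`; the metric of
the space form is its restriction to tangent vectors. -/
def form (c : ℝ) {m : ℕ} (p q : Ambient m) : ℝ :=
  (if c < 0 then -1 else 1) * (p 0 * q 0) + ∑ i : Fin m, p i.succ * q i.succ

/-- The space form of dimension `m` and curvature `c`. -/
def SpaceForm (c : ℝ) (m : ℕ) : Set (Ambient m) :=
  {p | if c = 0 then p 0 = 0 else form c p p = 1 / c ∧ (c < 0 → 0 < p 0)}

/-- `v` is tangent to the space form of curvature `c` at the point `p`. -/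
def IsTangent (c : ℝ) {m : ℕ} (p v : Ambient m) : Prop :=
  if c = 0 then v 0 = 0 else form c p v = 0

/-! ### Immersions into space forms, in coordinates

`F` is an immersion of an open subset of `ℝⁿ` into the space form of curvature `c`. -/

section Local

variable {n m : ℕ}

/-- The induced metric `⟨∂ᵢF, ∂ⱼF⟩`. -/
def gram (c : ℝ) (F : Coord n → Ambient m) (u : Coord n) : Matrix (Fin n) (Fin n) ℝ :=
  fun i j => form c (partialD i F u) (partialD j F u)

/-- The component of `w` normal to the immersion and tangent to the space form: the part of `w`
in the span of the `∂ₗF` and the part in the direction `F`, which is normal to the space form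
when `c ≠ 0` (where `⟨F, F⟩ = 1/c`), are removed. When `c = 0`, the vectors `w` to which it is
applied below are derivatives of maps into `{p₀ = 0}`, so no further component has to be removed. -/
def normalPart (c : ℝ) (F : Coord n → Ambient m) (u : Coord n) (w : Ambient m) : Ambient m :=
  w - (∑ k, ∑ l, ((gram c F u)⁻¹ k l * form c w (partialD k F u)) • partialD l F u)
    - (c * form c w (F u)) • F u

/-- The second fundamental form `α(v, w)`: the normal part of the derivative in the direction `v`
of the vector field `dF(w)`. -/
def secondFF (c : ℝ) (F : Coord n → Ambient m) (u v w : Coord n) : Ambient m :=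
  normalPart c F u (fderiv ℝ (fun p => fderiv ℝ F p w) u v)

/-- The normal connection: the normal part of the derivative of the normal field `ξ`. -/
def normalD (c : ℝ) (F : Coord n → Ambient m) (v : Coord n) (ξ : Coord n → Ambient m)
    (u : Coord n) : Ambient m :=
  normalPart c F u (fderiv ℝ ξ u v)

/-- The curvature `R^⊥(v, w)ξ` of the normal connection; `v` and `w` are constant vector fields in
the coordinates, so that their bracket vanishes. -/
def normalCurvature (c : ℝ) (F : Coord n → Ambient m) (v w : Coord n) (ξ : Coord n → Ambient m)
    (u : Coord n) : Ambient m :=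
  normalD c F v (normalD c F w ξ) u - normalD c F w (normalD c F v ξ) u

theorem form_add_left (c : ℝ) (p q r : Ambient m) :
    form c (p + q) r = form c p r + form c q r := by
  simp only [form, Pi.add_apply, add_mul, Finset.sum_add_distrib]
  ring

theorem form_smul_left (c a : ℝ) (p r : Ambient m) : form c (a • p) r = a * form c p r := by
  simp only [form, Pi.smul_apply, smul_eq_mul, mul_add, Finset.mul_sum]
  congr 1
  · ring
  · exact Finset.sum_congr rfl fun i _ => by ring

theorem normalPart_add (c : ℝ) (F : Coord n → Ambient m) (u : Coord n) (v w : Ambient m) :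
    normalPart c F u (v + w) = normalPart c F u v + normalPart c F u w := by
  simp only [normalPart, form_add_left, mul_add, add_smul, Finset.sum_add_distrib]
  abel

theorem normalPart_smul (c : ℝ) (F : Coord n → Ambient m) (u : Coord n) (a : ℝ) (w : Ambient m) :
    normalPart c F u (a • w) = a • normalPart c F u w := by
  simp only [normalPart, form_smul_left, smul_sub, Finset.smul_sum, smul_smul, mul_left_comm _ a]

end Local

/-! ### Isometric immersions of a Riemannian manifold into a space form -/

section Global

variable {n m : ℕ} {M : Type*} [TopologicalSpace M] [ChartedSpace (Coord n) M]

/-- The differential of `f` at `x`. -/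
def differential (f : M → Ambient m) (x : M) : TangentSpace (𝓡 n) x →L[ℝ] Ambient m :=
  mfderiv (𝓡 n) 𝓘(ℝ, Ambient m) f x

/-- The expression of `f` in the preferred chart at `x`. -/
def inChart (n : ℕ) {m : ℕ} {M : Type*} [TopologicalSpace M] [ChartedSpace (Coord n) M]
    (f : M → Ambient m) (x : M) : Coord n → Ambient m :=
  fun u => f ((extChartAt (𝓡 n) x).symm u)

/-- The coordinates of a tangent vector at `x` in the preferred chart at `x`. -/
def coords (x : M) : TangentSpace (𝓡 n) x →L[ℝ] Coord n :=
  mfderiv (𝓡 n) 𝓘(ℝ, Coord n) (extChartAt (𝓡 n) x) x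

/-- `f` is a smooth isometric immersion of `M` into the space form of curvature `c`. -/
structure IsIsometricImmersion [RiemannianBundle (fun y : M => TangentSpace (𝓡 n) y)]
    (c : ℝ) (f : M → Ambient m) : Prop where
  smooth : ContMDiff (𝓡 n) 𝓘(ℝ, Ambient m) ∞ f
  mem_spaceForm : ∀ x, f x ∈ SpaceForm c m
  isometric : ∀ (x : M) (X Y : TangentSpace (𝓡 n) x),
    form c (differential f x X) (differential f x Y) = inner ℝ X Y

/-- `ξ` is a normal vector of `f` at `x`. -/
def IsNormal (n : ℕ) {m : ℕ} {M : Type*} [TopologicalSpace M] [ChartedSpace (Coord n) M]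
    (c : ℝ) (f : M → Ambient m) (x : M) (ξ : Ambient m) : Prop :=
  IsTangent c (f x) ξ ∧ ∀ X : TangentSpace (𝓡 n) x, form c ξ (differential f x X) = 0

/-- The normal bundle of `f` is flat: `R^⊥(v, w)ξ = 0` for all local normal fields `ξ`. -/
def FlatNormalBundle (n : ℕ) {m : ℕ} {M : Type*} [TopologicalSpace M] [ChartedSpace (Coord n) M]
    (c : ℝ) (f : M → Ambient m) : Prop :=
  ∀ (x : M) (ξ : Coord n → Ambient m),
    ContDiffOn ℝ ∞ ξ (extChartAt (𝓡 n) x).target →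
    (∀ u ∈ (extChartAt (𝓡 n) x).target,
      IsNormal n c f ((extChartAt (𝓡 n) x).symm u) (ξ u)) →
    ∀ u ∈ (extChartAt (𝓡 n) x).target, ∀ v w : Coord n,
      normalCurvature c (inChart n f x) v w ξ u = 0

/-- The second fundamental form `α(x)(X, Y)` of `f`. -/
def secondFundamentalForm (c : ℝ) (f : M → Ambient m) (x : M)
    (X Y : TangentSpace (𝓡 n) x) : Ambient m :=
  secondFF c (inChart n f x) (extChartAt (𝓡 n) x x) (coords x X) (coords x Y)

variable [RiemannianBundle (fun y : M => TangentSpace (𝓡 n) y)]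

/-- `E_η = {X ∈ T_xM : α(x)(X, Y) = ⟨X, Y⟩ η for all Y ∈ T_xM}`. -/
def principalSpace (c : ℝ) (f : M → Ambient m) (x : M) (η : Ambient m) :
    Submodule ℝ (TangentSpace (𝓡 n) x) where
  carrier := {X | ∀ Y : TangentSpace (𝓡 n) x,
    secondFundamentalForm c f x X Y = (inner ℝ X Y : ℝ) • η}
  add_mem' := by
    intro X X' hX hX' Y
    have h : secondFundamentalForm c f x (X + X') Y
        = secondFundamentalForm c f x X Y + secondFundamentalForm c f x X' Y := by
      simp only [secondFundamentalForm, secondFF, map_add, normalPart_add]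
    rw [h, hX Y, hX' Y, inner_add_left, add_smul]
  zero_mem' := by
    intro Y
    have h : secondFundamentalForm c f x ((0 : ℝ) • (0 : TangentSpace (𝓡 n) x)) Y
        = (0 : ℝ) • secondFundamentalForm c f x 0 Y := by
      simp only [secondFundamentalForm, secondFF, map_smul, normalPart_smul]
    rw [zero_smul, zero_smul] at h
    rw [h, inner_zero_left, zero_smul]
  smul_mem' := by
    intro a X hX Y
    have h : secondFundamentalForm c f x (a • X) Y = a • secondFundamentalForm c f x X Y := by
      simp only [secondFundamentalForm, secondFF, map_smul, normalPart_smul]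
    rw [h, hX Y, real_inner_smul_left, smul_smul]

/-- `η 0, …, η (s - 1)` are the principal normal vectors of `f` at `x`: pairwise distinct normal
vectors, with nonzero spaces `E_(η i)`, such that `T_xM` is the orthogonal direct sum of the
`E_(η i)`. -/
structure ArePrincipalNormals (n : ℕ) {m : ℕ} {M : Type*} [TopologicalSpace M]
    [ChartedSpace (Coord n) M] [RiemannianBundle (fun y : M => TangentSpace (𝓡 n) y)]
    (c : ℝ) (f : M → Ambient m) (x : M) {s : ℕ} (η : Fin s → Ambient m) : Prop where
  distinct : Function.Injective η
  normal : ∀ i, IsNormal n c f x (η i)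
  ne_bot : ∀ i, principalSpace (n := n) c f x (η i) ≠ ⊥
  orthogonal : ∀ i j, i ≠ j → ∀ X ∈ principalSpace (n := n) c f x (η i),
    ∀ Y ∈ principalSpace (n := n) c f x (η j), (inner ℝ X Y : ℝ) = 0
  iSup_eq_top : ⨆ i, principalSpace (n := n) c f x (η i) = ⊤

/-- `f` is proper: the number `s(x)` of principal normal vectors does not depend on `x`. -/
def IsProperImmersion (n : ℕ) {m : ℕ} {M : Type*} [TopologicalSpace M]
    [ChartedSpace (Coord n) M] [RiemannianBundle (fun y : M => TangentSpace (𝓡 n) y)]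
    (c : ℝ) (f : M → Ambient m) : Prop :=
  ∃ s : ℕ, ∀ x, ∃ η : Fin s → Ambient m, ArePrincipalNormals n c f x η

/-- `f` has type `(l 0, …, l (s - 1))`: at every point the principal normal vectors can be numbered
so that `dim E_(η i) = l i`. -/
def HasType (n : ℕ) {m : ℕ} {M : Type*} [TopologicalSpace M]
    [ChartedSpace (Coord n) M] [RiemannianBundle (fun y : M => TangentSpace (𝓡 n) y)]
    (c : ℝ) (f : M → Ambient m) {s : ℕ} (l : Fin s → ℕ) : Prop :=
  ∀ x, ∃ η : Fin s → Ambient m, ArePrincipalNormals n c f x η ∧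
    ∀ i, Module.finrank ℝ (principalSpace (n := n) c f x (η i)) = l i

end Global

end

/-
Let `T` be a unit vector spanning the one-dimensional `E_η`, and let `ζ` be the other principal
normal. The Codazzi equation gives `∇_X T = ψ X` for `X ⊥ T`, `dζ(T) = ψ (η - ζ)`, and that `ζ` is
parallel along `T^⊥`. By the Gauss equation `R = n(n-1)c + (n-1)ρ` with
`ρ = 2⟨η, ζ⟩ + (n-2)⟨ζ, ζ⟩`, so `ρ` is constant and the gap `w = n⟨ζ, ζ⟩ - ρ` satisfies
`dw = -nψw ⟨T, ·⟩`; where `w ≠ 0` the field `T` is geodesic and `T(ψ) = -ψ² - ⟨η, ζ⟩ - c`.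

Suppose `w ≥ w₀ > 0` and `⟨η, ζ⟩ + c < 0`. Orienting `T` so that `ψ ≥ 0`, the quotient `Q = ψⁿ/w`
increases along `T`. On a set `{Q ≥ q}` with `q > 0` the function `ψ` is bounded below, so there `w`
decreases along `T` at a definite rate without leaving the set, although it is bounded below: by
Ekeland's variational principle this contradicts completeness. If `R` violates one of the bounds,
then `w ≥ w₀ > 0` and `⟨η, ζ⟩ + c < 0` hold. In the compact case with `ρ = 0`, the linear equation
for `w` makes `{w = 0}` open and closed; it is not everything, because at a maximum of `|f|²`
(if `c = 0`) or of the timelike coordinate of `f` (if `c < 0`) the vector `ζ` cannot vanish.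
-/

section Calculus

variable {𝕜 : Type*} [NontriviallyNormedField 𝕜]
  {E : Type*} [NormedAddCommGroup E] [NormedSpace 𝕜 E]
  {A : Type*} [NormedAddCommGroup A] [NormedSpace 𝕜 A]
  {A' : Type*} [NormedAddCommGroup A'] [NormedSpace 𝕜 A']
  {W : Type*} [NormedAddCommGroup W] [NormedSpace 𝕜 W]

theorem fderiv_bilinear_apply (B : A →L[𝕜] A' →L[𝕜] W) {p : E → A} {q : E → A'} {u : E}
    (hp : DifferentiableAt 𝕜 p u) (hq : DifferentiableAt 𝕜 q u) (z : E) :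
    fderiv 𝕜 (fun x => B (p x) (q x)) u z
      = B (fderiv 𝕜 p u z) (q u) + B (p u) (fderiv 𝕜 q u z) := by
  rw [(B.hasFDerivAt_of_bilinear hp.hasFDerivAt hq.hasFDerivAt).fderiv]
  simp [add_comm]

theorem differentiableAt_bilinear (B : A →L[𝕜] A' →L[𝕜] W) {p : E → A} {q : E → A'} {u : E}
    (hp : DifferentiableAt 𝕜 p u) (hq : DifferentiableAt 𝕜 q u) :
    DifferentiableAt 𝕜 (fun x => B (p x) (q x)) u :=
  (B.hasFDerivAt_of_bilinear hp.hasFDerivAt hq.hasFDerivAt).differentiableAt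

theorem contDiffOn_bilinear (B : A →L[𝕜] A' →L[𝕜] W) {p : E → A} {q : E → A'} {Ω : Set E}
    {r : WithTop ℕ∞} (hp : ContDiffOn 𝕜 r p Ω) (hq : ContDiffOn 𝕜 r q Ω) :
    ContDiffOn 𝕜 r (fun x => B (p x) (q x)) Ω :=
  (B.contDiff.comp_contDiffOn hp).clm_apply hq

theorem fderiv_clm_apply_const {L : E → A →L[𝕜] W} {u : E} (h : DifferentiableAt 𝕜 L u)
    (v : A) (z : E) : fderiv 𝕜 (fun x => L x v) u z = fderiv 𝕜 L u z v := by
  rw [fderiv_clm_apply h (differentiableAt_const v)]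
  simp

theorem fderiv_eq_of_eqOn_isOpen {Ω : Set E} (hΩ : IsOpen Ω) {u : E} (hu : u ∈ Ω) {p q : E → W}
    (h : Set.EqOn p q Ω) : fderiv 𝕜 p u = fderiv 𝕜 q u :=
  (h.eventuallyEq_of_mem (hΩ.mem_nhds hu)).fderiv_eq

theorem fderiv_eq_zero_of_eqOn_const {Ω : Set E} (hΩ : IsOpen Ω) {u : E} (hu : u ∈ Ω) {p : E → W}
    {a : W} (h : ∀ x ∈ Ω, p x = a) : fderiv 𝕜 p u = 0 := by
  rw [fderiv_eq_of_eqOn_isOpen hΩ hu (q := fun _ => a) h, fderiv_const_apply]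

theorem contDiffOn_infty_fderiv {Ω : Set E} (hΩ : IsOpen Ω) {p : E → W}
    (h : ContDiffOn 𝕜 ∞ p Ω) : ContDiffOn 𝕜 ∞ (fderiv 𝕜 p) Ω :=
  h.fderiv_of_isOpen hΩ (by simp)

theorem differentiableAt_of_contDiffOn_infty {Ω : Set E} (hΩ : IsOpen Ω) {u : E} (hu : u ∈ Ω)
    {p : E → W} (h : ContDiffOn 𝕜 ∞ p Ω) : DifferentiableAt 𝕜 p u :=
  (h.contDiffAt (hΩ.mem_nhds hu)).differentiableAt (by simp)

end Calculus

theorem fderiv_fderiv_comm {E W : Type*} [NormedAddCommGroup E] [NormedSpace ℝ E]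
    [NormedAddCommGroup W] [NormedSpace ℝ W] {Ω : Set E} (hΩ : IsOpen Ω) {u : E} (hu : u ∈ Ω)
    {p : E → W} (h : ContDiffOn ℝ ∞ p Ω) (v w : E) :
    fderiv ℝ (fderiv ℝ p) u v w = fderiv ℝ (fderiv ℝ p) u w v :=
  (h.contDiffAt (hΩ.mem_nhds hu)).isSymmSndFDerivAt
    (by simpa using WithTop.coe_le_coe.2 (le_top : (2 : ℕ∞) ≤ ⊤)) v w

section LocalImmersion

variable {E A : Type*} [NormedAddCommGroup E] [NormedSpace ℝ E]
  [NormedAddCommGroup A] [NormedSpace ℝ A]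

/-- The first fundamental form `⟨dF(v), dF(w)⟩` of `F` at `u`. -/
noncomputable def inducedMetric (B : A →L[ℝ] A →L[ℝ] ℝ) (F : E → A) (u : E) :
    E →L[ℝ] E →L[ℝ] ℝ :=
  B.bilinearComp (fderiv ℝ F u) (fderiv ℝ F u)

theorem inducedMetric_apply (B : A →L[ℝ] A →L[ℝ] ℝ) (F : E → A) (u v w : E) :
    inducedMetric B F u v w = B (fderiv ℝ F u v) (fderiv ℝ F u w) := rfl

/-- The vector field `dF(T)` along `F`. -/
noncomputable def pushforward (F : E → A) (T : E → E) (u : E) : A :=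
  fderiv ℝ F u (T u)

/-- `⟨∇_z T, v⟩` at `u`, where `∇` is the Levi-Civita connection of the metric induced by `F`: it
is the tangential part of the derivative of `dF(T)`. -/
noncomputable def connectionForm (B : A →L[ℝ] A →L[ℝ] ℝ) (F : E → A) (T : E → E) (u : E) :
    E →L[ℝ] E →L[ℝ] ℝ :=
  B.bilinearComp (fderiv ℝ (pushforward F T) u) (fderiv ℝ F u)

theorem connectionForm_apply (B : A →L[ℝ] A →L[ℝ] ℝ) (F : E → A) (T : E → E) (u z v : E) :
    connectionForm B F T u z v = B (fderiv ℝ (pushforward F T) u z) (fderiv ℝ F u v) := rfl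

/-- `ξ` is orthogonal to the immersion `F` at `u` and tangent to the space form of curvature `c`;
the factor `c` in the second condition makes it void for `c = 0`. -/
structure IsNormalVector (B : A →L[ℝ] A →L[ℝ] ℝ) (c : ℝ) (F : E → A) (u : E) (ξ : A) : Prop where
  orthogonal : ∀ v, B ξ (fderiv ℝ F u v) = 0
  radial : c * B ξ (F u) = 0

theorem IsNormalVector.sub {B : A →L[ℝ] A →L[ℝ] ℝ} {c : ℝ} {F : E → A} {u : E} {ξ ξ' : A}
    (h : IsNormalVector B c F u ξ) (h' : IsNormalVector B c F u ξ') :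
    IsNormalVector B c F u (ξ - ξ') where
  orthogonal v := by rw [map_sub, sub_apply, h.orthogonal, h'.orthogonal, sub_zero]
  radial := by rw [map_sub, sub_apply, mul_sub, h.radial, h'.radial, sub_zero]

/-- A smooth normal field of `F` on `Ω`. -/
structure IsNormalField (B : A →L[ℝ] A →L[ℝ] ℝ) (c : ℝ) (F : E → A) (Ω : Set E) (ξ : E → A) :
    Prop where
  smooth : ContDiffOn ℝ ∞ ξ Ω
  normal : ∀ u ∈ Ω, IsNormalVector B c F u (ξ u)

theorem IsNormalField.sub {B : A →L[ℝ] A →L[ℝ] ℝ} {c : ℝ} {F : E → A} {Ω : Set E} {ξ ξ' : E → A}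
    (h : IsNormalField B c F Ω ξ) (h' : IsNormalField B c F Ω ξ') :
    IsNormalField B c F Ω fun u => ξ u - ξ' u where
  smooth := h.smooth.sub h'.smooth
  normal u hu := (h.normal u hu).sub (h'.normal u hu)

/-- `F` is a smooth immersion of the open set `Ω` with positive definite induced metric into a space
form of curvature `c`, of which only the orthogonality of the tangent vectors to the position
vector `F` is recorded (a void condition when `c = 0`). -/
structure IsLocalImmersion (B : A →L[ℝ] A →L[ℝ] ℝ) (c : ℝ) (F : E → A) (Ω : Set E) : Prop where
  isOpen : IsOpen Ω
  smooth : ContDiffOn ℝ ∞ F Ω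
  symm : ∀ p q, B p q = B q p
  pos : ∀ u ∈ Ω, ∀ v, v ≠ 0 → 0 < inducedMetric B F u v v
  radial : ∀ u ∈ Ω, ∀ v, c * B (F u) (fderiv ℝ F u v) = 0

namespace IsLocalImmersion

variable {B : A →L[ℝ] A →L[ℝ] ℝ} {c : ℝ} {F : E → A} {Ω : Set E}
  (h : IsLocalImmersion B c F Ω) {u : E} (hu : u ∈ Ω)

include h

theorem mono {Ω' : Set E} (hΩ : IsOpen Ω') (hs : Ω' ⊆ Ω) : IsLocalImmersion B c F Ω' :=
  ⟨hΩ, h.smooth.mono hs, h.symm, fun u hu => h.pos u (hs hu), fun u hu => h.radial u (hs hu)⟩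

theorem inducedMetric_symm (u v w : E) : inducedMetric B F u v w = inducedMetric B F u w v :=
  h.symm _ _

theorem contDiffOn_fderiv : ContDiffOn ℝ ∞ (fderiv ℝ F) Ω :=
  contDiffOn_infty_fderiv h.isOpen h.smooth

theorem contDiffOn_fderiv_fderiv : ContDiffOn ℝ ∞ (fderiv ℝ (fderiv ℝ F)) Ω :=
  contDiffOn_infty_fderiv h.isOpen h.contDiffOn_fderiv

include hu

theorem differentiableAt : DifferentiableAt ℝ F u :=
  differentiableAt_of_contDiffOn_infty h.isOpen hu h.smooth

theorem differentiableAt_fderiv : DifferentiableAt ℝ (fderiv ℝ F) u :=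
  differentiableAt_of_contDiffOn_infty h.isOpen hu h.contDiffOn_fderiv

theorem differentiableAt_fderiv_fderiv_apply (v w : E) :
    DifferentiableAt ℝ (fun x => fderiv ℝ (fderiv ℝ F) x v w) u :=
  ((differentiableAt_of_contDiffOn_infty h.isOpen hu h.contDiffOn_fderiv_fderiv).clm_apply
    (differentiableAt_const v)).clm_apply (differentiableAt_const w)

theorem fderiv_fderiv_fderiv_apply (v w z : E) :
    fderiv ℝ (fun x => fderiv ℝ (fderiv ℝ F) x v w) u z
      = fderiv ℝ (fderiv ℝ (fderiv ℝ F)) u z v w := by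
  have hS := differentiableAt_of_contDiffOn_infty h.isOpen hu h.contDiffOn_fderiv_fderiv
  rw [fderiv_clm_apply_const (hS.clm_apply (differentiableAt_const v)), fderiv_clm_apply_const hS]

theorem differentiableAt_fderiv_apply (v : E) : DifferentiableAt ℝ (fun x => fderiv ℝ F x v) u :=
  (h.differentiableAt_fderiv hu).clm_apply (differentiableAt_const v)

theorem fderiv_fderiv_symm (v w : E) :
    fderiv ℝ (fderiv ℝ F) u v w = fderiv ℝ (fderiv ℝ F) u w v :=
  fderiv_fderiv_comm h.isOpen hu h.smooth v w

theorem differentiableAt_inducedMetric (v w : E) :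
    DifferentiableAt ℝ (fun x => inducedMetric B F x v w) u :=
  differentiableAt_bilinear B (h.differentiableAt_fderiv_apply hu v)
    (h.differentiableAt_fderiv_apply hu w)

theorem fderiv_inducedMetric (v w z : E) :
    fderiv ℝ (fun x => inducedMetric B F x v w) u z
      = B (fderiv ℝ (fderiv ℝ F) u z v) (fderiv ℝ F u w)
        + B (fderiv ℝ (fderiv ℝ F) u z w) (fderiv ℝ F u v) := by
  simp only [inducedMetric_apply]
  rw [fderiv_bilinear_apply B (h.differentiableAt_fderiv_apply hu v)
      (h.differentiableAt_fderiv_apply hu w),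
    fderiv_clm_apply_const (h.differentiableAt_fderiv hu),
    fderiv_clm_apply_const (h.differentiableAt_fderiv hu), h.symm (fderiv ℝ F u v)]

theorem radial_fderiv {τ : E → A} (hτ : DifferentiableAt ℝ τ u)
    (hr : ∀ x ∈ Ω, c * B (F x) (τ x) = 0) (z : E) :
    c * B (F u) (fderiv ℝ τ u z) = -(c * B (fderiv ℝ F u z) (τ u)) := by
  have h1 := DFunLike.congr_fun (fderiv_eq_zero_of_eqOn_const (𝕜 := ℝ) h.isOpen hu hr) z
  simp only [fderiv_const_mul (differentiableAt_bilinear B (h.differentiableAt hu) hτ), smul_apply,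
    smul_eq_mul, fderiv_bilinear_apply B (h.differentiableAt hu) hτ, zero_apply] at h1
  linear_combination h1

theorem radial_fderiv_fderiv (v w : E) :
    c * B (F u) (fderiv ℝ (fderiv ℝ F) u v w) = -(c * inducedMetric B F u v w) := by
  rw [inducedMetric_apply, ← fderiv_clm_apply_const (h.differentiableAt_fderiv hu)]
  exact h.radial_fderiv hu (h.differentiableAt_fderiv_apply hu w) (fun x hx => h.radial x hx w) v

theorem differentiableAt_normalField {ξ : E → A} (hξ : IsNormalField B c F Ω ξ) :
    DifferentiableAt ℝ ξ u :=
  differentiableAt_of_contDiffOn_infty h.isOpen hu hξ.smooth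

theorem inner_fderiv_normalField {ξ : E → A} (hξ : IsNormalField B c F Ω ξ) {T : E → E}
    (hT : DifferentiableAt ℝ (pushforward F T) u) (z : E) :
    B (fderiv ℝ ξ u z) (pushforward F T u) = -B (ξ u) (fderiv ℝ (pushforward F T) u z) := by
  have h1 := DFunLike.congr_fun (fderiv_eq_zero_of_eqOn_const (𝕜 := ℝ) h.isOpen hu
    fun x hx => (hξ.normal x hx).orthogonal (T x)) z
  rw [← eq_neg_iff_add_eq_zero.2]
  rwa [← fderiv_bilinear_apply B (h.differentiableAt_normalField hu hξ) hT]

theorem weingarten {ξ : E → A} (hξ : IsNormalField B c F Ω ξ) (v z : E) :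
    B (fderiv ℝ ξ u z) (fderiv ℝ F u v) = -B (ξ u) (fderiv ℝ (fderiv ℝ F) u z v) := by
  rw [← fderiv_clm_apply_const (h.differentiableAt_fderiv hu)]
  exact h.inner_fderiv_normalField hu hξ (T := fun _ => v) (h.differentiableAt_fderiv_apply hu v) z

theorem radial_fderiv_normalField {ξ : E → A} (hξ : IsNormalField B c F Ω ξ) (z : E) :
    c * B (fderiv ℝ ξ u z) (F u) = 0 := by
  rw [h.symm, h.radial_fderiv hu (h.differentiableAt_normalField hu hξ)
    fun x hx => by rw [h.symm, (hξ.normal x hx).radial], h.symm, (hξ.normal u hu).orthogonal]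
  simp

end IsLocalImmersion

end LocalImmersion

section PrincipalFrame

variable {E A : Type*} [NormedAddCommGroup E] [NormedSpace ℝ E]
  [NormedAddCommGroup A] [NormedSpace ℝ A]

/-- `T` is a unit vector, and `η`, `ζ` are distinct normal vectors at `u` of the immersion `F` into
a space form of curvature `c`, such that the second fundamental form is
`⟨v, w⟩ ζ + ⟨v, T⟩ ⟨w, T⟩ (η - ζ)`: these are the principal normals, with `T` spanning `E_η`. The
vector `γ` in the Gauss formula is `∇_v w`. -/
structure IsPrincipalFrameAt (B : A →L[ℝ] A →L[ℝ] ℝ) (c : ℝ) (F : E → A) (u : E) (T : E)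
    (η ζ : A) : Prop where
  unit : inducedMetric B F u T T = 1
  normal_eta : IsNormalVector B c F u η
  normal_zeta : IsNormalVector B c F u ζ
  diff_pos : 0 < B (η - ζ) (η - ζ)
  gauss_formula : ∀ v w, ∃ γ, fderiv ℝ (fderiv ℝ F) u v w = fderiv ℝ F u γ
    + inducedMetric B F u v w • ζ
    + (inducedMetric B F u v T * inducedMetric B F u w T) • (η - ζ)
    - (c * inducedMetric B F u v w) • F u

/-- A principal frame varying smoothly over the open set `Ω`. -/
structure IsPrincipalFrame (B : A →L[ℝ] A →L[ℝ] ℝ) (c : ℝ) (F : E → A) (Ω : Set E) (T : E → E)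
    (η ζ : E → A) : Prop extends IsLocalImmersion B c F Ω where
  smooth_T : ContDiffOn ℝ ∞ T Ω
  smooth_eta : ContDiffOn ℝ ∞ η Ω
  smooth_zeta : ContDiffOn ℝ ∞ ζ Ω
  frame : ∀ u ∈ Ω, IsPrincipalFrameAt B c F u (T u) (η u) (ζ u)

theorem IsPrincipalFrameAt.inner_normal_second {B : A →L[ℝ] A →L[ℝ] ℝ} {c : ℝ} {F : E → A}
    {u T : E} {η ζ : A} (h : IsPrincipalFrameAt B c F u T η ζ) {ξ : A}
    (hξ : IsNormalVector B c F u ξ) (v w : E) :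
    B ξ (fderiv ℝ (fderiv ℝ F) u v w) = inducedMetric B F u v w * B ξ ζ
      + inducedMetric B F u v T * inducedMetric B F u w T * B ξ (η - ζ) := by
  obtain ⟨γ, hγ⟩ := h.gauss_formula v w
  rw [hγ, map_sub, map_add, map_add, hξ.orthogonal, map_smul, map_smul, map_smul]
  simp only [smul_eq_mul, zero_add]
  linear_combination -(inducedMetric B F u v w) * hξ.radial

theorem IsLocalImmersion.exists_gauss_formula {B : A →L[ℝ] A →L[ℝ] ℝ} {c : ℝ} {F : E → A}
    {Ω : Set E} (hF : IsLocalImmersion B c F Ω) {u T : E} (hu : u ∈ Ω) {η ζ : A}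
    (h : IsPrincipalFrameAt B c F u T η ζ) (v w : E) :
    ∃ γ, fderiv ℝ (fderiv ℝ F) u v w = fderiv ℝ F u γ + inducedMetric B F u v w • ζ
        + (inducedMetric B F u v T * inducedMetric B F u w T) • (η - ζ)
        - (c * inducedMetric B F u v w) • F u ∧
      ∀ y, B (fderiv ℝ (fderiv ℝ F) u v w) (fderiv ℝ F u y) = inducedMetric B F u γ y := by
  obtain ⟨γ, hγ⟩ := h.gauss_formula v w
  refine ⟨γ, hγ, fun y => ?_⟩
  rw [hγ]
  simp only [map_add, map_sub, map_smul, add_apply, sub_apply, smul_apply, smul_eq_mul,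
    h.normal_eta.orthogonal, h.normal_zeta.orthogonal]
  rw [inducedMetric_apply B F u γ]
  linear_combination -(inducedMetric B F u v w) * hF.radial u hu y

namespace IsPrincipalFrame

variable {B : A →L[ℝ] A →L[ℝ] ℝ} {c : ℝ} {F : E → A} {Ω : Set E} {T : E → E} {η ζ : E → A}
  (h : IsPrincipalFrame B c F Ω T η ζ) {u : E} (hu : u ∈ Ω)

include h

theorem normalField_eta : IsNormalField B c F Ω η :=
  ⟨h.smooth_eta, fun u hu => (h.frame u hu).normal_eta⟩

theorem normalField_zeta : IsNormalField B c F Ω ζ :=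
  ⟨h.smooth_zeta, fun u hu => (h.frame u hu).normal_zeta⟩

theorem normalField_diff : IsNormalField B c F Ω fun u => η u - ζ u :=
  h.normalField_eta.sub h.normalField_zeta

theorem contDiffOn_pushforward : ContDiffOn ℝ ∞ (pushforward F T) Ω :=
  h.contDiffOn_fderiv.clm_apply h.smooth_T

include hu

theorem differentiableAt_pushforward : DifferentiableAt ℝ (pushforward F T) u :=
  differentiableAt_of_contDiffOn_infty h.isOpen hu h.contDiffOn_pushforward

theorem differentiableAt_eta : DifferentiableAt ℝ η u :=
  h.differentiableAt_normalField hu h.normalField_eta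

theorem differentiableAt_zeta : DifferentiableAt ℝ ζ u :=
  h.differentiableAt_normalField hu h.normalField_zeta

theorem differentiableAt_inner_T (v : E) :
    DifferentiableAt ℝ (fun x => inducedMetric B F x v (T x)) u :=
  differentiableAt_bilinear B (h.differentiableAt_fderiv_apply hu v)
    (h.differentiableAt_pushforward hu)

theorem fderiv_inner_T (v z : E) :
    fderiv ℝ (fun x => inducedMetric B F x v (T x)) u z
      = B (fderiv ℝ (fderiv ℝ F) u z v) (fderiv ℝ F u (T u)) + connectionForm B F T u z v := by
  rw [connectionForm_apply, h.symm _ (fderiv ℝ F u v),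
    ← fderiv_clm_apply_const (h.differentiableAt_fderiv hu)]
  exact fderiv_bilinear_apply B (h.differentiableAt_fderiv_apply hu v)
    (h.differentiableAt_pushforward hu) z

theorem connectionForm_T (z : E) : connectionForm B F T u z (T u) = 0 := by
  have hτ := h.differentiableAt_pushforward hu
  have h1 := DFunLike.congr_fun (fderiv_eq_zero_of_eqOn_const (𝕜 := ℝ) h.isOpen hu
    fun x hx => (h.frame x hx).unit) z
  have h2 := fderiv_bilinear_apply B hτ hτ z
  rw [h.symm (pushforward F T u)] at h2
  have h3 : 2 * connectionForm B F T u z (T u) = 0 := by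
    rw [two_mul]
    exact h2.symm.trans h1
  linarith

theorem inner_fderiv_normal_second {ξ : E → A} (hξ : IsNormalField B c F Ω ξ) (z v w : E) :
    B (fderiv ℝ ξ u z) (fderiv ℝ (fderiv ℝ F) u v w)
      = inducedMetric B F u v w * B (fderiv ℝ ξ u z) (ζ u)
        + inducedMetric B F u v (T u) * inducedMetric B F u w (T u)
          * B (fderiv ℝ ξ u z) (η u - ζ u)
        - (B (fderiv ℝ (fderiv ℝ F) u v w) (fderiv ℝ F u z) * B (ξ u) (ζ u)
          + inducedMetric B F u z (T u)
            * B (fderiv ℝ (fderiv ℝ F) u v w) (fderiv ℝ F u (T u)) * B (ξ u) (η u - ζ u)) := by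
  obtain ⟨γ, hγ, hγt⟩ := h.exists_gauss_formula hu (h.frame u hu) v w
  rw [hγt, hγt, hγ, map_sub, map_add, map_add, map_smul, map_smul, map_smul,
    h.weingarten hu hξ, (h.frame u hu).inner_normal_second (hξ.normal u hu) z γ,
    h.inducedMetric_symm u γ z]
  simp only [smul_eq_mul]
  linear_combination -(inducedMetric B F u v w) * h.radial_fderiv_normalField hu hξ z

theorem fderiv_inner_normal_second {ξ : E → A} (hξ : IsNormalField B c F Ω ξ) (z v w : E) :
    fderiv ℝ (fun x => B (ξ x) (fderiv ℝ (fderiv ℝ F) x v w)) u z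
      = fderiv ℝ (fun x => inducedMetric B F x v w) u z * B (ξ u) (ζ u)
        + inducedMetric B F u v w * fderiv ℝ (fun x => B (ξ x) (ζ x)) u z
        + (fderiv ℝ (fun x => inducedMetric B F x v (T x)) u z * inducedMetric B F u w (T u)
          + inducedMetric B F u v (T u) * fderiv ℝ (fun x => inducedMetric B F x w (T x)) u z)
          * B (ξ u) (η u - ζ u)
        + inducedMetric B F u v (T u) * inducedMetric B F u w (T u)
          * fderiv ℝ (fun x => B (ξ x) (η x - ζ x)) u z := by
  have hvw := h.differentiableAt_inducedMetric hu v w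
  have hv := h.differentiableAt_inner_T hu v
  have hw := h.differentiableAt_inner_T hu w
  have hξ' := h.differentiableAt_normalField hu hξ
  have hξζ := differentiableAt_bilinear B hξ' (h.differentiableAt_zeta hu)
  have hξδ := differentiableAt_bilinear B hξ' (h.differentiableAt_normalField hu h.normalField_diff)
  rw [fderiv_eq_of_eqOn_isOpen h.isOpen hu fun x hx =>
      (h.frame x hx).inner_normal_second (hξ.normal x hx) v w,
    fderiv_fun_add (hvw.fun_mul hξζ) ((hv.fun_mul hw).fun_mul hξδ), fderiv_fun_mul hvw hξζ,
    fderiv_fun_mul (hv.fun_mul hw) hξδ, fderiv_fun_mul hv hw]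
  simp only [add_apply, smul_apply, smul_eq_mul]
  ring

theorem inner_normal_third {ξ : E → A} (hξ : IsNormalField B c F Ω ξ) (z v w : E) :
    B (ξ u) (fderiv ℝ (fderiv ℝ (fderiv ℝ F)) u z v w)
      = (B (fderiv ℝ (fderiv ℝ F) u v w) (fderiv ℝ F u z)
          + B (fderiv ℝ (fderiv ℝ F) u z v) (fderiv ℝ F u w)
          + B (fderiv ℝ (fderiv ℝ F) u z w) (fderiv ℝ F u v)) * B (ξ u) (ζ u)
        + (inducedMetric B F u z (T u) * B (fderiv ℝ (fderiv ℝ F) u v w) (fderiv ℝ F u (T u))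
          + inducedMetric B F u w (T u) * B (fderiv ℝ (fderiv ℝ F) u z v) (fderiv ℝ F u (T u))
          + inducedMetric B F u v (T u) * B (fderiv ℝ (fderiv ℝ F) u z w) (fderiv ℝ F u (T u)))
          * B (ξ u) (η u - ζ u)
        + (inducedMetric B F u v w * B (ξ u) (fderiv ℝ ζ u z)
          + (connectionForm B F T u z v * inducedMetric B F u w (T u)
            + inducedMetric B F u v (T u) * connectionForm B F T u z w) * B (ξ u) (η u - ζ u)
          + inducedMetric B F u v (T u) * inducedMetric B F u w (T u)
            * B (ξ u) (fderiv ℝ η u z - fderiv ℝ ζ u z)) := by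
  have hξ' := h.differentiableAt_normalField hu hξ
  have hη := h.differentiableAt_eta hu
  have hζ := h.differentiableAt_zeta hu
  have key := h.fderiv_inner_normal_second hu hξ z v w
  rw [fderiv_bilinear_apply B hξ' (h.differentiableAt_fderiv_fderiv_apply hu v w),
    h.fderiv_fderiv_fderiv_apply hu, h.inner_fderiv_normal_second hu hξ,
    h.fderiv_inducedMetric hu, h.fderiv_inner_T hu, h.fderiv_inner_T hu,
    fderiv_bilinear_apply B hξ' hζ, fderiv_bilinear_apply B hξ' (hη.fun_sub hζ),
    fderiv_fun_sub hη hζ, sub_apply] at key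
  linear_combination key

theorem codazzi {ξ : E → A} (hξ : IsNormalField B c F Ω ξ) (z v w : E) :
    inducedMetric B F u v w * B (ξ u) (fderiv ℝ ζ u z)
        + (connectionForm B F T u z v * inducedMetric B F u w (T u)
          + inducedMetric B F u v (T u) * connectionForm B F T u z w) * B (ξ u) (η u - ζ u)
        + inducedMetric B F u v (T u) * inducedMetric B F u w (T u)
          * B (ξ u) (fderiv ℝ η u z - fderiv ℝ ζ u z)
      = inducedMetric B F u z w * B (ξ u) (fderiv ℝ ζ u v)
        + (connectionForm B F T u v z * inducedMetric B F u w (T u)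
          + inducedMetric B F u z (T u) * connectionForm B F T u v w) * B (ξ u) (η u - ζ u)
        + inducedMetric B F u z (T u) * inducedMetric B F u w (T u)
          * B (ξ u) (fderiv ℝ η u v - fderiv ℝ ζ u v) := by
  have h1 := h.inner_normal_third hu hξ z v w
  rw [fderiv_fderiv_comm h.isOpen hu h.contDiffOn_fderiv z v, h.inner_normal_third hu hξ v z w,
    h.fderiv_fderiv_symm hu z v, h.fderiv_fderiv_symm hu z w, h.fderiv_fderiv_symm hu v w] at h1
  linear_combination -h1

end IsPrincipalFrame

end PrincipalFrame

section LocalRiccati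

theorem exists_ne_zero_of_two_functionals {K V : Type*} [Field K] [AddCommGroup V] [Module K V]
    [FiniteDimensional K V] (hV : 3 ≤ Module.finrank K V) (l₁ l₂ : V →ₗ[K] K) :
    ∃ y, y ≠ 0 ∧ l₁ y = 0 ∧ l₂ y = 0 := by
  have h : LinearMap.ker (l₁.prod l₂) ≠ ⊥ := by
    apply LinearMap.ker_ne_bot_of_finrank_lt
    rw [Module.finrank_prod, Module.finrank_self]
    omega
  obtain ⟨y, hy, hy0⟩ := Submodule.exists_mem_ne_zero_of_ne_bot h
  obtain ⟨h₁, h₂⟩ := Prod.mk_eq_zero.1 (LinearMap.mem_ker.1 hy)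
  exact ⟨y, hy0, h₁, h₂⟩

variable {E A : Type*} [NormedAddCommGroup E] [NormedSpace ℝ E]
  [NormedAddCommGroup A] [NormedSpace ℝ A]

/-- The function `ψ` with `∇_X T = ψ X` for all `X` orthogonal to `T`; by the Codazzi equation it
is the quotient of `⟨∇_T ζ, η - ζ⟩` by `⟨η - ζ, η - ζ⟩`. -/
noncomputable def umbilicity (B : A →L[ℝ] A →L[ℝ] ℝ) (T : E → E) (η ζ : E → A) (u : E) : ℝ :=
  B (fderiv ℝ ζ u (T u)) (η u - ζ u) / B (η u - ζ u) (η u - ζ u)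

namespace IsPrincipalFrame

variable {B : A →L[ℝ] A →L[ℝ] ℝ} {c : ℝ} {F : E → A} {Ω : Set E} {T : E → E} {η ζ : E → A}
  (h : IsPrincipalFrame B c F Ω T η ζ)

include h

theorem contDiffOn_umbilicity : ContDiffOn ℝ ∞ (umbilicity B T η ζ) Ω := by
  have hδ := h.normalField_diff.smooth
  exact (contDiffOn_bilinear B ((contDiffOn_infty_fderiv h.isOpen h.smooth_zeta).clm_apply
    h.smooth_T) hδ).div (contDiffOn_bilinear B hδ hδ) fun x hx => (h.frame x hx).diff_pos.ne'

variable {u : E} (hu : u ∈ Ω)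

include hu

theorem codazzi_T {ξ : E → A} (hξ : IsNormalField B c F Ω ξ) {X Y : E}
    (hX : inducedMetric B F u X (T u) = 0) (hY : inducedMetric B F u Y (T u) = 0) :
    inducedMetric B F u X Y * B (ξ u) (fderiv ℝ ζ u (T u))
      = connectionForm B F T u X Y * B (ξ u) (η u - ζ u) := by
  have hc := h.codazzi hu hξ (T u) X Y
  rw [hX, hY, (h.frame u hu).unit, h.inducedMetric_symm u (T u) Y, hY] at hc
  linear_combination hc

theorem connectionForm_orthogonal {X Y : E} (hX : inducedMetric B F u X (T u) = 0)
    (hY : inducedMetric B F u Y (T u) = 0) :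
    connectionForm B F T u X Y = umbilicity B T η ζ u * inducedMetric B F u X Y := by
  have hc := h.codazzi_T hu h.normalField_diff hX hY
  have hp := (h.frame u hu).diff_pos
  rw [umbilicity, h.symm (fderiv ℝ ζ u (T u))]
  field_simp
  linear_combination -hc

theorem inducedMetric_sub_smul_T (v : E) :
    inducedMetric B F u (v - inducedMetric B F u v (T u) • T u) (T u) = 0 := by
  rw [map_sub, map_smul, sub_apply, smul_apply, (h.frame u hu).unit, smul_eq_mul, mul_one, sub_self]

variable [FiniteDimensional ℝ E] (hE : 3 ≤ Module.finrank ℝ E)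

include hE

theorem exists_orthogonal (X : E) : ∃ Y, 0 < inducedMetric B F u Y Y ∧
    inducedMetric B F u Y (T u) = 0 ∧ inducedMetric B F u X Y = 0 := by
  obtain ⟨Y, hY, hTY, hXY⟩ := exists_ne_zero_of_two_functionals hE
    (inducedMetric B F u (T u)).toLinearMap (inducedMetric B F u X).toLinearMap
  exact ⟨Y, h.pos u hu Y hY, (h.inducedMetric_symm u _ _).trans hTY, hXY⟩

theorem inner_fderiv_zeta_orthogonal {ξ : E → A} (hξ : IsNormalField B c F Ω ξ) {X : E}
    (hX : inducedMetric B F u X (T u) = 0) : B (ξ u) (fderiv ℝ ζ u X) = 0 := by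
  obtain ⟨Y, hY, hYT, hXY⟩ := h.exists_orthogonal hu hE X
  have hc := h.codazzi hu hξ X Y Y
  rw [hX, hYT, hXY] at hc
  apply mul_left_cancel₀ hY.ne'
  linear_combination hc

theorem inner_fderiv_zeta_T {ξ : E → A} (hξ : IsNormalField B c F Ω ξ) :
    B (ξ u) (fderiv ℝ ζ u (T u)) = umbilicity B T η ζ u * B (ξ u) (η u - ζ u) := by
  obtain ⟨Y, hY, hYT, -⟩ := h.exists_orthogonal hu hE 0
  have hc := h.codazzi_T hu hξ hYT hYT
  rw [h.connectionForm_orthogonal hu hYT hYT] at hc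
  apply mul_left_cancel₀ hY.ne'
  linear_combination hc

theorem inner_fderiv_zeta {ξ : E → A} (hξ : IsNormalField B c F Ω ξ) (v : E) :
    B (ξ u) (fderiv ℝ ζ u v)
      = umbilicity B T η ζ u * inducedMetric B F u v (T u) * B (ξ u) (η u - ζ u) := by
  have h1 := h.inner_fderiv_zeta_orthogonal hu hE hξ (h.inducedMetric_sub_smul_T hu v)
  rw [map_sub, map_smul, map_sub, map_smul, h.inner_fderiv_zeta_T hu hE hξ, smul_eq_mul] at h1
  linear_combination h1

theorem inner_fderiv_eta_orthogonal {ξ : E → A} (hξ : IsNormalField B c F Ω ξ) {X : E}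
    (hX : inducedMetric B F u X (T u) = 0) :
    B (ξ u) (fderiv ℝ η u X) = connectionForm B F T u (T u) X * B (ξ u) (η u - ζ u) := by
  have hc := h.codazzi hu hξ X (T u) (T u)
  have h0 := h.inner_fderiv_zeta_orthogonal hu hE hξ hX
  rw [hX, (h.frame u hu).unit, h.connectionForm_T hu, h.connectionForm_T hu, h0,
    map_sub (B (ξ u)) (fderiv ℝ η u X), h0] at hc
  linear_combination hc

theorem fderiv_inner_zeta_zeta (v : E) :
    fderiv ℝ (fun x => B (ζ x) (ζ x)) u v
      = 2 * umbilicity B T η ζ u * inducedMetric B F u v (T u)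
        * (B (η u) (ζ u) - B (ζ u) (ζ u)) := by
  have hζ := h.differentiableAt_zeta hu
  rw [fderiv_bilinear_apply B hζ hζ, h.symm (fderiv ℝ ζ u v),
    h.inner_fderiv_zeta hu hE h.normalField_zeta, map_sub, h.symm (η u)]
  ring

theorem fderiv_inner_eta_zeta_orthogonal {X : E} (hX : inducedMetric B F u X (T u) = 0) :
    fderiv ℝ (fun x => B (η x) (ζ x)) u X
      = connectionForm B F T u (T u) X * (B (η u) (ζ u) - B (ζ u) (ζ u)) := by
  rw [fderiv_bilinear_apply B (h.differentiableAt_eta hu) (h.differentiableAt_zeta hu),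
    h.symm (fderiv ℝ η u X), h.inner_fderiv_eta_orthogonal hu hE h.normalField_zeta hX,
    h.inner_fderiv_zeta_orthogonal hu hE h.normalField_eta hX, map_sub, h.symm (η u)]
  ring

omit [FiniteDimensional ℝ E] hE in
theorem inner_fderiv_pushforward_normal {ξ : E → A} (hξ : IsNormalField B c F Ω ξ) (z : E) :
    B (fderiv ℝ (pushforward F T) u z) (ξ u)
      = inducedMetric B F u z (T u) * B (ξ u) (η u) := by
  have h1 := h.inner_fderiv_normalField hu hξ (h.differentiableAt_pushforward hu) z
  rw [pushforward, h.weingarten hu hξ,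
    (h.frame u hu).inner_normal_second (hξ.normal u hu), (h.frame u hu).unit, map_sub] at h1
  rw [h.symm]
  linear_combination h1

omit [FiniteDimensional ℝ E] hE in
theorem inner_fderiv_pushforward_position (z : E) :
    c * B (fderiv ℝ (pushforward F T) u z) (F u) = -(c * inducedMetric B F u z (T u)) := by
  rw [h.symm]
  exact h.radial_fderiv hu (h.differentiableAt_pushforward hu)
    (fun x hx => h.radial x hx (T x)) z

section ConstantScalarCurvature

variable {ρ N : ℝ} (hρ : ∀ x ∈ Ω, 2 * B (η x) (ζ x) + (N - 2) * B (ζ x) (ζ x) = ρ)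

include hρ

theorem connectionForm_T_orthogonal (hw : N * B (ζ u) (ζ u) - ρ ≠ 0) {X : E}
    (hX : inducedMetric B F u X (T u) = 0) : connectionForm B F T u (T u) X = 0 := by
  have hηζ := differentiableAt_bilinear B (h.differentiableAt_eta hu) (h.differentiableAt_zeta hu)
  have hζζ := differentiableAt_bilinear B (h.differentiableAt_zeta hu) (h.differentiableAt_zeta hu)
  have h1 := DFunLike.congr_fun (fderiv_eq_zero_of_eqOn_const (𝕜 := ℝ) h.isOpen hu hρ) X
  rw [fderiv_fun_add (hηζ.const_mul 2) (hζζ.const_mul (N - 2)), fderiv_const_mul hηζ,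
    fderiv_const_mul hζζ] at h1
  simp only [add_apply, smul_apply, smul_eq_mul, zero_apply, h.fderiv_inner_zeta_zeta hu hE,
    h.fderiv_inner_eta_zeta_orthogonal hu hE hX, hX] at h1
  apply mul_right_cancel₀ hw
  linear_combination -h1 + connectionForm B F T u (T u) X * hρ u hu

theorem connectionForm_eq (hw : N * B (ζ u) (ζ u) - ρ ≠ 0) (z v : E) :
    connectionForm B F T u z v = umbilicity B T η ζ u * (inducedMetric B F u z v
      - inducedMetric B F u z (T u) * inducedMetric B F u v (T u)) := by
  have hv := h.inducedMetric_sub_smul_T hu v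
  have h1 := h.connectionForm_orthogonal hu (h.inducedMetric_sub_smul_T hu z) hv
  have h2 := h.connectionForm_T_orthogonal hu hE hρ hw hv
  simp only [map_sub, map_smul, sub_apply, smul_apply, smul_eq_mul, h.connectionForm_T hu,
    (h.frame u hu).unit, h.inducedMetric_symm u (T u) v] at h1 h2
  linear_combination h1 + inducedMetric B F u z (T u) * h2

theorem inner_fderiv_pushforward_second (hw : N * B (ζ u) (ζ u) - ρ ≠ 0) {X : E}
    (hX : inducedMetric B F u X (T u) = 0) (z y : E) :
    B (fderiv ℝ (pushforward F T) u y) (fderiv ℝ (fderiv ℝ F) u z X)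
      = umbilicity B T η ζ u * (B (fderiv ℝ (fderiv ℝ F) u z X) (fderiv ℝ F u y)
          - inducedMetric B F u y (T u)
            * B (fderiv ℝ (fderiv ℝ F) u z X) (fderiv ℝ F u (T u)))
        + inducedMetric B F u y (T u) * inducedMetric B F u z X * (B (η u) (ζ u) + c) := by
  obtain ⟨γ, hγ, hγt⟩ := h.exists_gauss_formula hu (h.frame u hu) z X
  have hσ := h.connectionForm_eq hu hE hρ hw y γ
  rw [connectionForm_apply] at hσ
  rw [hγt, hγt, hγ, hX]
  simp only [map_add, map_sub, map_smul, smul_eq_mul]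
  rw [hσ, h.inner_fderiv_pushforward_normal hu h.normalField_zeta, h.symm (ζ u) (η u),
    h.inducedMetric_symm u y γ]
  linear_combination -(inducedMetric B F u z X) * h.inner_fderiv_pushforward_position hu y

theorem inner_fderiv_fderiv_pushforward (hw : ∀ x ∈ Ω, N * B (ζ x) (ζ x) - ρ ≠ 0) {X : E}
    (hX : inducedMetric B F u X (T u) = 0) (z y : E) :
    B (fderiv ℝ (fderiv ℝ (pushforward F T)) u z y) (fderiv ℝ F u X)
      = fderiv ℝ (umbilicity B T η ζ) u z * inducedMetric B F u y X
        + umbilicity B T η ζ u * B (fderiv ℝ (fderiv ℝ F) u z y) (fderiv ℝ F u X)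
        - inducedMetric B F u y (T u) * inducedMetric B F u z X
          * (umbilicity B T η ζ u ^ 2 + B (η u) (ζ u) + c) := by
  have hψ := differentiableAt_of_contDiffOn_infty h.isOpen hu h.contDiffOn_umbilicity
  have hτ' := differentiableAt_of_contDiffOn_infty h.isOpen hu
    (contDiffOn_infty_fderiv h.isOpen h.contDiffOn_pushforward)
  have hg := h.differentiableAt_inducedMetric hu y X
  have hty := h.differentiableAt_inner_T hu y
  have htX := h.differentiableAt_inner_T hu X
  have h1 := DFunLike.congr_fun (fderiv_eq_of_eqOn_isOpen (𝕜 := ℝ) h.isOpen hu fun x hx =>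
    h.connectionForm_eq hx hE hρ (hw x hx) y X) z
  simp only [connectionForm_apply] at h1
  rw [fderiv_bilinear_apply B (hτ'.clm_apply (differentiableAt_const y))
      (h.differentiableAt_fderiv_apply hu X),
    fderiv_clm_apply_const (h.differentiableAt_fderiv hu), fderiv_clm_apply_const hτ',
    h.inner_fderiv_pushforward_second hu hE hρ (hw u hu) hX,
    fderiv_fun_mul hψ (hg.fun_sub (hty.fun_mul htX)), fderiv_fun_sub hg (hty.fun_mul htX),
    fderiv_fun_mul hty htX] at h1
  simp only [add_apply, sub_apply, smul_apply, smul_eq_mul] at h1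
  rw [h.fderiv_inducedMetric hu, h.fderiv_inner_T hu, h.fderiv_inner_T hu,
    h.connectionForm_eq hu hE hρ (hw u hu) z X, hX] at h1
  linear_combination h1

theorem riccati (hw : ∀ x ∈ Ω, N * B (ζ x) (ζ x) - ρ ≠ 0) :
    fderiv ℝ (umbilicity B T η ζ) u (T u)
      = -umbilicity B T η ζ u ^ 2 - B (η u) (ζ u) - c := by
  obtain ⟨X, hX, hXT, -⟩ := h.exists_orthogonal hu hE 0
  have h1 := h.inner_fderiv_fderiv_pushforward hu hE hρ hw hXT (T u) X
  rw [fderiv_fderiv_comm h.isOpen hu h.contDiffOn_pushforward (T u) X,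
    h.inner_fderiv_fderiv_pushforward hu hE hρ hw hXT X (T u), h.fderiv_fderiv_symm hu X,
    h.inducedMetric_symm u (T u) X, hXT, (h.frame u hu).unit] at h1
  apply mul_left_cancel₀ hX.ne'
  linear_combination -h1

end ConstantScalarCurvature

end IsPrincipalFrame

end LocalRiccati

section MatrixSmoothness

variable {𝕜 : Type*} [NontriviallyNormedField 𝕜] {E : Type*} [NormedAddCommGroup E]
  [NormedSpace 𝕜 E] {ι : Type*} [Fintype ι] [DecidableEq ι] {D : E → Matrix ι ι 𝕜} {Ω : Set E}
  {r : WithTop ℕ∞}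

theorem contDiffOn_matrix_det (h : ∀ i j, ContDiffOn 𝕜 r (fun u => D u i j) Ω) :
    ContDiffOn 𝕜 r (fun u => (D u).det) Ω := by
  simp only [Matrix.det_apply]
  exact ContDiffOn.sum fun σ _ => (contDiffOn_prod fun i _ => h (σ i) i).const_smul _

theorem contDiffOn_matrix_inv_apply (h : ∀ i j, ContDiffOn 𝕜 r (fun u => D u i j) Ω)
    (hD : ∀ u ∈ Ω, (D u).det ≠ 0) (i j : ι) : ContDiffOn 𝕜 r (fun u => (D u)⁻¹ i j) Ω := by
  have hCramer : (fun u => (D u)⁻¹ i j)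
      = fun u => ((D u).det)⁻¹ * ((D u).updateRow j (Pi.single i 1)).det := by
    ext u
    rw [Matrix.inv_def, Matrix.smul_apply, Matrix.adjugate_apply, Ring.inverse_eq_inv', smul_eq_mul]
  rw [hCramer]
  refine ((contDiffOn_matrix_det h).inv hD).mul (contDiffOn_matrix_det fun k l => ?_)
  by_cases hk : k = j
  · subst hk
    simp only [Matrix.updateRow_self]
    exact contDiffOn_const
  · simp only [Matrix.updateRow_ne hk]
    exact h k l

end MatrixSmoothness

section TracelessDyad

variable {K ι : Type*} [Field K] [Fintype ι] [DecidableEq ι] {G : Matrix ι ι K} {t : ι → K}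

/-- The traceless part, with respect to the metric `G`, of the dyad `t ⊗ t` of a unit covector. -/
def tracelessDyad (G : Matrix ι ι K) (t : ι → K) : Matrix ι ι K :=
  Matrix.vecMulVec t t - (Fintype.card ι : K)⁻¹ • G

theorem trace_inv_mul_vecMulVec (G : Matrix ι ι K) (x y : ι → K) :
    (G⁻¹ * Matrix.vecMulVec x y).trace = (G⁻¹ *ᵥ x) ⬝ᵥ y := by
  rw [Matrix.mul_vecMulVec, Matrix.trace_vecMulVec]

theorem trace_inv_mul_self (hG : IsUnit G.det) : (G⁻¹ * G).trace = Fintype.card ι := by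
  rw [Matrix.nonsing_inv_mul _ hG, Matrix.trace_one]

variable (hG : IsUnit G.det) (ht : (G⁻¹ *ᵥ t) ⬝ᵥ t = 1)

include hG ht

theorem tracelessDyad_mul_inv_mul_self :
    tracelessDyad G t * G⁻¹ * tracelessDyad G t
      = (1 - 2 / (Fintype.card ι : K)) • Matrix.vecMulVec t t
        + ((Fintype.card ι : K) ^ 2)⁻¹ • G := by
  have htt : Matrix.vecMulVec t t * G⁻¹ * Matrix.vecMulVec t t = Matrix.vecMulVec t t := by
    rw [Matrix.mul_assoc, Matrix.mul_vecMulVec, Matrix.vecMulVec_mul_vecMulVec,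
      dotProduct_comm, ht, one_smul]
  simp only [tracelessDyad, sub_mul, mul_sub, Matrix.smul_mul, Matrix.mul_smul, htt,
    Matrix.nonsing_inv_mul_cancel_right _ _ hG, Matrix.mul_nonsing_inv _ hG, one_mul, smul_smul]
  module

theorem trace_inv_mul_tracelessDyad_sq (hι : (Fintype.card ι : K) ≠ 0) :
    (G⁻¹ * (tracelessDyad G t * G⁻¹ * tracelessDyad G t)).trace
      = 1 - 1 / (Fintype.card ι : K) := by
  rw [tracelessDyad_mul_inv_mul_self hG ht, Matrix.mul_add, Matrix.trace_add, Matrix.mul_smul,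
    Matrix.mul_smul, Matrix.trace_smul, Matrix.trace_smul, trace_inv_mul_vecMulVec, ht,
    trace_inv_mul_self hG, smul_eq_mul, smul_eq_mul]
  field_simp
  ring

end TracelessDyad

section GramMatrix

variable {E A ι : Type*} [NormedAddCommGroup E] [NormedSpace ℝ E]
  [NormedAddCommGroup A] [NormedSpace ℝ A] [Fintype ι] [DecidableEq ι]

/-- The matrix of the induced metric in the basis `e`. -/
noncomputable def gramMatrix (B : A →L[ℝ] A →L[ℝ] ℝ) (e : Module.Basis ι ℝ E) (F : E → A) (u : E) :
    Matrix ι ι ℝ :=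
  Matrix.of fun i j => inducedMetric B F u (e i) (e j)

/-- The components in the basis `e` of the covector dual to `v` with respect to the induced
metric. -/
noncomputable def flat (B : A →L[ℝ] A →L[ℝ] ℝ) (e : Module.Basis ι ℝ E) (F : E → A) (u v : E) :
    ι → ℝ :=
  fun k => inducedMetric B F u (e k) v

/-- The vector dual, with respect to the induced metric, to the covector with components `a k` in
the basis `e`. -/
noncomputable def sharp (B : A →L[ℝ] A →L[ℝ] ℝ) (e : Module.Basis ι ℝ E) (F : E → A) (u : E)
    (a : ι → ℝ) : E :=
  e.equivFun.symm ((gramMatrix B e F u)⁻¹ *ᵥ a)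

/-- The part of `w` orthogonal to the image of the differential of `F`. -/
noncomputable def removeTangent (B : A →L[ℝ] A →L[ℝ] ℝ) (e : Module.Basis ι ℝ E) (F : E → A)
    (u : E) (w : A) : A :=
  w - fderiv ℝ F u (sharp B e F u fun k => B w (fderiv ℝ F u (e k)))

theorem sharp_smul (B : A →L[ℝ] A →L[ℝ] ℝ) (e : Module.Basis ι ℝ E) (F : E → A) (u : E) (s : ℝ)
    (a : ι → ℝ) : sharp B e F u (s • a) = s • sharp B e F u a := by
  rw [sharp, Matrix.mulVec_smul, map_smul, sharp]

theorem sharp_eq_sum (B : A →L[ℝ] A →L[ℝ] ℝ) (e : Module.Basis ι ℝ E) (F : E → A) (u : E)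
    (a : ι → ℝ) : sharp B e F u a = ∑ k, ∑ l, ((gramMatrix B e F u)⁻¹ k l * a l) • e k := by
  simp only [sharp, Module.Basis.equivFun_symm_apply, Matrix.mulVec, dotProduct, Finset.sum_smul]

namespace IsLocalImmersion

variable {B : A →L[ℝ] A →L[ℝ] ℝ} {c : ℝ} {F : E → A} {Ω : Set E}
  (h : IsLocalImmersion B c F Ω) (e : Module.Basis ι ℝ E)

include h

omit [Fintype ι] [DecidableEq ι] in
theorem isSymm_gramMatrix (u : E) : (gramMatrix B e F u).IsSymm :=
  Matrix.IsSymm.ext fun _ _ => h.symm _ _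

omit [DecidableEq ι] in
theorem gramMatrix_mulVec (u : E) (x : ι → ℝ) (i : ι) :
    (gramMatrix B e F u *ᵥ x) i = inducedMetric B F u (e.equivFun.symm x) (e i) := by
  simp only [Matrix.mulVec, dotProduct, gramMatrix, Matrix.of_apply,
    Module.Basis.equivFun_symm_apply, map_sum, map_smul, sum_apply, smul_apply, smul_eq_mul]
  exact Finset.sum_congr rfl fun j _ => by rw [h.inducedMetric_symm, mul_comm]

omit [Fintype ι] [DecidableEq ι] in
theorem contDiffOn_gramMatrix (i j : ι) : ContDiffOn ℝ ∞ (fun x => gramMatrix B e F x i j) Ω :=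
  contDiffOn_bilinear B (h.contDiffOn_fderiv.clm_apply contDiffOn_const)
    (h.contDiffOn_fderiv.clm_apply contDiffOn_const)

variable {u : E} (hu : u ∈ Ω)

omit [Fintype ι] [DecidableEq ι] in
include hu in
theorem eq_of_inducedMetric_basis_eq {v w : E}
    (hvw : ∀ i, inducedMetric B F u v (e i) = inducedMetric B F u w (e i)) : v = w := by
  have hext : inducedMetric B F u v = inducedMetric B F u w :=
    ContinuousLinearMap.coe_injective (e.ext hvw)
  have hdiff : inducedMetric B F u (v - w) = 0 := by rw [map_sub, hext, sub_self]
  by_contra hne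
  refine (h.pos u hu (v - w) (sub_ne_zero.2 hne)).ne' ?_
  rw [hdiff, zero_apply]

include hu in
theorem isUnit_det_gramMatrix : IsUnit (gramMatrix B e F u).det := by
  refine Ne.isUnit fun hdet => ?_
  obtain ⟨x, hx, hGx⟩ := Matrix.exists_mulVec_eq_zero_iff.2 hdet
  refine hx (e.equivFun.symm.map_eq_zero_iff.1 (h.eq_of_inducedMetric_basis_eq e hu fun i => ?_))
  rw [← h.gramMatrix_mulVec, hGx, map_zero, zero_apply, Pi.zero_apply]

theorem contDiffOn_gramMatrix_inv (i j : ι) :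
    ContDiffOn ℝ ∞ (fun x => (gramMatrix B e F x)⁻¹ i j) Ω :=
  contDiffOn_matrix_inv_apply (h.contDiffOn_gramMatrix e)
    (fun _ hx => (h.isUnit_det_gramMatrix e hx).ne_zero) i j

theorem contDiffOn_sharp {a : ι → E → ℝ} {Ω' : Set E} (hs : Ω' ⊆ Ω)
    (ha : ∀ k, ContDiffOn ℝ ∞ (a k) Ω') :
    ContDiffOn ℝ ∞ (fun x => sharp B e F x fun k => a k x) Ω' := by
  simp only [sharp_eq_sum]
  exact ContDiffOn.sum fun k _ => ContDiffOn.sum fun l _ =>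
    (((h.contDiffOn_gramMatrix_inv e k l).mono hs).mul (ha l)).smul contDiffOn_const

theorem contDiffOn_removeTangent {w : E → A} (hw : ContDiffOn ℝ ∞ w Ω) :
    ContDiffOn ℝ ∞ (fun x => removeTangent B e F x (w x)) Ω :=
  hw.sub <| h.contDiffOn_fderiv.clm_apply <| h.contDiffOn_sharp e subset_rfl fun _ =>
    contDiffOn_bilinear B hw (h.contDiffOn_fderiv.clm_apply contDiffOn_const)

include hu

theorem inducedMetric_sharp (a : ι → ℝ) (i : ι) :
    inducedMetric B F u (sharp B e F u a) (e i) = a i := by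
  rw [sharp, ← h.gramMatrix_mulVec, Matrix.mulVec_mulVec,
    Matrix.mul_nonsing_inv _ (h.isUnit_det_gramMatrix e hu), Matrix.one_mulVec]

theorem sharp_flat (v : E) : sharp B e F u (flat B e F u v) = v :=
  h.eq_of_inducedMetric_basis_eq e hu fun _ => by
    rw [h.inducedMetric_sharp e hu, flat, h.inducedMetric_symm]

theorem inner_removeTangent (w : A) (v : E) :
    B (removeTangent B e F u w) (fderiv ℝ F u v) = 0 := by
  have hbasis : (B (removeTangent B e F u w) ∘L fderiv ℝ F u) = 0 :=
    ContinuousLinearMap.coe_injective <| e.ext fun i => by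
      have h1 := h.inducedMetric_sharp e hu (fun k => B w (fderiv ℝ F u (e k))) i
      rw [inducedMetric_apply] at h1
      simp [removeTangent, h1]
  exact DFunLike.congr_fun hbasis v

theorem removeTangent_add {v : E} {ξ : A} (hξ : ∀ v, B ξ (fderiv ℝ F u v) = 0) :
    removeTangent B e F u (fderiv ℝ F u v + ξ) = ξ := by
  have hcov : (fun k => B (fderiv ℝ F u v + ξ) (fderiv ℝ F u (e k)))
      = flat B e F u v := by
    funext k
    rw [map_add, add_apply, hξ, add_zero, ← inducedMetric_apply, h.inducedMetric_symm, flat]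
  rw [removeTangent, hcov, h.sharp_flat e hu, add_sub_cancel_left]

theorem gramMatrix_inv_mulVec_flat_dotProduct (v : E) :
    ((gramMatrix B e F u)⁻¹ *ᵥ flat B e F u v) ⬝ᵥ flat B e F u v = inducedMetric B F u v v := by
  have hdual := congrArg (fun w => inducedMetric B F u w v) (h.sharp_flat e hu v)
  simp only [sharp, Module.Basis.equivFun_symm_apply, map_sum, map_smul, sum_apply, smul_apply,
    smul_eq_mul] at hdual
  exact hdual

end IsLocalImmersion

end GramMatrix

section FrameSmoothness

variable {E A ι : Type*} [NormedAddCommGroup E] [NormedSpace ℝ E]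
  [NormedAddCommGroup A] [NormedSpace ℝ A] [Fintype ι] [DecidableEq ι]

/-- The second fundamental form of `F` in the quadric `B p p = 1 / c` (in `A` itself if `c = 0`);
the position term removes the component of the second derivative normal to the quadric. -/
noncomputable def secondForm (B : A →L[ℝ] A →L[ℝ] ℝ) (c : ℝ) (e : Module.Basis ι ℝ E) (F : E → A)
    (u v w : E) : A :=
  removeTangent B e F u (fderiv ℝ (fderiv ℝ F) u v w) + (c * inducedMetric B F u v w) • F u

/-- The trace of the second fundamental form, that is, `card ι` times the mean curvature vector. -/
noncomputable def traceSecondForm (B : A →L[ℝ] A →L[ℝ] ℝ) (c : ℝ) (e : Module.Basis ι ℝ E)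
    (F : E → A) (u : E) : A :=
  ∑ k, ∑ l, (gramMatrix B e F u)⁻¹ k l • secondForm B c e F u (e k) (e l)

/-- The components of the traceless part of the second fundamental form. -/
noncomputable def tracelessSecondForm (B : A →L[ℝ] A →L[ℝ] ℝ) (c : ℝ) (e : Module.Basis ι ℝ E)
    (F : E → A) (u : E) (i j : ι) : A :=
  secondForm B c e F u (e i) (e j)
    - ((Fintype.card ι : ℝ)⁻¹ * gramMatrix B e F u i j) • traceSecondForm B c e F u

/-- The contraction over one index of the traceless second fundamental form with itself. -/
noncomputable def tracelessSquare (B : A →L[ℝ] A →L[ℝ] ℝ) (c : ℝ) (e : Module.Basis ι ℝ E)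
    (F : E → A) (u : E) : Matrix ι ι ℝ :=
  Matrix.of fun i j => ∑ l, ∑ k, B (tracelessSecondForm B c e F u i k)
    (tracelessSecondForm B c e F u l j) * (gramMatrix B e F u)⁻¹ k l

variable {B : A →L[ℝ] A →L[ℝ] ℝ} {c : ℝ} {F : E → A} {Ω : Set E}

namespace IsLocalImmersion

section Smooth

variable (h : IsLocalImmersion B c F Ω) (e : Module.Basis ι ℝ E)

include h

theorem contDiffOn_secondForm {V W : E → E} (hV : ContDiffOn ℝ ∞ V Ω) (hW : ContDiffOn ℝ ∞ W Ω) :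
    ContDiffOn ℝ ∞ (fun u => secondForm B c e F u (V u) (W u)) Ω :=
  (h.contDiffOn_removeTangent e ((h.contDiffOn_fderiv_fderiv.clm_apply hV).clm_apply hW)).add
    ((contDiffOn_const.mul (contDiffOn_bilinear B (h.contDiffOn_fderiv.clm_apply hV)
      (h.contDiffOn_fderiv.clm_apply hW))).smul h.smooth)

theorem contDiffOn_traceSecondForm : ContDiffOn ℝ ∞ (traceSecondForm B c e F) Ω :=
  ContDiffOn.sum fun k _ => ContDiffOn.sum fun l _ => (h.contDiffOn_gramMatrix_inv e k l).smul
    (h.contDiffOn_secondForm e contDiffOn_const contDiffOn_const)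

theorem contDiffOn_tracelessSecondForm (i j : ι) :
    ContDiffOn ℝ ∞ (fun u => tracelessSecondForm B c e F u i j) Ω :=
  (h.contDiffOn_secondForm e contDiffOn_const contDiffOn_const).sub
    ((contDiffOn_const.mul (h.contDiffOn_gramMatrix e i j)).smul (h.contDiffOn_traceSecondForm e))

theorem contDiffOn_tracelessSquare (i j : ι) :
    ContDiffOn ℝ ∞ (fun u => tracelessSquare B c e F u i j) Ω :=
  ContDiffOn.sum fun l _ => ContDiffOn.sum fun k _ =>
    (contDiffOn_bilinear B (h.contDiffOn_tracelessSecondForm e i k)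
      (h.contDiffOn_tracelessSecondForm e l j)).mul (h.contDiffOn_gramMatrix_inv e k l)

theorem contDiffOn_trace_tracelessSquare :
    ContDiffOn ℝ ∞ (fun u => ((gramMatrix B e F u)⁻¹ * tracelessSquare B c e F u).trace) Ω :=
  ContDiffOn.sum fun k _ => ContDiffOn.sum fun l _ =>
    (h.contDiffOn_gramMatrix_inv e k l).mul (h.contDiffOn_tracelessSquare e l k)

end Smooth

section Pointwise

variable (h : IsLocalImmersion B c F Ω) (e : Module.Basis ι ℝ E) {u : E} (hu : u ∈ Ω) {T : E}
  {η ζ : A} (hframe : IsPrincipalFrameAt B c F u T η ζ)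

include h hu hframe

theorem secondForm_eq (v w : E) :
    secondForm B c e F u v w = inducedMetric B F u v w • ζ
      + (inducedMetric B F u v T * inducedMetric B F u w T) • (η - ζ) := by
  obtain ⟨γ, hγ⟩ := hframe.gauss_formula v w
  rw [add_assoc, add_sub_assoc] at hγ
  rw [secondForm, hγ, h.removeTangent_add e hu, sub_add_cancel]
  intro y
  simp only [map_add, map_sub, map_smul, add_apply, sub_apply, smul_apply, smul_eq_mul,
    hframe.normal_eta.orthogonal, hframe.normal_zeta.orthogonal]
  linear_combination -(inducedMetric B F u v w) * h.radial u hu y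

theorem traceSecondForm_eq :
    traceSecondForm B c e F u = (Fintype.card ι : ℝ) • ζ + (η - ζ) := by
  have hG : ∑ k, ∑ l, (gramMatrix B e F u)⁻¹ k l * inducedMetric B F u (e k) (e l)
      = Fintype.card ι := by
    rw [← trace_inv_mul_self (h.isUnit_det_gramMatrix e hu)]
    exact Finset.sum_congr rfl fun k _ => Finset.sum_congr rfl fun l _ => by
      rw [h.inducedMetric_symm]
      rfl
  have hT : ∑ k, ∑ l, (gramMatrix B e F u)⁻¹ k l
      * (inducedMetric B F u (e k) T * inducedMetric B F u (e l) T) = 1 := by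
    rw [← hframe.unit, ← h.gramMatrix_inv_mulVec_flat_dotProduct e hu, ← trace_inv_mul_vecMulVec]
    exact Finset.sum_congr rfl fun k _ => Finset.sum_congr rfl fun l _ => by
      rw [mul_comm (inducedMetric B F u (e k) T)]
      rfl
  simp only [traceSecondForm, h.secondForm_eq e hu hframe, smul_add, smul_smul,
    Finset.sum_add_distrib, ← Finset.sum_smul]
  rw [hG, hT, one_smul]

theorem tracelessSecondForm_eq (i j : ι) : tracelessSecondForm B c e F u i j
    = tracelessDyad (gramMatrix B e F u) (flat B e F u T) i j • (η - ζ) := by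
  have : Nonempty ι := ⟨i⟩
  have hN : (Fintype.card ι : ℝ) ≠ 0 := Nat.cast_ne_zero.2 Fintype.card_ne_zero
  simp only [tracelessSecondForm, h.secondForm_eq e hu hframe, h.traceSecondForm_eq e hu hframe,
    tracelessDyad, Matrix.sub_apply, Matrix.smul_apply, Matrix.vecMulVec_apply, flat, gramMatrix,
    Matrix.of_apply, smul_eq_mul, smul_add, smul_smul]
  rw [mul_right_comm, inv_mul_cancel₀ hN]
  module

theorem tracelessSquare_eq : tracelessSquare B c e F u = B (η - ζ) (η - ζ) •
    (tracelessDyad (gramMatrix B e F u) (flat B e F u T) * (gramMatrix B e F u)⁻¹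
      * tracelessDyad (gramMatrix B e F u) (flat B e F u T)) := by
  ext i j
  simp only [tracelessSquare, Matrix.of_apply, h.tracelessSecondForm_eq e hu hframe, map_smul,
    smul_apply, smul_eq_mul, Matrix.smul_apply, Matrix.mul_apply, Finset.mul_sum, Finset.sum_mul]
  exact Finset.sum_congr rfl fun l _ => Finset.sum_congr rfl fun k _ => by ring

theorem trace_tracelessSquare [Nonempty ι] :
    ((gramMatrix B e F u)⁻¹ * tracelessSquare B c e F u).trace
      = B (η - ζ) (η - ζ) * (1 - 1 / (Fintype.card ι : ℝ)) := by
  rw [h.tracelessSquare_eq e hu hframe, Matrix.mul_smul, Matrix.trace_smul,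
    trace_inv_mul_tracelessDyad_sq (h.isUnit_det_gramMatrix e hu) _
      (Nat.cast_ne_zero.2 Fintype.card_ne_zero), smul_eq_mul]
  rw [h.gramMatrix_inv_mulVec_flat_dotProduct e hu, hframe.unit]

theorem flat_mul_flat (hι : 3 ≤ Fintype.card ι) (i j : ι) :
    flat B e F u T i * flat B e F u T j
      = (tracelessSquare B c e F u i j * (1 - 1 / (Fintype.card ι : ℝ))
          / ((gramMatrix B e F u)⁻¹ * tracelessSquare B c e F u).trace
          - ((Fintype.card ι : ℝ) ^ 2)⁻¹ * gramMatrix B e F u i j)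
        / (1 - 2 / (Fintype.card ι : ℝ)) := by
  have : Nonempty ι := ⟨i⟩
  have hN : (3 : ℝ) ≤ Fintype.card ι := by exact_mod_cast hι
  have hN1 : 0 < 1 - 1 / (Fintype.card ι : ℝ) := by
    rw [sub_pos, div_lt_one (by linarith)]; linarith
  have hN2 : 0 < 1 - 2 / (Fintype.card ι : ℝ) := by
    rw [sub_pos, div_lt_one (by linarith)]; linarith
  have hunit : ((gramMatrix B e F u)⁻¹ *ᵥ flat B e F u T) ⬝ᵥ flat B e F u T = 1 := by
    rw [h.gramMatrix_inv_mulVec_flat_dotProduct e hu, hframe.unit]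
  rw [h.trace_tracelessSquare e hu hframe, h.tracelessSquare_eq e hu hframe,
    tracelessDyad_mul_inv_mul_self (h.isUnit_det_gramMatrix e hu) hunit, Matrix.smul_apply,
    Matrix.add_apply, Matrix.smul_apply, Matrix.smul_apply, Matrix.vecMulVec_apply,
    mul_div_mul_right _ _ hN1.ne', smul_eq_mul, mul_div_cancel_left₀ _ hframe.diff_pos.ne',
    smul_eq_mul, smul_eq_mul, add_sub_cancel_right, mul_div_cancel_left₀ _ hN2.ne']

end Pointwise

omit [DecidableEq ι] in
theorem contDiffOn_flat_mul_flat (h : IsLocalImmersion B c F Ω) (e : Module.Basis ι ℝ E)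
    (hι : 3 ≤ Fintype.card ι) {T : E → E} {η ζ : E → A}
    (hframe : ∀ u ∈ Ω, IsPrincipalFrameAt B c F u (T u) (η u) (ζ u)) (i j : ι) :
    ContDiffOn ℝ ∞ (fun u => flat B e F u (T u) i * flat B e F u (T u) j) Ω := by
  classical
  have : Nonempty ι := ⟨i⟩
  have hN : (1 : ℝ) < Fintype.card ι := by exact_mod_cast (by omega : 1 < Fintype.card ι)
  have hN1 : 0 < 1 - 1 / (Fintype.card ι : ℝ) := by
    rw [sub_pos, div_lt_one (by linarith)]; exact hN
  refine ContDiffOn.congr ?_ fun u hu => h.flat_mul_flat e hu (hframe u hu) hι i j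
  refine ((((h.contDiffOn_tracelessSquare e i j).mul contDiffOn_const).div
    (h.contDiffOn_trace_tracelessSquare e) fun u hu => ?_).sub
    (contDiffOn_const.mul (h.contDiffOn_gramMatrix e i j))).div_const _
  rw [h.trace_tracelessSquare e hu (hframe u hu)]
  exact (mul_pos (hframe u hu).diff_pos hN1).ne'

end IsLocalImmersion

theorem IsPrincipalFrameAt.smul_T {u T : E} {η ζ : A} (h : IsPrincipalFrameAt B c F u T η ζ)
    {s : ℝ} (hs : s * s = 1) : IsPrincipalFrameAt B c F u (s • T) η ζ where
  unit := by
    simp only [map_smul, smul_apply, smul_eq_mul, h.unit, mul_one, hs]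
  normal_eta := h.normal_eta
  normal_zeta := h.normal_zeta
  diff_pos := h.diff_pos
  gauss_formula v w := by
    simpa only [map_smul, smul_eq_mul, mul_mul_mul_comm, hs, one_mul] using h.gauss_formula v w

omit [Fintype ι] [DecidableEq ι] in
theorem IsPrincipalFrameAt.exists_flat_ne_zero {u T : E} {η ζ : A}
    (h : IsPrincipalFrameAt B c F u T η ζ) (e : Module.Basis ι ℝ E) :
    ∃ m, flat B e F u T m ≠ 0 := by
  by_contra! hcon
  have hzero : (inducedMetric B F u).flip T = 0 :=
    ContinuousLinearMap.coe_injective (e.ext hcon)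
  have hunit := h.unit
  rw [← ContinuousLinearMap.flip_apply, hzero, zero_apply] at hunit
  exact zero_ne_one hunit

namespace IsLocalImmersion

variable (h : IsLocalImmersion B c F Ω) (e : Module.Basis ι ℝ E) (hι : 3 ≤ Fintype.card ι)
  {T : E → E} {η ζ : E → A}
  (hframe : ∀ u ∈ Ω, IsPrincipalFrameAt B c F u (T u) (η u) (ζ u))

include h e hι hframe

omit [DecidableEq ι] in
theorem isPrincipalFrame_of_contDiffOn (hT : ContDiffOn ℝ ∞ T Ω) :
    IsPrincipalFrame B c F Ω T η ζ := by
  classical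
  have hη : ContDiffOn ℝ ∞ η Ω := (h.contDiffOn_secondForm e hT hT).congr fun u hu => by
    rw [h.secondForm_eq e hu (hframe u hu), (hframe u hu).unit]
    module
  have hN : (0 : ℝ) < Fintype.card ι - 1 := by
    rw [sub_pos]; exact_mod_cast (by omega : 1 < Fintype.card ι)
  refine ⟨h, hT, hη, ?_, hframe⟩
  refine (((h.contDiffOn_traceSecondForm e).sub hη).const_smul
    ((Fintype.card ι : ℝ) - 1)⁻¹).congr fun u hu => ?_
  rw [h.traceSecondForm_eq e hu (hframe u hu), eq_inv_smul_iff₀ hN.ne']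
  module

omit [DecidableEq ι] in
/-- Only the product `t i * t j` of components of `T` is intrinsically smooth, so `T` is normalized
to be positive against a fixed basis vector. -/
theorem exists_isPrincipalFrame {u₀ : E} (hu₀ : u₀ ∈ Ω) :
    ∃ (Ω' : Set E) (T' : E → E), u₀ ∈ Ω' ∧ Ω' ⊆ Ω ∧ IsPrincipalFrame B c F Ω' T' η ζ ∧
      ∀ u ∈ Ω', T' u = T u ∨ T' u = -T u := by
  classical
  have hdyad := h.contDiffOn_flat_mul_flat e hι hframe
  obtain ⟨m, hm⟩ := (hframe u₀ hu₀).exists_flat_ne_zero e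
  let t : E → ι → ℝ := fun u => flat B e F u (T u)
  let s : E → ℝ := fun u => t u m / √(t u m * t u m)
  let Ω' : Set E := Ω ∩ (fun u => t u m * t u m) ⁻¹' {0}ᶜ
  have hsub : Ω' ⊆ Ω := Set.inter_subset_left
  have h' : IsLocalImmersion B c F Ω' := h.mono
    ((hdyad m m).continuousOn.isOpen_inter_preimage h.isOpen isOpen_compl_singleton) hsub
  have hs : ∀ u ∈ Ω', s u * s u = 1 := fun u hu => by
    rw [div_mul_div_comm, Real.mul_self_sqrt (mul_self_nonneg _), div_self hu.2]
  have hT : ContDiffOn ℝ ∞ (fun u => s u • T u) Ω' := by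
    refine (h.contDiffOn_sharp e hsub fun k => ((hdyad k m).mono hsub).div
      (((hdyad m m).mono hsub).sqrt fun u hu => hu.2)
      fun u hu => (Real.sqrt_pos.2 ((mul_self_nonneg _).lt_of_ne' hu.2)).ne').congr fun u hu => ?_
    conv_lhs => rw [← h.sharp_flat e hu.1 (T u), ← sharp_smul]
    congr 1
    funext k
    simp only [Pi.smul_apply, Pi.div_apply, smul_eq_mul, s, t]
    ring
  refine ⟨Ω', fun u => s u • T u, ⟨hu₀, mul_self_ne_zero.2 hm⟩, hsub,
    h'.isPrincipalFrame_of_contDiffOn e hι (fun u hu => (hframe u hu.1).smul_T (hs u hu)) hT,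
    fun u hu => (mul_self_eq_one_iff.1 (hs u hu)).imp (fun hs1 => ?_) fun hs1 => ?_⟩
  · simp only [hs1, one_smul]
  · simp only [hs1, neg_smul, one_smul]

end IsLocalImmersion

end FrameSmoothness

section GaussEquation

open Filter Topology

theorem partialD_congr {n : ℕ} {W : Type*} [NormedAddCommGroup W] [NormedSpace ℝ W]
    {p q : Coord n → W} {u : Coord n} (h : p =ᶠ[𝓝 u] q) (i : Fin n) :
    partialD i p u = partialD i q u := by
  rw [partialD, partialD, h.fderiv_eq]

theorem christoffel_congr {n : ℕ} {G G' : Coord n → Matrix (Fin n) (Fin n) ℝ} {u : Coord n}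
    (h : G =ᶠ[𝓝 u] G') (k i j : Fin n) : christoffel G k i j =ᶠ[𝓝 u] christoffel G' k i j := by
  filter_upwards [h.eventuallyEq_nhds] with x hx
  have hpartial : ∀ i j l, partialD i (fun p => G p j l) x = partialD i (fun p => G' p j l) x :=
    fun i j l => partialD_congr (hx.mono fun y hy => by rw [hy]) i
  simp only [christoffel, hx.eq_of_nhds, hpartial]

theorem scalarCoord_congr {n : ℕ} {G G' : Coord n → Matrix (Fin n) (Fin n) ℝ} {u : Coord n}
    (h : G =ᶠ[𝓝 u] G') : scalarCoord G u = scalarCoord G' u := by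
  have hpartial : ∀ m k i j,
      partialD m (christoffel G k i j) u = partialD m (christoffel G' k i j) u :=
    fun m k i j => partialD_congr (christoffel_congr h k i j) m
  have hvalue : ∀ k i j, christoffel G k i j u = christoffel G' k i j u :=
    fun k i j => (christoffel_congr h k i j).eq_of_nhds
  simp only [scalarCoord, ricciCoeff, riemannCoeff, hpartial, hvalue, h.eq_of_nhds]

variable {n : ℕ} {A : Type*} [NormedAddCommGroup A] [NormedSpace ℝ A]

/-- The standard basis of `Coord n`. -/
noncomputable abbrev coordBasis (n : ℕ) : Module.Basis (Fin n) ℝ (Coord n) :=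
  (EuclideanSpace.basisFun (Fin n) ℝ).toBasis

theorem partialD_eq_fderiv_coordBasis {W : Type*} [NormedAddCommGroup W] [NormedSpace ℝ W]
    (i : Fin n) (p : Coord n → W) (u : Coord n) :
    partialD i p u = fderiv ℝ p u (coordBasis n i) := by
  simp [partialD]

namespace IsLocalImmersion

variable {B : A →L[ℝ] A →L[ℝ] ℝ} {c : ℝ} {F : Coord n → A} {Ω : Set (Coord n)}
  (h : IsLocalImmersion B c F Ω) {u : Coord n} (hu : u ∈ Ω)

local notation "𝐞" => coordBasis n

local notation "𝐆" => gramMatrix B (coordBasis n) F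

local notation "D²F" => fderiv ℝ (fderiv ℝ F)

include h

section Christoffel

include hu

theorem partialD_gramMatrix (i j l : Fin n) : partialD i (fun p => 𝐆 p j l) u
    = B (D²F u (𝐞 i) (𝐞 j)) (fderiv ℝ F u (𝐞 l)) + B (D²F u (𝐞 i) (𝐞 l)) (fderiv ℝ F u (𝐞 j)) := by
  rw [partialD_eq_fderiv_coordBasis, ← h.fderiv_inducedMetric hu]
  rfl

theorem christoffel_eq (k i j : Fin n) : christoffel 𝐆 k i j u
    = ((𝐆 u)⁻¹ *ᵥ fun l => B (D²F u (𝐞 i) (𝐞 j)) (fderiv ℝ F u (𝐞 l))) k := by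
  rw [christoffel, Finset.mul_sum]
  refine Finset.sum_congr rfl fun l _ => ?_
  rw [h.partialD_gramMatrix hu, h.partialD_gramMatrix hu, h.partialD_gramMatrix hu,
    h.fderiv_fderiv_symm hu (𝐞 j) (𝐞 i), h.fderiv_fderiv_symm hu (𝐞 l) (𝐞 i),
    h.fderiv_fderiv_symm hu (𝐞 l) (𝐞 j)]
  ring

theorem sum_christoffel_smul (i j : Fin n) :
    ∑ k, christoffel 𝐆 k i j u • fderiv ℝ F u (𝐞 k)
      = D²F u (𝐞 i) (𝐞 j) - removeTangent B 𝐞 F u (D²F u (𝐞 i) (𝐞 j)) := by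
  simp only [h.christoffel_eq hu, ← map_smul, ← map_sum]
  rw [removeTangent, sub_sub_cancel, sharp, Module.Basis.equivFun_symm_apply]

theorem sum_christoffel_mul_inducedMetric (i j : Fin n) (v : Coord n) :
    ∑ k, christoffel 𝐆 k i j u * inducedMetric B F u (𝐞 k) v
      = B (D²F u (𝐞 i) (𝐞 j)) (fderiv ℝ F u v) := by
  have hsum := congrArg (fun w => B w (fderiv ℝ F u v)) (h.sum_christoffel_smul hu i j)
  simpa only [map_sub, sub_apply, h.inner_removeTangent 𝐞 hu, sub_zero, map_sum, map_smul,
    sum_apply, smul_apply, smul_eq_mul, inducedMetric_apply] using hsum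

theorem sum_christoffel_mul_inner (i j : Fin n) (w : A) :
    ∑ k, christoffel 𝐆 k i j u * B w (fderiv ℝ F u (𝐞 k))
      = B (D²F u (𝐞 i) (𝐞 j)) w - B (removeTangent B 𝐞 F u (D²F u (𝐞 i) (𝐞 j))) w := by
  have hsum := congrArg (B w) (h.sum_christoffel_smul hu i j)
  simpa only [map_sum, map_smul, smul_eq_mul, map_sub, h.symm w (D²F u _ _),
    h.symm w (removeTangent _ _ _ _ _)] using hsum

end Christoffel

theorem contDiffOn_christoffel (k i j : Fin n) : ContDiffOn ℝ ∞ (christoffel 𝐆 k i j) Ω := by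
  have hcov : ∀ l, ContDiffOn ℝ ∞ (fun x => B (D²F x (𝐞 i) (𝐞 j)) (fderiv ℝ F x (𝐞 l))) Ω :=
    fun l => contDiffOn_bilinear B
      ((h.contDiffOn_fderiv_fderiv.clm_apply contDiffOn_const).clm_apply contDiffOn_const)
      (h.contDiffOn_fderiv.clm_apply contDiffOn_const)
  have hsum : ContDiffOn ℝ ∞
      (fun x => ∑ l, (𝐆 x)⁻¹ k l * B (D²F x (𝐞 i) (𝐞 j)) (fderiv ℝ F x (𝐞 l))) Ω :=
    ContDiffOn.sum fun l _ => (h.contDiffOn_gramMatrix_inv 𝐞 k l).mul (hcov l)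
  exact hsum.congr fun x hx => h.christoffel_eq hx k i j

include hu

theorem inner_third_fderiv (m i j p : Fin n) :
    B (fderiv ℝ D²F u (𝐞 m) (𝐞 i) (𝐞 j)) (fderiv ℝ F u (𝐞 p))
      = ∑ k, partialD m (christoffel 𝐆 k i j) u * 𝐆 u k p
        + ∑ k, christoffel 𝐆 k i j u * B (D²F u (𝐞 m) (𝐞 k)) (fderiv ℝ F u (𝐞 p))
        - B (removeTangent B 𝐞 F u (D²F u (𝐞 i) (𝐞 j))) (D²F u (𝐞 m) (𝐞 p)) := by
  have hΓ : ∀ k, DifferentiableAt ℝ (christoffel 𝐆 k i j) u :=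
    fun k => differentiableAt_of_contDiffOn_infty h.isOpen hu (h.contDiffOn_christoffel k i j)
  have hg : ∀ k, DifferentiableAt ℝ (fun x => inducedMetric B F x (𝐞 k) (𝐞 p)) u :=
    fun k => h.differentiableAt_inducedMetric hu (𝐞 k) (𝐞 p)
  have hD := DFunLike.congr_fun (fderiv_eq_of_eqOn_isOpen (𝕜 := ℝ) h.isOpen hu
    fun x hx => h.sum_christoffel_mul_inducedMetric hx i j (𝐞 p)) (𝐞 m)
  rw [fderiv_fun_sum fun k _ => (hΓ k).fun_mul (hg k),
    fderiv_bilinear_apply B (h.differentiableAt_fderiv_fderiv_apply hu _ _)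
      (h.differentiableAt_fderiv_apply hu _), h.fderiv_fderiv_fderiv_apply hu,
    fderiv_clm_apply_const (h.differentiableAt_fderiv hu)] at hD
  simp only [sum_apply, fun k => fderiv_fun_mul (hΓ k) (hg k), add_apply, smul_apply, smul_eq_mul,
    h.fderiv_inducedMetric hu, mul_add, Finset.sum_add_distrib,
    h.sum_christoffel_mul_inner hu i j (D²F u (𝐞 m) (𝐞 p))] at hD
  simp only [partialD_eq_fderiv_coordBasis, gramMatrix, Matrix.of_apply,
    mul_comm _ (inducedMetric B F u _ _)]
  linear_combination -hD

theorem gauss_equation (i j m p : Fin n) : ∑ k, riemannCoeff 𝐆 k j m i u * 𝐆 u k p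
    = B (removeTangent B 𝐞 F u (D²F u (𝐞 i) (𝐞 j))) (D²F u (𝐞 m) (𝐞 p))
      - B (removeTangent B 𝐞 F u (D²F u (𝐞 m) (𝐞 j))) (D²F u (𝐞 i) (𝐞 p)) := by
  have hquad : ∀ m i, ∑ k, christoffel 𝐆 k i j u * B (D²F u (𝐞 m) (𝐞 k)) (fderiv ℝ F u (𝐞 p))
      = ∑ k, (∑ q, christoffel 𝐆 k m q u * christoffel 𝐆 q i j u) * 𝐆 u k p := fun m i => by
    simp only [← h.sum_christoffel_mul_inducedMetric hu, Finset.mul_sum, Finset.sum_mul]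
    rw [Finset.sum_comm]
    exact Finset.sum_congr rfl fun k _ => Finset.sum_congr rfl fun l _ => by
      rw [gramMatrix, Matrix.of_apply]; ring
  have hcomm := h.inner_third_fderiv hu m i j p
  rw [fderiv_fderiv_comm h.isOpen hu h.contDiffOn_fderiv (𝐞 m) (𝐞 i),
    h.inner_third_fderiv hu i m j p, hquad, hquad] at hcomm
  simp only [riemannCoeff, Finset.sum_sub_distrib, add_mul, sub_mul, Finset.sum_add_distrib]
  linear_combination -hcomm

theorem ricciCoeff_eq_trace (i j : Fin n) : ricciCoeff 𝐆 i j u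
    = ((𝐆 u)⁻¹ * Matrix.of fun m p =>
        B (removeTangent B 𝐞 F u (D²F u (𝐞 i) (𝐞 j))) (D²F u (𝐞 m) (𝐞 p))
          - B (removeTangent B 𝐞 F u (D²F u (𝐞 m) (𝐞 j))) (D²F u (𝐞 i) (𝐞 p))).trace := by
  rw [ricciCoeff, Matrix.trace_mul_comm]
  refine Finset.sum_congr rfl fun m _ => ?_
  have hlower : (fun k => riemannCoeff 𝐆 k j m i u) ᵥ* 𝐆 u = fun p =>
      B (removeTangent B 𝐞 F u (D²F u (𝐞 i) (𝐞 j))) (D²F u (𝐞 m) (𝐞 p))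
        - B (removeTangent B 𝐞 F u (D²F u (𝐞 m) (𝐞 j))) (D²F u (𝐞 i) (𝐞 p)) :=
    funext fun p => h.gauss_equation hu i j m p
  calc riemannCoeff 𝐆 m j m i u
      = ((fun k => riemannCoeff 𝐆 k j m i u) ᵥ* 𝐆 u ᵥ* (𝐆 u)⁻¹) m := by
        rw [Matrix.vecMul_vecMul, Matrix.mul_nonsing_inv _ (h.isUnit_det_gramMatrix 𝐞 hu),
          Matrix.vecMul_one]
    _ = _ := by rw [hlower]; rfl

variable {T : Coord n} {η ζ : A} (hframe : IsPrincipalFrameAt B c F u T η ζ)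

include hframe

theorem inner_removeTangent_second (v w x y : Coord n) :
    B (removeTangent B 𝐞 F u (D²F u v w)) (D²F u x y)
      = (B ζ ζ + c) * (inducedMetric B F u v w * inducedMetric B F u x y)
        + (B η ζ - B ζ ζ) * (inducedMetric B F u v w
              * (inducedMetric B F u x T * inducedMetric B F u y T)
            + inducedMetric B F u v T * inducedMetric B F u w T * inducedMetric B F u x y)
        + B (η - ζ) (η - ζ) * (inducedMetric B F u v T * inducedMetric B F u w T
            * (inducedMetric B F u x T * inducedMetric B F u y T)) := by
  have hsecond := h.secondForm_eq 𝐞 hu hframe v w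
  rw [secondForm, ← eq_sub_iff_add_eq] at hsecond
  rw [hsecond]
  simp only [map_add, map_sub, map_smul, add_apply, sub_apply, smul_apply, smul_eq_mul,
    hframe.inner_normal_second hframe.normal_zeta, hframe.inner_normal_second hframe.normal_eta,
    h.symm ζ η]
  linear_combination -(inducedMetric B F u v w) * h.radial_fderiv_fderiv hu x y

theorem ricciCoeff_eq (i j : Fin n) : ricciCoeff 𝐆 i j u
    = (B ζ ζ + c) * ((n - 1) * 𝐆 u i j)
      + (B η ζ - B ζ ζ) * (𝐆 u i j + (n - 2) * (flat B 𝐞 F u T i * flat B 𝐞 F u T j)) := by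
  set t := flat B 𝐞 F u T
  have hdet := h.isUnit_det_gramMatrix 𝐞 hu
  have hriem : (Matrix.of fun m p =>
      B (removeTangent B 𝐞 F u (D²F u (𝐞 i) (𝐞 j))) (D²F u (𝐞 m) (𝐞 p))
      - B (removeTangent B 𝐞 F u (D²F u (𝐞 m) (𝐞 j))) (D²F u (𝐞 i) (𝐞 p)))
      = (B ζ ζ + c) • (𝐆 u i j • 𝐆 u - Matrix.vecMulVec ((𝐆 u).col j) (𝐆 u i))
        + (B η ζ - B ζ ζ) • (𝐆 u i j • Matrix.vecMulVec t t + (t i * t j) • 𝐆 u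
          - t i • Matrix.vecMulVec ((𝐆 u).col j) t - t j • Matrix.vecMulVec t (𝐆 u i)) := by
    ext m p
    simp only [Matrix.of_apply, h.inner_removeTangent_second hu hframe, Matrix.add_apply,
      Matrix.sub_apply, Matrix.smul_apply, Matrix.vecMulVec_apply, Matrix.col_apply, smul_eq_mul,
      gramMatrix, t, flat]
    ring
  have hcol : (𝐆 u)⁻¹ *ᵥ (𝐆 u).col j = Pi.single j 1 := by
    rw [← Matrix.mulVec_single_one, Matrix.mulVec_mulVec, Matrix.nonsing_inv_mul _ hdet,
      Matrix.one_mulVec]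
  have hrow : ((𝐆 u)⁻¹ *ᵥ t) ⬝ᵥ 𝐆 u i = t i := by
    calc _ = (𝐆 u *ᵥ ((𝐆 u)⁻¹ *ᵥ t)) i := dotProduct_comm _ _
      _ = t i := by
        rw [Matrix.mulVec_mulVec, Matrix.mul_nonsing_inv _ hdet, Matrix.one_mulVec]
  rw [h.ricciCoeff_eq_trace hu, hriem]
  simp only [Matrix.mul_add, Matrix.mul_sub, Matrix.mul_smul, Matrix.trace_add, Matrix.trace_sub,
    Matrix.trace_smul, trace_inv_mul_vecMulVec, trace_inv_mul_self hdet, hcol, hrow,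
    single_one_dotProduct, h.gramMatrix_inv_mulVec_flat_dotProduct 𝐞 hu T, hframe.unit, t,
    Fintype.card_fin, smul_eq_mul]
  ring

theorem scalarCoord_gramMatrix :
    scalarCoord 𝐆 u = n * (n - 1) * c + (n - 1) * (2 * B η ζ + (n - 2) * B ζ ζ) := by
  set t := flat B 𝐞 F u T
  have hricci : (Matrix.of fun i j => ricciCoeff 𝐆 j i u)
      = ((B ζ ζ + c) * (n - 1) + (B η ζ - B ζ ζ)) • 𝐆 u
        + ((B η ζ - B ζ ζ) * (n - 2)) • Matrix.vecMulVec t t := by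
    ext i j
    simp only [Matrix.of_apply, h.ricciCoeff_eq hu hframe, (h.isSymm_gramMatrix 𝐞 u).apply i j,
      Matrix.add_apply, Matrix.smul_apply,
      Matrix.vecMulVec_apply, smul_eq_mul, t]
    ring
  have htrace : scalarCoord 𝐆 u = ((𝐆 u)⁻¹ * Matrix.of fun i j => ricciCoeff 𝐆 j i u).trace := rfl
  rw [htrace, hricci, Matrix.mul_add, Matrix.mul_smul, Matrix.mul_smul, Matrix.trace_add,
    Matrix.trace_smul, Matrix.trace_smul, trace_inv_mul_vecMulVec,
    trace_inv_mul_self (h.isUnit_det_gramMatrix 𝐞 hu),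
    h.gramMatrix_inv_mulVec_flat_dotProduct 𝐞 hu T, hframe.unit, Fintype.card_fin, smul_eq_mul,
    smul_eq_mul]
  ring

end IsLocalImmersion

end GaussEquation

section Ekeland

open Filter Topology

/-- The points of `S` that are below `x` for the Brønsted order `H y + δ * dist x y ≤ H x`. -/
def ekelandSet {X : Type*} [PseudoMetricSpace X] (S : Set X) (H : X → ℝ) (δ : ℝ) (x : X) :
    Set X :=
  {y ∈ S | H y + δ * dist x y ≤ H x}

variable {X : Type*} [PseudoMetricSpace X] {S : Set X} {H : X → ℝ} {m δ : ℝ} {x y : X}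

theorem mem_ekelandSet_self (hx : x ∈ S) : x ∈ ekelandSet S H δ x := ⟨hx, by simp⟩

theorem ekelandSet_subset_of_mem (hδ : 0 ≤ δ) (hy : y ∈ ekelandSet S H δ x) :
    ekelandSet S H δ y ⊆ ekelandSet S H δ x := fun z hz =>
  ⟨hz.1, by
    have htri := mul_le_mul_of_nonneg_left (dist_triangle x y z) hδ
    linarith [hy.2, hz.2]⟩

theorem isClosed_ekelandSet (hS : IsClosed S) (hH : Continuous H) :
    IsClosed (ekelandSet S H δ x) :=
  hS.inter (isClosed_le (hH.add ((continuous_const.dist continuous_id).const_mul δ))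
    continuous_const)

theorem exists_ekelandSet_subset_closedBall (hm : ∀ x ∈ S, m ≤ H x) (hδ : 0 < δ) (hx : x ∈ S)
    {ε : ℝ} (hε : 0 < ε) :
    ∃ y ∈ ekelandSet S H δ x, ekelandSet S H δ y ⊆ Metric.closedBall y ε := by
  have hbdd : BddBelow (H '' ekelandSet S H δ x) :=
    ⟨m, Set.forall_mem_image.2 fun y hy => hm y hy.1⟩
  obtain ⟨_, ⟨y, hy, rfl⟩, hyε⟩ := exists_lt_of_csInf_lt
    (Set.Nonempty.image H ⟨x, mem_ekelandSet_self hx⟩)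
    (lt_add_of_pos_right (sInf (H '' ekelandSet S H δ x)) (mul_pos hδ hε))
  refine ⟨y, hy, fun z hz => ?_⟩
  have hinf := csInf_le hbdd ⟨z, ekelandSet_subset_of_mem hδ.le hy hz, rfl⟩
  rw [Metric.mem_closedBall']
  exact le_of_mul_le_mul_left (by linarith [hz.2]) hδ

theorem exists_seq_ekelandSet_subset_closedBall (hne : S.Nonempty) (hm : ∀ x ∈ S, m ≤ H x)
    (hδ : 0 < δ) : ∃ s : ℕ → X, (∀ k, s k ∈ S) ∧
      (∀ k, s (k + 1) ∈ ekelandSet S H δ (s k)) ∧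
      ∀ k, ekelandSet S H δ (s (k + 1)) ⊆ Metric.closedBall (s (k + 1)) ((1 / 2) ^ k) := by
  obtain ⟨x₀, hx₀⟩ := hne
  choose next hmem hball using fun (k : ℕ) (x : S) =>
    exists_ekelandSet_subset_closedBall hm hδ x.2 (pow_pos (half_pos one_pos) k)
  let s : ℕ → S := fun k => Nat.rec ⟨x₀, hx₀⟩ (fun k x => ⟨next k x, (hmem k x).1⟩) k
  exact ⟨fun k => (s k).1, fun k => (s k).2, fun k => hmem k (s k), fun k => hball k (s k)⟩

end Ekeland

open Filter Topology in
theorem exists_forall_add_mul_dist_le_imp_eq {X : Type*} [MetricSpace X] [CompleteSpace X]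
    {S : Set X} (hS : IsClosed S) (hne : S.Nonempty) {H : X → ℝ} (hH : Continuous H) {m δ : ℝ}
    (hm : ∀ x ∈ S, m ≤ H x) (hδ : 0 < δ) :
    ∃ x ∈ S, ∀ y ∈ S, H y + δ * dist x y ≤ H x → y = x := by
  obtain ⟨s, hsS, hs, hball⟩ := exists_seq_ekelandSet_subset_closedBall hne hm hδ
  have hpow : Tendsto (fun k : ℕ => ((1 : ℝ) / 2) ^ k) atTop (𝓝 0) :=
    tendsto_pow_atTop_nhds_zero_of_lt_one (by norm_num) (by norm_num)
  have hanti : Antitone fun k => ekelandSet S H δ (s k) :=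
    antitone_nat_of_succ_le fun k => ekelandSet_subset_of_mem hδ.le (hs k)
  have hself (k : ℕ) : s k ∈ ekelandSet S H δ (s k) := mem_ekelandSet_self (hsS k)
  have hcauchy : CauchySeq fun k => s (k + 1) :=
    cauchySeq_of_le_tendsto_0' _
      (fun k l hkl => Metric.mem_closedBall'.1 (hball k (hanti (by omega) (hself (l + 1))))) hpow
  obtain ⟨x, hx⟩ := cauchySeq_tendsto_of_complete hcauchy
  have hmem (k : ℕ) : x ∈ ekelandSet S H δ (s k) :=
    (isClosed_ekelandSet hS hH).mem_of_tendsto hx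
      ((eventually_ge_atTop k).mono fun l hl => hanti (by omega) (hself (l + 1)))
  refine ⟨x, (hmem 0).1, fun y hy hyx => ?_⟩
  have hlim : Tendsto (fun k => s (k + 1)) atTop (𝓝 y) :=
    tendsto_iff_dist_tendsto_zero.2 <| squeeze_zero (fun _ => dist_nonneg)
      (fun k => Metric.mem_closedBall'.1
        (hball k (ekelandSet_subset_of_mem hδ.le (hmem (k + 1)) ⟨hy, hyx⟩))) hpow
  exact tendsto_nhds_unique hlim hx

section Form

variable {m : ℕ}

theorem form_symm (c : ℝ) (p q : Ambient m) : form c p q = form c q p := by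
  simp only [form, mul_comm]

/-- The scalar product of the ambient space as a continuous bilinear map. -/
noncomputable def formL (c : ℝ) (m : ℕ) : Ambient m →L[ℝ] Ambient m →L[ℝ] ℝ :=
  (LinearMap.mk₂ ℝ (form c) (form_add_left c) (form_smul_left c)
    (fun p q r => by rw [form_symm, form_add_left, form_symm c q, form_symm c r])
    (fun a p q => by rw [form_symm, form_smul_left, form_symm c q, smul_eq_mul])
    ).toContinuousBilinearMap

@[simp] theorem formL_apply (c : ℝ) (p q : Ambient m) : formL c m p q = form c p q := rfl

theorem form_self_pos_of_nonneg {c : ℝ} (hc : 0 ≤ c) {ξ : Ambient m} (hξ : ξ ≠ 0) :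
    0 < form c ξ ξ := by
  rw [form, if_neg hc.not_gt, one_mul, ← Fin.sum_univ_succ (fun i => ξ i * ξ i)]
  obtain ⟨i, hi⟩ := Function.ne_iff.1 hξ
  exact Finset.sum_pos' (fun i _ => mul_self_nonneg _) ⟨i, Finset.mem_univ _, mul_self_pos.2 hi⟩

theorem form_self_pos_of_neg {c : ℝ} (hc : c < 0) {p ξ : Ambient m} (hp : form c p p < 0)
    (hpξ : form c p ξ = 0) (hξ : ξ ≠ 0) : 0 < form c ξ ξ := by
  simp only [form, if_pos hc] at hp hpξ ⊢
  by_contra! hle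
  have hcauchy := Finset.sum_mul_sq_le_sq_mul_sq Finset.univ (fun i : Fin m => p i.succ)
    (fun i => ξ i.succ)
  simp only [pow_two] at hcauchy
  have hp' : 0 ≤ ∑ i : Fin m, p i.succ * p i.succ :=
    Finset.sum_nonneg fun i _ => mul_self_nonneg _
  have hξ' : ∀ i ∈ Finset.univ, 0 ≤ ξ (Fin.succ i) * ξ i.succ := fun i _ => mul_self_nonneg _
  rcases eq_or_ne (ξ 0) 0 with h₀ | h₀
  · have hzero := (Finset.sum_eq_zero_iff_of_nonneg hξ').1
      (le_antisymm (by simpa [h₀] using hle) (Finset.sum_nonneg hξ'))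
    exact hξ (funext (Fin.cases h₀ fun i => mul_self_eq_zero.1 (hzero i (Finset.mem_univ i))))
  · have hspace : ∑ i : Fin m, p i.succ * ξ i.succ = p 0 * ξ 0 := by linarith
    rw [hspace] at hcauchy
    have hξ₀ : 0 < ξ 0 * ξ 0 := mul_self_pos.2 h₀
    nlinarith [mul_le_mul_of_nonneg_left (sub_nonneg.2 hle) hp']

theorem form_self_pos {c : ℝ} {p ξ : Ambient m} (hp : p ∈ SpaceForm c m) (ht : IsTangent c p ξ)
    (hξ : ξ ≠ 0) : 0 < form c ξ ξ := by
  rcases le_or_gt 0 c with hc | hc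
  · exact form_self_pos_of_nonneg hc hξ
  · simp only [SpaceForm, Set.mem_ofPred_eq, if_neg hc.ne, IsTangent] at hp ht
    exact form_self_pos_of_neg hc (hp.1.trans_lt (one_div_neg.2 hc)) ht hξ

theorem IsTangent.sub {c : ℝ} {p v w : Ambient m} (hv : IsTangent c p v) (hw : IsTangent c p w) :
    IsTangent c p (v - w) := by
  unfold IsTangent at *
  split_ifs at * with hc
  · simp [hv, hw]
  · simpa [hv, hw] using (map_sub (formL c m p) v w)

theorem IsTangent.mul_form {c : ℝ} {p v : Ambient m} (hv : IsTangent c p v) :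
    c * form c v p = 0 := by
  unfold IsTangent at hv
  split_ifs at hv with hc
  · simp [hc]
  · rw [form_symm, hv, mul_zero]

end Form

section Charts

open Filter Topology

variable {n m : ℕ} {M : Type*} [TopologicalSpace M] [ChartedSpace (Coord n) M]
  [IsManifold (𝓡 n) ∞ M]

theorem mdifferentiableAt_extChartAt_symm_of_mem (x : M) {u : Coord n}
    (hu : u ∈ (extChartAt (𝓡 n) x).target) :
    MDifferentiableAt 𝓘(ℝ, Coord n) (𝓡 n) (extChartAt (𝓡 n) x).symm u :=
  ((contMDiffOn_extChartAt_symm (n := ∞) x).contMDiffAt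
    ((isOpen_extChartAt_target x).mem_nhds hu)).mdifferentiableAt (by simp)

/-- The differential of the inverse chart. -/
noncomputable def chartSymmD (x : M) (u : Coord n) :
    Coord n →L[ℝ] TangentSpace (𝓡 n) ((extChartAt (𝓡 n) x).symm u) :=
  mfderiv 𝓘(ℝ, Coord n) (𝓡 n) (extChartAt (𝓡 n) x).symm u

/-- The differential of the chart at `x`, at the point with coordinates `u`. -/
noncomputable def chartD (x : M) (u : Coord n) :
    TangentSpace (𝓡 n) ((extChartAt (𝓡 n) x).symm u) →L[ℝ] Coord n :=
  mfderiv (𝓡 n) 𝓘(ℝ, Coord n) (extChartAt (𝓡 n) x) ((extChartAt (𝓡 n) x).symm u)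

theorem chartD_chartSymmD (x : M) {u : Coord n} (hu : u ∈ (extChartAt (𝓡 n) x).target)
    (v : Coord n) : chartD x u (chartSymmD x u v) = v := by
  have hcomp := mfderiv_extChartAt_comp_mfderivWithin_extChartAt_symm (I := 𝓡 n) hu
  rw [ModelWithCorners.range_eq_univ, mfderivWithin_univ] at hcomp
  exact DFunLike.congr_fun hcomp v

theorem chartSymmD_chartD (x : M) {u : Coord n} (hu : u ∈ (extChartAt (𝓡 n) x).target)
    (X : TangentSpace (𝓡 n) ((extChartAt (𝓡 n) x).symm u)) :
    chartSymmD x u (chartD x u X) = X := by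
  have hcomp := mfderivWithin_extChartAt_symm_comp_mfderiv_extChartAt (I := 𝓡 n) hu
  rw [ModelWithCorners.range_eq_univ, mfderivWithin_univ] at hcomp
  exact DFunLike.congr_fun hcomp X

theorem contDiffOn_inChart {f : M → Ambient m} (hf : ContMDiff (𝓡 n) 𝓘(ℝ, Ambient m) ∞ f) (x : M) :
    ContDiffOn ℝ ∞ (inChart n f x) (extChartAt (𝓡 n) x).target :=
  contMDiffOn_iff_contDiffOn.1 (hf.comp_contMDiffOn (contMDiffOn_extChartAt_symm x))

theorem fderiv_inChart {f : M → Ambient m} (hf : ContMDiff (𝓡 n) 𝓘(ℝ, Ambient m) ∞ f) (x : M)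
    {u : Coord n} (hu : u ∈ (extChartAt (𝓡 n) x).target) (v : Coord n) :
    fderiv ℝ (inChart n f x) u v
      = differential f ((extChartAt (𝓡 n) x).symm u) (chartSymmD x u v) := by
  have hdf : MDifferentiableAt (𝓡 n) 𝓘(ℝ, Ambient m) f ((extChartAt (𝓡 n) x).symm u) :=
    (hf _).mdifferentiableAt (by simp)
  have hcomp := mfderiv_comp (I := 𝓘(ℝ, Coord n)) u hdf
    (mdifferentiableAt_extChartAt_symm_of_mem x hu)
  rw [mfderiv_eq_fderiv] at hcomp
  exact DFunLike.congr_fun hcomp v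

variable [RiemannianBundle (fun y : M => TangentSpace (𝓡 n) y)] {c : ℝ} {f : M → Ambient m}

namespace IsIsometricImmersion

variable (hf : IsIsometricImmersion (n := n) c f) (x : M)
include hf

theorem inducedMetric_inChart {u : Coord n} (hu : u ∈ (extChartAt (𝓡 n) x).target)
    (v w : Coord n) : inducedMetric (formL c m) (inChart n f x) u v w
      = inner ℝ (chartSymmD x u v) (chartSymmD x u w) := by
  rw [inducedMetric_apply, formL_apply, fderiv_inChart hf.smooth x hu,
    fderiv_inChart hf.smooth x hu, hf.isometric]

theorem radial {u : Coord n} (hu : u ∈ (extChartAt (𝓡 n) x).target) (v : Coord n) :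
    c * form c (inChart n f x u) (fderiv ℝ (inChart n f x) u v) = 0 := by
  by_cases hc : c = 0
  · simp [hc]
  have hF : DifferentiableAt ℝ (inChart n f x) u :=
    differentiableAt_of_contDiffOn_infty (isOpen_extChartAt_target x) hu
      (contDiffOn_inChart hf.smooth x)
  have hnorm : Set.EqOn (fun y => formL c m (inChart n f x y) (inChart n f x y))
      (fun _ => 1 / c) (extChartAt (𝓡 n) x).target := fun y _ => by
    have hmem := hf.mem_spaceForm ((extChartAt (𝓡 n) x).symm y)
    simp only [SpaceForm, Set.mem_ofPred_eq, if_neg hc] at hmem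
    exact hmem.1
  have hderiv := DFunLike.congr_fun
    (fderiv_eq_zero_of_eqOn_const (𝕜 := ℝ) (isOpen_extChartAt_target x) hu hnorm) v
  rw [fderiv_bilinear_apply (formL c m) hF hF, formL_apply, formL_apply,
    form_symm c (fderiv ℝ (inChart n f x) u v), zero_apply] at hderiv
  linear_combination c / 2 * hderiv

theorem isLocalImmersion :
    IsLocalImmersion (formL c m) c (inChart n f x) (extChartAt (𝓡 n) x).target where
  isOpen := isOpen_extChartAt_target x
  smooth := contDiffOn_inChart hf.smooth x
  symm p q := form_symm c p q
  pos u hu v hv := by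
    rw [hf.inducedMetric_inChart x hu]
    refine real_inner_self_pos.2 fun h0 => hv ?_
    rw [← chartD_chartSymmD x hu v, h0, map_zero]
  radial u hu v := hf.radial x hu v

theorem metricInChart_eq {u : Coord n} (hu : u ∈ (extChartAt (𝓡 n) x).target) :
    metricInChart x u = gramMatrix (formL c m) (coordBasis n) (inChart n f x) u := by
  ext i j
  rw [gramMatrix, Matrix.of_apply, hf.inducedMetric_inChart x hu]
  simp [metricInChart, chartSymmD, coordBasis]

end IsIsometricImmersion
end Charts

section PrincipalDatum

open Filter Topology

theorem fderiv_fderiv_comp {E E' W : Type*} [NormedAddCommGroup E] [NormedSpace ℝ E]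
    [NormedAddCommGroup E'] [NormedSpace ℝ E'] [NormedAddCommGroup W] [NormedSpace ℝ W]
    {p : E' → W} {θ : E → E'} {u : E} (hp : ContDiffAt ℝ 2 p (θ u)) (hθ : ContDiffAt ℝ 2 θ u)
    (v w : E) :
    fderiv ℝ (fderiv ℝ (p ∘ θ)) u v w
      = fderiv ℝ (fderiv ℝ p) (θ u) (fderiv ℝ θ u v) (fderiv ℝ θ u w)
        + fderiv ℝ p (θ u) (fderiv ℝ (fderiv ℝ θ) u v w) := by
  have hchain : fderiv ℝ (p ∘ θ) =ᶠ[𝓝 u] fun x => (fderiv ℝ p (θ x)).comp (fderiv ℝ θ x) := by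
    filter_upwards [hθ.continuousAt.eventually (hp.eventually (by simp)),
      hθ.eventually (by simp)] with x hpx hθx
    exact fderiv_comp x (hpx.differentiableAt (by simp)) (hθx.differentiableAt (by simp))
  have hp' : DifferentiableAt ℝ (fderiv ℝ p) (θ u) :=
    (hp.fderiv_right (m := 1) (by norm_num)).differentiableAt (by simp)
  have hθ' : DifferentiableAt ℝ (fderiv ℝ θ) u :=
    (hθ.fderiv_right (m := 1) (by norm_num)).differentiableAt (by simp)
  have hθ₁ : DifferentiableAt ℝ θ u := hθ.differentiableAt (by simp)
  have hpθ : DifferentiableAt ℝ (fun x => fderiv ℝ p (θ x)) u := hp'.comp u hθ₁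
  have hcomp : fderiv ℝ (fun x => fderiv ℝ p (θ x)) u
      = (fderiv ℝ (fderiv ℝ p) (θ u)).comp (fderiv ℝ θ u) := fderiv_comp u hp' hθ₁
  rw [hchain.fderiv_eq, fderiv_clm_comp hpθ hθ']
  simp [hcomp, add_comm]

theorem exists_eq_add_normalPart {n m : ℕ} (c : ℝ) (F : Coord n → Ambient m) (u : Coord n)
    (w : Ambient m) :
    ∃ γ, w = fderiv ℝ F u γ + normalPart c F u w + (c * form c w (F u)) • F u := by
  refine ⟨∑ k, ∑ l, ((gram c F u)⁻¹ k l * form c w (partialD k F u)) •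
    EuclideanSpace.single l 1, ?_⟩
  simp only [map_sum, map_smul, normalPart, partialD]
  abel

variable {n m : ℕ} {M : Type*} [TopologicalSpace M] [ChartedSpace (Coord n) M]
  {c : ℝ} {f : M → Ambient m}

theorem secondFundamentalForm_add_left (x : M) (X X' Y : TangentSpace (𝓡 n) x) :
    secondFundamentalForm c f x (X + X') Y
      = secondFundamentalForm c f x X Y + secondFundamentalForm c f x X' Y := by
  simp only [secondFundamentalForm, secondFF, map_add, normalPart_add]

variable [RiemannianBundle (fun y : M => TangentSpace (𝓡 n) y)]

/-- `η` and `ζ` are distinct normal vectors at `x`, and `T` a unit tangent vector, such that the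
second fundamental form is `⟨X, Y⟩ ζ + ⟨X, T⟩ ⟨Y, T⟩ (η - ζ)`: the pointwise content of having
principal normals `η` and `ζ` of multiplicities `1` and `n - 1`. -/
structure IsPrincipalDatum (c : ℝ) (f : M → Ambient m) (x : M) (T : TangentSpace (𝓡 n) x)
    (η ζ : Ambient m) : Prop where
  unit : inner ℝ T T = (1 : ℝ)
  normal_eta : IsNormal n c f x η
  normal_zeta : IsNormal n c f x ζ
  ne : η ≠ ζ
  second : ∀ X Y : TangentSpace (𝓡 n) x, secondFundamentalForm c f x X Y
    = (inner ℝ X Y : ℝ) • ζ + ((inner ℝ X T : ℝ) * inner ℝ Y T) • (η - ζ)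

theorem ArePrincipalNormals.exists_add {x : M} {η : Fin 2 → Ambient m}
    (h : ArePrincipalNormals n c f x η) (X : TangentSpace (𝓡 n) x) :
    ∃ X₁ ∈ principalSpace (n := n) c f x (η 0), ∃ X₂ ∈ principalSpace (n := n) c f x (η 1),
      X₁ + X₂ = X := by
  have hsup : principalSpace (n := n) c f x (η 0) ⊔ principalSpace (n := n) c f x (η 1) = ⊤ :=
    top_le_iff.1 (h.iSup_eq_top ▸ iSup_le (Fin.forall_fin_two.2 ⟨le_sup_left, le_sup_right⟩))
  exact Submodule.mem_sup.1 (hsup ▸ Submodule.mem_top)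

theorem exists_inner_self_eq_one_and_forall_eq_smul {V : Type*} [NormedAddCommGroup V]
    [InnerProductSpace ℝ V] {P : Submodule ℝ V} (hP : Module.finrank ℝ P = 1) :
    ∃ T ∈ P, inner ℝ T T = (1 : ℝ) ∧ ∀ X ∈ P, ∃ a : ℝ, X = a • T := by
  obtain ⟨⟨X₀, hX₀⟩, hne, hspan⟩ := finrank_eq_one_iff'.1 hP
  have hpos : 0 < ‖X₀‖ := norm_pos_iff.2 fun h0 => hne (Subtype.ext h0)
  refine ⟨‖X₀‖⁻¹ • X₀, P.smul_mem _ hX₀, ?_, fun X hX => ?_⟩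
  · rw [real_inner_smul_left, real_inner_smul_right, real_inner_self_eq_norm_sq]
    field_simp
  · obtain ⟨a, ha⟩ := hspan ⟨X, hX⟩
    have hX' : a • X₀ = X := congrArg Subtype.val ha
    exact ⟨a * ‖X₀‖, by rw [smul_smul, mul_assoc, mul_inv_cancel₀ hpos.ne', mul_one, hX']⟩

theorem HasType.exists_isPrincipalDatum {k : ℕ} (h : HasType n c f ![1, k]) (x : M) :
    ∃ (T : TangentSpace (𝓡 n) x) (η ζ : Ambient m), IsPrincipalDatum c f x T η ζ := by
  obtain ⟨η, hη, hdim⟩ := h x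
  obtain ⟨T, hT, hunit, hspan⟩ := exists_inner_self_eq_one_and_forall_eq_smul (hdim 0)
  refine ⟨T, η 0, η 1, hunit, hη.normal 0, hη.normal 1, hη.distinct.ne (by decide), fun X Y => ?_⟩
  obtain ⟨X₁, hX₁, X₂, hX₂, rfl⟩ := hη.exists_add X
  obtain ⟨a, rfl⟩ := hspan X₁ hX₁
  have horth : inner ℝ X₂ T = (0 : ℝ) := by
    rw [real_inner_comm]
    exact hη.orthogonal 0 1 (by decide) T hT X₂ hX₂
  rw [secondFundamentalForm_add_left, hX₁ Y, hX₂ Y, inner_add_left, inner_add_left, horth,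
    add_zero, real_inner_smul_left, real_inner_smul_left, hunit, real_inner_comm Y T]
  module

end PrincipalDatum

section PrincipalFrame

open Filter Topology

variable {n m : ℕ} {M : Type*} [TopologicalSpace M] [ChartedSpace (Coord n) M]
  [IsManifold (𝓡 n) ∞ M] {c : ℝ} {f : M → Ambient m}

theorem mdifferentiableAt_extChartAt_self (y : M) :
    MDifferentiableAt (𝓡 n) 𝓘(ℝ, Coord n) (extChartAt (𝓡 n) y) y :=
  mdifferentiableAt_extChartAt (mem_chart_source _ y)

theorem exists_coords_eq (y : M) (v : Coord n) : ∃ X : TangentSpace (𝓡 n) y, coords y X = v := by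
  obtain ⟨Φ, hΦ⟩ := isInvertible_mfderiv_extChartAt (I := 𝓡 n) (mem_extChartAt_source y)
  exact ⟨Φ.symm v, by rw [coords, ← hΦ]; exact Φ.apply_symm_apply v⟩

theorem fderiv_inChart_coords (hf : ContMDiff (𝓡 n) 𝓘(ℝ, Ambient m) ∞ f) (y : M)
    (X : TangentSpace (𝓡 n) y) :
    fderiv ℝ (inChart n f y) (extChartAt (𝓡 n) y y) (coords y X) = differential f y X := by
  have hF : DifferentiableAt ℝ (inChart n f y) (extChartAt (𝓡 n) y y) :=
    differentiableAt_of_contDiffOn_infty (isOpen_extChartAt_target y) (mem_extChartAt_target y)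
      (contDiffOn_inChart hf y)
  have hcomp := mfderiv_comp (I := 𝓡 n) (I' := 𝓘(ℝ, Coord n)) (I'' := 𝓘(ℝ, Ambient m)) y
    hF.mdifferentiableAt (mdifferentiableAt_extChartAt_self y)
  have hloc : inChart n f y ∘ extChartAt (𝓡 n) y =ᶠ[𝓝 y] f := by
    filter_upwards [extChartAt_source_mem_nhds (I := 𝓡 n) y] with z hz
    simp only [Function.comp, inChart, (extChartAt (𝓡 n) y).left_inv hz]
  rw [hloc.mfderiv_eq, mfderiv_eq_fderiv] at hcomp
  exact (DFunLike.congr_fun hcomp X).symm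

section Transition

variable {x y : M} {u : Coord n} (hu : u ∈ (extChartAt (𝓡 n) x).target)
include hu

theorem contMDiffAt_extChartAt_symm_of_mem :
    ContMDiffAt 𝓘(ℝ, Coord n) (𝓡 n) ∞ (extChartAt (𝓡 n) x).symm u :=
  (contMDiffOn_extChartAt_symm x).contMDiffAt ((isOpen_extChartAt_target x).mem_nhds hu)

theorem fderiv_transition (v : Coord n) :
    fderiv ℝ (extChartAt (𝓡 n) ((extChartAt (𝓡 n) x).symm u) ∘ (extChartAt (𝓡 n) x).symm) u v
      = coords ((extChartAt (𝓡 n) x).symm u) (chartSymmD x u v) := by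
  have hcomp := mfderiv_comp (I := 𝓘(ℝ, Coord n)) (I' := 𝓡 n) (I'' := 𝓘(ℝ, Coord n)) u
    (mdifferentiableAt_extChartAt_self ((extChartAt (𝓡 n) x).symm u))
    (mdifferentiableAt_extChartAt_symm_of_mem x hu)
  rw [mfderiv_eq_fderiv] at hcomp
  exact DFunLike.congr_fun hcomp v

theorem exists_fderiv_fderiv_inChart (hf : ContMDiff (𝓡 n) 𝓘(ℝ, Ambient m) ∞ f)
    (hy : (extChartAt (𝓡 n) x).symm u = y) (v w : Coord n) :
    ∃ Z : TangentSpace (𝓡 n) ((extChartAt (𝓡 n) x).symm u),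
      fderiv ℝ (fderiv ℝ (inChart n f x)) u v w
        = fderiv ℝ (fderiv ℝ (inChart n f y)) (extChartAt (𝓡 n) y y)
            (coords _ (chartSymmD x u v)) (coords _ (chartSymmD x u w))
          + differential f ((extChartAt (𝓡 n) x).symm u) Z := by
  subst hy
  set y := (extChartAt (𝓡 n) x).symm u
  let θ : Coord n → Coord n := extChartAt (𝓡 n) y ∘ (extChartAt (𝓡 n) x).symm
  have hsymm := contMDiffAt_extChartAt_symm_of_mem hu
  have hθ : ContDiffAt ℝ ∞ θ u :=
    contMDiffAt_iff_contDiffAt.1 (ContMDiffAt.comp u contMDiffAt_extChartAt hsymm)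
  have hloc : inChart n f x =ᶠ[𝓝 u] inChart n f y ∘ θ := by
    filter_upwards [hsymm.continuousAt.preimage_mem_nhds (extChartAt_source_mem_nhds (I := 𝓡 n) y)]
      with z hz
    simp only [Function.comp, inChart, θ, (extChartAt (𝓡 n) y).left_inv hz]
  have hF : ContDiffAt ℝ ∞ (inChart n f y) (θ u) :=
    (contDiffOn_inChart hf y).contDiffAt ((isOpen_extChartAt_target y).mem_nhds
      (mem_extChartAt_target y))
  obtain ⟨Z, hZ⟩ := exists_coords_eq y (fderiv ℝ (fderiv ℝ θ) u v w)
  refine ⟨Z, ?_⟩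
  rw [hloc.fderiv.fderiv_eq, fderiv_fderiv_comp (contDiffAt_infty.1 hF 2)
      (contDiffAt_infty.1 hθ 2),
    fderiv_transition hu, fderiv_transition hu, ← hZ, ← fderiv_inChart_coords hf]
  rfl

end Transition

variable [RiemannianBundle (fun y : M => TangentSpace (𝓡 n) y)]
  (hf : IsIsometricImmersion (n := n) c f)
include hf

theorem IsIsometricImmersion.exists_gauss_formula (y : M) (X Y : TangentSpace (𝓡 n) y) :
    ∃ Z : TangentSpace (𝓡 n) y, fderiv ℝ (fderiv ℝ (inChart n f y)) (extChartAt (𝓡 n) y y)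
        (coords y X) (coords y Y)
      = differential f y Z + secondFundamentalForm c f y X Y - (c * inner ℝ X Y) • f y := by
  have hI := hf.isLocalImmersion y
  have hy := mem_extChartAt_target (I := 𝓡 n) y
  obtain ⟨γ, hγ⟩ := exists_eq_add_normalPart c (inChart n f y) (extChartAt (𝓡 n) y y)
    (fderiv ℝ (fderiv ℝ (inChart n f y)) (extChartAt (𝓡 n) y y) (coords y X) (coords y Y))
  obtain ⟨Z, rfl⟩ := exists_coords_eq y γ
  have hrad := hI.radial_fderiv_fderiv hy (coords y X) (coords y Y)
  rw [formL_apply, form_symm, inducedMetric_apply, formL_apply, fderiv_inChart_coords hf.smooth,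
    fderiv_inChart_coords hf.smooth, hf.isometric] at hrad
  have hpos : inChart n f y (extChartAt (𝓡 n) y y) = f y := by
    simp only [inChart, (extChartAt (𝓡 n) y).left_inv (mem_extChartAt_source y)]
  refine ⟨Z, ?_⟩
  rw [hrad, fderiv_inChart_coords hf.smooth, hpos] at hγ
  rw [hγ, secondFundamentalForm, secondFF, fderiv_clm_apply_const (hI.differentiableAt_fderiv hy)]
  module

theorem IsPrincipalDatum.isPrincipalFrameAt {x : M} {u : Coord n}
    (hu : u ∈ (extChartAt (𝓡 n) x).target)
    {T : TangentSpace (𝓡 n) ((extChartAt (𝓡 n) x).symm u)} {η ζ : Ambient m}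
    (h : IsPrincipalDatum c f ((extChartAt (𝓡 n) x).symm u) T η ζ) :
    IsPrincipalFrameAt (formL c m) c (inChart n f x) u (chartD x u T) η ζ where
  unit := by rw [hf.inducedMetric_inChart x hu, chartSymmD_chartD x hu, h.unit]
  normal_eta :=
    ⟨fun v => by rw [formL_apply, fderiv_inChart hf.smooth x hu]; exact h.normal_eta.2 _,
      h.normal_eta.1.mul_form⟩
  normal_zeta :=
    ⟨fun v => by rw [formL_apply, fderiv_inChart hf.smooth x hu]; exact h.normal_zeta.2 _,
      h.normal_zeta.1.mul_form⟩
  diff_pos := form_self_pos (hf.mem_spaceForm _) (h.normal_eta.1.sub h.normal_zeta.1)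
    (sub_ne_zero.2 h.ne)
  gauss_formula v w := by
    obtain ⟨Z, hZ⟩ := exists_fderiv_fderiv_inChart hu hf.smooth rfl v w
    obtain ⟨Z', hZ'⟩ := hf.exists_gauss_formula _ (chartSymmD x u v) (chartSymmD x u w)
    refine ⟨chartD x u (Z + Z'), ?_⟩
    rw [hZ, hZ', h.second, fderiv_inChart hf.smooth x hu, hf.inducedMetric_inChart x hu,
      hf.inducedMetric_inChart x hu, hf.inducedMetric_inChart x hu, chartSymmD_chartD x hu,
      chartSymmD_chartD x hu, map_add, show inChart n f x u = f ((extChartAt (𝓡 n) x).symm u) from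
        rfl]
    module

end PrincipalFrame

section Calculus

open Filter Topology

theorem eventually_add_mul_lt_of_hasLineDerivAt {E : Type*} [AddCommGroup E] [Module ℝ E]
    {g : E → ℝ} {g' r : ℝ} {x v : E} (h : HasLineDerivAt ℝ g g' x v) (hr : r < g') :
    ∀ᶠ s in 𝓝[>] (0 : ℝ), g x + r * s < g (x + s • v) := by
  filter_upwards [h.tendsto_slope_zero_right.eventually_const_lt hr, self_mem_nhdsWithin]
    with s hs hs₀
  rw [smul_eq_mul, inv_mul_eq_div, lt_div_iff₀ hs₀] at hs
  linarith

theorem deriv_deriv_nonpos_of_isLocalMax {p : ℝ → ℝ} {a : ℝ} (hm : IsLocalMax p a)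
    (hp : ContinuousAt p a) : deriv (deriv p) a ≤ 0 := by
  by_contra! hpos
  have hmin : IsLocalMin p a := isLocalMin_of_deriv_deriv_pos hpos hm.deriv_eq_zero hp
  have hconst : p =ᶠ[𝓝 a] fun _ => p a := by
    filter_upwards [hm, hmin] with s hle hge using le_antisymm hle hge
  have hderiv : deriv p =ᶠ[𝓝 a] fun _ => 0 := by simpa using hconst.deriv
  simp [hderiv.deriv_eq] at hpos

section SecondDerivative

variable {E : Type*} [NormedAddCommGroup E] [NormedSpace ℝ E] {p : E → ℝ} {u : E}

theorem hasDerivAt_add_smul (u v : E) (s : ℝ) : HasDerivAt (fun s : ℝ => u + s • v) v s := by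
  simpa using ((hasDerivAt_id s).smul_const v).const_add u

theorem tendsto_add_smul_zero (u v : E) : Tendsto (fun s : ℝ => u + s • v) (𝓝 0) (𝓝 u) := by
  simpa using (hasDerivAt_add_smul u v 0).continuousAt.tendsto

theorem deriv_deriv_add_smul (hp : ContDiffAt ℝ 2 p u) (v : E) :
    deriv (deriv fun s : ℝ => p (u + s • v)) 0 = fderiv ℝ (fderiv ℝ p) u v v := by
  have hderiv : (deriv fun s : ℝ => p (u + s • v)) =ᶠ[𝓝 0] fun s => fderiv ℝ p (u + s • v) v := by
    filter_upwards [(tendsto_add_smul_zero u v).eventually (hp.eventually (by simp))] with s hs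
    exact ((hs.differentiableAt (by simp)).hasFDerivAt.comp_hasDerivAt s
      (hasDerivAt_add_smul u v s)).deriv
  have hfderiv : DifferentiableAt ℝ (fderiv ℝ p) u :=
    (hp.fderiv_right (m := 1) (by norm_num)).differentiableAt (by simp)
  rw [hderiv.deriv_eq, ← fderiv_clm_apply_const hfderiv]
  exact (hfderiv.clm_apply (differentiableAt_const v)).lineDeriv_eq_fderiv

theorem fderiv_fderiv_nonpos_of_isLocalMax (hm : IsLocalMax p u) (hp : ContDiffAt ℝ 2 p u)
    (v : E) : fderiv ℝ (fderiv ℝ p) u v v ≤ 0 := by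
  have hline := tendsto_add_smul_zero u v
  rw [← deriv_deriv_add_smul hp]
  refine deriv_deriv_nonpos_of_isLocalMax ?_ ?_
  · filter_upwards [hline.eventually hm] with s hs
    simpa using hs
  · exact hp.continuousAt.comp_of_eq (hasDerivAt_add_smul u v 0).continuousAt (by simp)

end SecondDerivative

theorem eventually_eq_zero_of_hasFDerivAt_smul {E : Type*} [NormedAddCommGroup E]
    [NormedSpace ℝ E] {w : E → ℝ} {L : E → E →L[ℝ] ℝ} {u₀ : E}
    (hw : ∀ᶠ u in 𝓝 u₀, HasFDerivAt w (w u • L u) u) (hL : ContinuousAt L u₀) (h0 : w u₀ = 0) :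
    ∀ᶠ u in 𝓝 u₀, w u = 0 := by
  obtain ⟨r, hr, hball⟩ := Metric.eventually_nhds_iff_ball.1
    (hw.and (hL.norm.eventually_lt_const (lt_add_one ‖L u₀‖)))
  filter_upwards [Metric.ball_mem_nhds u₀ hr] with u hu
  have hk : ∀ s ∈ Set.Icc (0 : ℝ) 1, u₀ + s • (u - u₀) ∈ Metric.ball u₀ r := fun s hs =>
    (convex_ball u₀ r).add_smul_sub_mem (Metric.mem_ball_self hr) hu hs
  have hder : ∀ s ∈ Set.Icc (0 : ℝ) 1, HasDerivAt (fun s : ℝ => w (u₀ + s • (u - u₀)))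
      ((w (u₀ + s • (u - u₀)) • L (u₀ + s • (u - u₀))) (u - u₀)) s := fun s hs =>
    (hball _ (hk s hs)).1.comp_hasDerivAt s (hasDerivAt_add_smul u₀ (u - u₀) s)
  have hzero := eq_zero_of_abs_deriv_le_mul_abs_self_of_eq_zero_right
    (K := (‖L u₀‖ + 1) * ‖u - u₀‖)
    (fun s hs => (hder s hs).continuousAt.continuousWithinAt)
    (fun s hs => (hder s (Set.Ico_subset_Icc_self hs)).hasDerivWithinAt) (by simpa using h0)
    (fun s hs => by
      rw [smul_apply, norm_smul, mul_comm]
      exact mul_le_mul_of_nonneg_right ((L _).le_of_opNorm_le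
        (hball _ (hk s (Set.Ico_subset_Icc_self hs))).2.le _) (norm_nonneg _))
    1 ⟨zero_le_one, le_rfl⟩
  simpa using hzero

end Calculus

section Gap

open Filter Topology

/-- The function `n ⟨ζ, ζ⟩ - ρ`. When `2 ⟨η, ζ⟩ + (n - 2) ⟨ζ, ζ⟩ = ρ`, that is, when the scalar
curvature is constant, it equals `2 (⟨ζ, ζ⟩ - ⟨η, ζ⟩)`. -/
noncomputable def gap {X A : Type*} [NormedAddCommGroup A] [NormedSpace ℝ A]
    (B : A →L[ℝ] A →L[ℝ] ℝ) (N ρ : ℝ) (ζ : X → A) (x : X) : ℝ :=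
  N * B (ζ x) (ζ x) - ρ

variable {E A : Type*} [NormedAddCommGroup E] [NormedSpace ℝ E]
  [NormedAddCommGroup A] [NormedSpace ℝ A]

theorem umbilicity_neg (B : A →L[ℝ] A →L[ℝ] ℝ) (T : E → E) (η ζ : E → A) (u : E) :
    umbilicity B (-T) η ζ u = -umbilicity B T η ζ u := by
  rw [umbilicity, Pi.neg_apply, map_neg, map_neg, neg_apply, neg_div, umbilicity]

namespace IsPrincipalFrame

variable {B : A →L[ℝ] A →L[ℝ] ℝ} {c : ℝ} {F : E → A} {Ω : Set E} {T : E → E} {η ζ : E → A}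
  (h : IsPrincipalFrame B c F Ω T η ζ)

include h

theorem neg : IsPrincipalFrame B c F Ω (-T) η ζ where
  toIsLocalImmersion := h.toIsLocalImmersion
  smooth_T := h.smooth_T.neg
  smooth_eta := h.smooth_eta
  smooth_zeta := h.smooth_zeta
  frame u hu :=
    { unit := by simpa using (h.frame u hu).unit
      normal_eta := (h.frame u hu).normal_eta
      normal_zeta := (h.frame u hu).normal_zeta
      diff_pos := (h.frame u hu).diff_pos
      gauss_formula := by simpa using (h.frame u hu).gauss_formula }

theorem differentiableAt_gap {u : E} (hu : u ∈ Ω) (N ρ : ℝ) :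
    DifferentiableAt ℝ (gap B N ρ ζ) u :=
  ((differentiableAt_bilinear B (h.differentiableAt_zeta hu)
    (h.differentiableAt_zeta hu)).const_mul N).sub_const ρ

variable [FiniteDimensional ℝ E] (hE : 3 ≤ Module.finrank ℝ E) {ρ N : ℝ}
  (hρ : ∀ x ∈ Ω, 2 * B (η x) (ζ x) + (N - 2) * B (ζ x) (ζ x) = ρ) {u : E} (hu : u ∈ Ω)

include hE hρ hu

theorem hasFDerivAt_gap : HasFDerivAt (gap B N ρ ζ)
    (gap B N ρ ζ u • -(N * umbilicity B T η ζ u) • inducedMetric B F u (T u)) u := by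
  have hζ := h.differentiableAt_zeta hu
  refine (h.differentiableAt_gap hu N ρ).hasFDerivAt.congr_fderiv (ContinuousLinearMap.ext
    fun v => ?_)
  change fderiv ℝ (fun x => N * B (ζ x) (ζ x) - ρ) u v = _
  rw [fderiv_sub_const, fderiv_const_mul (differentiableAt_bilinear B hζ hζ)]
  simp only [smul_apply, smul_eq_mul, h.fderiv_inner_zeta_zeta hu hE, gap,
    h.inducedMetric_symm u (T u)]
  linear_combination (N * umbilicity B T η ζ u * inducedMetric B F u v (T u)) * hρ u hu

theorem eventually_gap_eq_zero (h0 : gap B N ρ ζ u = 0) : ∀ᶠ x in 𝓝 u, gap B N ρ ζ x = 0 := by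
  have hcont : ContinuousOn (fun x => -(N * umbilicity B T η ζ x) • inducedMetric B F x (T x)) Ω :=
    (continuousOn_const.mul h.contDiffOn_umbilicity.continuousOn).neg.smul
      ((B.continuous.comp_continuousOn h.contDiffOn_pushforward.continuousOn).clm_comp
        h.contDiffOn_fderiv.continuousOn)
  refine eventually_eq_zero_of_hasFDerivAt_smul ?_ (hcont.continuousAt (h.isOpen.mem_nhds hu)) h0
  filter_upwards [h.isOpen.mem_nhds hu] with x hx using h.hasFDerivAt_gap hE hρ hx

theorem hasLineDerivAt_gap_T : HasLineDerivAt ℝ (gap B N ρ ζ)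
    (-(N * umbilicity B T η ζ u * gap B N ρ ζ u)) u (T u) := by
  convert (h.hasFDerivAt_gap hE hρ hu).hasLineDerivAt (T u) using 1
  simp only [smul_apply, smul_eq_mul, (h.frame u hu).unit]
  ring

omit hρ in
theorem hasLineDerivAt_umbilicity_pow_div_gap {n : ℕ} (hn : n ≠ 0)
    (hρ : ∀ x ∈ Ω, 2 * B (η x) (ζ x) + (n - 2) * B (ζ x) (ζ x) = ρ)
    (hw : ∀ x ∈ Ω, gap B n ρ ζ x ≠ 0) :
    HasLineDerivAt ℝ (fun x => umbilicity B T η ζ x ^ n / gap B n ρ ζ x)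
      (-(n * umbilicity B T η ζ u ^ (n - 1) * (B (η u) (ζ u) + c)) / gap B n ρ ζ u) u (T u) := by
  have hψ := (differentiableAt_of_contDiffOn_infty h.isOpen hu
    h.contDiffOn_umbilicity).hasFDerivAt.hasLineDerivAt (T u)
  rw [h.riccati hu hE hρ hw] at hψ
  have hderiv := (HasDerivAt.fun_pow hψ n).fun_div (h.hasLineDerivAt_gap_T hE hρ hu)
    (by simpa using hw u hu)
  refine hderiv.congr_deriv ?_
  have hpow : umbilicity B T η ζ u ^ n
      = umbilicity B T η ζ u ^ (n - 1) * umbilicity B T η ζ u := (pow_sub_one_mul hn _).symm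
  have hne := hw u hu
  simp only [zero_smul, add_zero, hpow]
  field_simp
  ring

omit hρ in
theorem eventually_umbilicity_pow_div_gap_lt {n : ℕ} (hn : n ≠ 0)
    (hρ : ∀ x ∈ Ω, 2 * B (η x) (ζ x) + (n - 2) * B (ζ x) (ζ x) = ρ)
    (hw : ∀ x ∈ Ω, 0 < gap B n ρ ζ x) (hcurv : B (η u) (ζ u) + c < 0)
    (hψ : 0 < umbilicity B T η ζ u) :
    ∀ᶠ s in 𝓝[>] (0 : ℝ), umbilicity B T η ζ u ^ n / gap B n ρ ζ u
      < umbilicity B T η ζ (u + s • T u) ^ n / gap B n ρ ζ (u + s • T u) := by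
  have hpos : 0 < -(n * umbilicity B T η ζ u ^ (n - 1) * (B (η u) (ζ u) + c)) / gap B n ρ ζ u :=
    div_pos (neg_pos.2 (mul_neg_of_pos_of_neg (by positivity) hcurv)) (hw u hu)
  simpa only [zero_mul, add_zero] using eventually_add_mul_lt_of_hasLineDerivAt
    (h.hasLineDerivAt_umbilicity_pow_div_gap hE hu hn hρ fun x hx => (hw x hx).ne') hpos

theorem eventually_gap_add_mul_lt {δ : ℝ} (hδ : δ < N * umbilicity B T η ζ u * gap B N ρ ζ u) :
    ∀ᶠ s in 𝓝[>] (0 : ℝ), gap B N ρ ζ (u + s • T u) + δ * s < gap B N ρ ζ u := by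
  have hneg : HasLineDerivAt ℝ (fun x => -gap B N ρ ζ x)
      (N * umbilicity B T η ζ u * gap B N ρ ζ u) u (T u) :=
    (HasDerivAt.fun_neg (h.hasLineDerivAt_gap_T hE hρ hu)).congr_deriv (neg_neg _)
  filter_upwards [eventually_add_mul_lt_of_hasLineDerivAt hneg hδ] with s hs
  linarith

end IsPrincipalFrame

end Gap

section ChartAnalysis

open Filter Topology Manifold

theorem edist_le_mul_of_enorm_mfderiv_le {E H M : Type*} [NormedAddCommGroup E] [NormedSpace ℝ E]
    [TopologicalSpace H] {I : ModelWithCorners ℝ E H} [PseudoEMetricSpace M] [ChartedSpace H M]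
    [RiemannianBundle (fun x : M => TangentSpace I x)] [IsRiemannianManifold I M] {γ : ℝ → M}
    {a b : ℝ} {C : ENNReal} (hab : a ≤ b) (hγ : ContMDiffOn 𝓘(ℝ, ℝ) I 1 γ (Set.Icc a b))
    (hC : ∀ t ∈ Set.Icc a b, ‖mfderiv 𝓘(ℝ, ℝ) I γ t 1‖ₑ ≤ C) :
    edist (γ a) (γ b) ≤ C * ENNReal.ofReal (b - a) := by
  rw [IsRiemannianManifold.out (I := I) (γ a) (γ b)]
  calc riemannianEDist I (γ a) (γ b) ≤ pathELength I γ a b :=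
        riemannianEDist_le_pathELength hγ rfl rfl hab
    _ = ∫⁻ t in Set.Icc a b, ‖mfderiv 𝓘(ℝ, ℝ) I γ t 1‖ₑ := pathELength_eq_lintegral_mfderiv_Icc
    _ ≤ ∫⁻ _ in Set.Icc a b, C := MeasureTheory.setLIntegral_mono' measurableSet_Icc hC
    _ = C * ENNReal.ofReal (b - a) := by rw [MeasureTheory.setLIntegral_const, Real.volume_Icc]

variable {n m : ℕ} {M : Type*}

section Topological

variable [TopologicalSpace M] [ChartedSpace (Coord n) M]

theorem extChartAt_symm_extChartAt_self (x : M) :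
    (extChartAt (𝓡 n) x).symm (extChartAt (𝓡 n) x x) = x :=
  (extChartAt (𝓡 n) x).left_inv (mem_extChartAt_source x)

theorem eventually_of_chart {P : M → Prop} {x : M}
    (h : ∀ᶠ u in 𝓝 (extChartAt (𝓡 n) x x), P ((extChartAt (𝓡 n) x).symm u)) :
    ∀ᶠ y in 𝓝 x, P y := by
  filter_upwards [(continuousAt_extChartAt (I := 𝓡 n) x).eventually h,
    extChartAt_source_mem_nhds (I := 𝓡 n) x] with y hy hys
  rwa [(extChartAt (𝓡 n) x).left_inv hys] at hy

theorem continuousAt_of_chart {W : Type*} [TopologicalSpace W] {g : M → W} {x : M}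
    (h : ContinuousAt (fun u => g ((extChartAt (𝓡 n) x).symm u)) (extChartAt (𝓡 n) x x)) :
    ContinuousAt g x := fun U hU =>
  eventually_of_chart (n := n) (P := fun y => g y ∈ U)
    (h (by simpa only [extChartAt_symm_extChartAt_self] using hU))

/-- The derivative of a real function `g` in the direction of a tangent vector. -/
noncomputable def directionalD (g : M → ℝ) (x : M) (X : TangentSpace (𝓡 n) x) : ℝ :=
  mfderiv (𝓡 n) 𝓘(ℝ, ℝ) g x X

variable [IsManifold (𝓡 n) ∞ M]

theorem directionalD_eq_fderiv_chart {g : M → ℝ} (x : M) {u : Coord n}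
    (hu : u ∈ (extChartAt (𝓡 n) x).target)
    (hg : DifferentiableAt ℝ (fun u => g ((extChartAt (𝓡 n) x).symm u)) u)
    (X : TangentSpace (𝓡 n) ((extChartAt (𝓡 n) x).symm u)) :
    directionalD g ((extChartAt (𝓡 n) x).symm u) X
      = fderiv ℝ (fun u => g ((extChartAt (𝓡 n) x).symm u)) u (chartD x u X) := by
  have hs : (extChartAt (𝓡 n) x).symm u ∈ (extChartAt (𝓡 n) x).source :=
    (extChartAt (𝓡 n) x).map_target hu
  have hinv : extChartAt (𝓡 n) x ((extChartAt (𝓡 n) x).symm u) = u :=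
    (extChartAt (𝓡 n) x).right_inv hu
  have hcomp := mfderiv_comp_of_eq (I := 𝓡 n) (I' := 𝓘(ℝ, Coord n)) (I'' := 𝓘(ℝ, ℝ))
    hg.mdifferentiableAt
    (mdifferentiableAt_extChartAt (by rwa [extChartAt_source] at hs)) hinv
  have hloc : (fun u => g ((extChartAt (𝓡 n) x).symm u)) ∘ extChartAt (𝓡 n) x
      =ᶠ[𝓝 ((extChartAt (𝓡 n) x).symm u)] g := by
    filter_upwards [(isOpen_extChartAt_source x).mem_nhds hs] with z hz
    simp only [Function.comp, (extChartAt (𝓡 n) x).left_inv hz]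
  rw [hloc.mfderiv_eq, mfderiv_eq_fderiv, hinv] at hcomp
  exact DFunLike.congr_fun hcomp X

theorem mfderiv_extChartAt_symm_comp {x : M} {k : ℝ → Coord n} {v : Coord n} {t : ℝ}
    (hk : HasDerivAt k v t) (hu : k t ∈ (extChartAt (𝓡 n) x).target) :
    mfderiv 𝓘(ℝ, ℝ) (𝓡 n) ((extChartAt (𝓡 n) x).symm ∘ k) t 1 = chartSymmD x (k t) v := by
  rw [mfderiv_comp t (mdifferentiableAt_extChartAt_symm_of_mem x hu)
    hk.differentiableAt.mdifferentiableAt, mfderiv_eq_fderiv]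
  have hone : fderiv ℝ k t 1 = v := by rw [hk.hasFDerivAt.fderiv]; simp
  exact congrArg (chartSymmD x (k t)) hone

end Topological

variable {c : ℝ} {f : M → Ambient m}

theorem eventually_norm_chartSymmD_lt [TopologicalSpace M] [ChartedSpace (Coord n) M]
    [IsManifold (𝓡 n) ∞ M] [RiemannianBundle (fun x : M => TangentSpace (𝓡 n) x)]
    (hf : IsIsometricImmersion (n := n) c f) (x : M) {u : Coord n}
    (hu : u ∈ (extChartAt (𝓡 n) x).target) {v : Coord n} {C : ℝ} (hv : ‖chartSymmD x u v‖ < C) :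
    ∀ᶠ u' in 𝓝 u, ‖chartSymmD x u' v‖ < C := by
  have hI := hf.isLocalImmersion x
  have hnorm : ∀ u ∈ (extChartAt (𝓡 n) x).target,
      ‖chartSymmD x u v‖ = √(inducedMetric (formL c m) (inChart n f x) u v v) := fun u hu => by
    rw [hf.inducedMetric_inChart x hu, norm_eq_sqrt_real_inner]
  have hcont : ContinuousAt (fun u => √(inducedMetric (formL c m) (inChart n f x) u v v)) u :=
    (hI.differentiableAt_inducedMetric hu v v).continuousAt.sqrt
  filter_upwards [hI.isOpen.mem_nhds hu, hcont.eventually_lt_const (hnorm u hu ▸ hv)]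
    with u' hu' hlt
  rwa [hnorm u' hu']

theorem eventually_dist_chart_le [MetricSpace M] [ChartedSpace (Coord n) M] [IsManifold (𝓡 n) ∞ M]
    [RiemannianBundle (fun x : M => TangentSpace (𝓡 n) x)] [IsRiemannianManifold (𝓡 n) M]
    (hf : IsIsometricImmersion (n := n) c f) (x : M) {v : Coord n} {C : ℝ}
    (hv : ‖chartSymmD x (extChartAt (𝓡 n) x x) v‖ < C) :
    ∀ᶠ s in 𝓝[>] (0 : ℝ),
      dist x ((extChartAt (𝓡 n) x).symm (extChartAt (𝓡 n) x x + s • v)) ≤ C * s := by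
  set φ := extChartAt (𝓡 n) x
  let k : ℝ → Coord n := fun s => φ x + s • v
  have hC : 0 ≤ C := (norm_nonneg _).trans hv.le
  have hu : φ x ∈ φ.target := mem_extChartAt_target x
  obtain ⟨r, hr, hball⟩ := Metric.eventually_nhds_iff_ball.1
    ((tendsto_add_smul_zero (φ x) v).eventually
      (((isOpen_extChartAt_target x).eventually_mem hu).and
        (eventually_norm_chartSymmD_lt hf x hu hv)))
  filter_upwards [Ioo_mem_nhdsGT hr] with s hs
  have hin : ∀ t ∈ Set.Icc 0 s, k t ∈ φ.target ∧ ‖chartSymmD x (k t) v‖ < C := fun t ht => by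
    refine hball t ?_
    rw [Metric.mem_ball, Real.dist_0_eq_abs, abs_of_nonneg ht.1]
    exact ht.2.trans_lt hs.2
  have hsmooth : ContMDiffOn 𝓘(ℝ, ℝ) (𝓡 n) 1 (φ.symm ∘ k) (Set.Icc 0 s) :=
    ((contMDiffOn_extChartAt_symm (n := ∞) x).of_le (by simp)).comp
      (contDiff_const.add (contDiff_id.smul contDiff_const)).contMDiff.contMDiffOn
      fun t ht => (hin t ht).1
  have hlen := edist_le_mul_of_enorm_mfderiv_le (C := ENNReal.ofReal C) hs.1.le hsmooth
    fun t ht => by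
      rw [mfderiv_extChartAt_symm_comp (hasDerivAt_add_smul (φ x) v t) (hin t ht).1, ← ofReal_norm]
      exact ENNReal.ofReal_le_ofReal (hin t ht).2.le
  rw [sub_zero, ← ENNReal.ofReal_mul hC, edist_dist,
    ENNReal.ofReal_le_ofReal_iff (mul_nonneg hC hs.1.le)] at hlen
  simpa [k, φ] using hlen

end ChartAnalysis

section GlobalFrame

open Filter Topology

variable {n m : ℕ} {M : Type*} [TopologicalSpace M] [ChartedSpace (Coord n) M]

/-- The absolute value `|ψ|` of the umbilicity, read off from `dw(T) = -nψw` for the gap `w`, so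
that it is defined on the whole manifold although `T` is only determined up to sign. -/
noncomputable def absUmbilicity (c ρ : ℝ) (T : ∀ x : M, TangentSpace (𝓡 n) x) (ζ : M → Ambient m)
    (x : M) : ℝ :=
  |directionalD (gap (formL c m) n ρ ζ) x (T x) / (n * gap (formL c m) n ρ ζ x)|

variable [RiemannianBundle (fun y : M => TangentSpace (𝓡 n) y)]
  {c : ℝ} {f : M → Ambient m} (hf : IsIsometricImmersion (n := n) c f)
  {T : ∀ x : M, TangentSpace (𝓡 n) x} {η ζ : M → Ambient m}
  (hd : ∀ x, IsPrincipalDatum c f x (T x) (η x) (ζ x))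

include hf hd

theorem form_zeta_nonneg (x : M) : 0 ≤ form c (ζ x) (ζ x) := by
  by_cases h : ζ x = 0
  · rw [h]; exact ((formL c m 0).map_zero).ge
  · exact (form_self_pos (hf.mem_spaceForm x) (hd x).normal_zeta.1 h).le

theorem form_zeta_pos {x : M} (h : ζ x ≠ 0) : 0 < form c (ζ x) (ζ x) :=
  form_self_pos (hf.mem_spaceForm x) (hd x).normal_zeta.1 h

variable [IsManifold (𝓡 n) ∞ M]

theorem scalarCurvature_eq (x : M) :
    scalarCurvature (n := n) x
      = n * (n - 1) * c + (n - 1) * (2 * form c (η x) (ζ x) + (n - 2) * form c (ζ x) (ζ x)) := by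
  have hu : extChartAt (𝓡 n) x x ∈ (extChartAt (𝓡 n) x).target := mem_extChartAt_target x
  have hmetric : metricInChart x =ᶠ[𝓝 (extChartAt (𝓡 n) x x)]
      gramMatrix (formL c m) (coordBasis n) (inChart n f x) :=
    eventually_of_mem ((isOpen_extChartAt_target x).mem_nhds hu) fun u hu =>
      hf.metricInChart_eq x hu
  have hgauss := (hf.isLocalImmersion x).scalarCoord_gramMatrix hu
    ((hd _).isPrincipalFrameAt hf hu)
  rw [extChartAt_symm_extChartAt_self] at hgauss
  rw [scalarCurvature, scalarCoord_congr hmetric, hgauss]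
  simp only [formL_apply]

variable (hn : 3 ≤ n)

include hn

theorem exists_isPrincipalFrame (x : M) :
    ∃ (Ω : Set (Coord n)) (T' : Coord n → Coord n), extChartAt (𝓡 n) x x ∈ Ω ∧
      Ω ⊆ (extChartAt (𝓡 n) x).target ∧
      IsPrincipalFrame (formL c m) c (inChart n f x) Ω T' (inChart n η x) (inChart n ζ x) ∧
      ∀ u ∈ Ω, T' u = chartD x u (T ((extChartAt (𝓡 n) x).symm u)) ∨
        T' u = -chartD x u (T ((extChartAt (𝓡 n) x).symm u)) :=
  (hf.isLocalImmersion x).exists_isPrincipalFrame (coordBasis n) (by simpa using hn)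
    (fun _ hu => (hd _).isPrincipalFrameAt hf hu) (mem_extChartAt_target x)

theorem continuous_gap (ρ : ℝ) : Continuous (gap (formL c m) n ρ ζ) := by
  refine continuous_iff_continuousAt.2 fun x => continuousAt_of_chart (n := n) ?_
  obtain ⟨Ω, T', hu, -, hF, -⟩ := exists_isPrincipalFrame hf hd hn x
  exact (hF.differentiableAt_gap hu n ρ).continuousAt

variable {ρ : ℝ} (hρ : ∀ x, 2 * form c (η x) (ζ x) + ((n : ℝ) - 2) * form c (ζ x) (ζ x) = ρ)

include hρ

theorem isClopen_gap_eq_zero : IsClopen {x | gap (formL c m) n ρ ζ x = 0} := by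
  refine ⟨isClosed_eq (continuous_gap hf hd hn ρ) continuous_const,
    isOpen_iff_eventually.2 fun x hx => eventually_of_chart (n := n) ?_⟩
  obtain ⟨Ω, T', hu, -, hF, -⟩ := exists_isPrincipalFrame hf hd hn x
  refine hF.eventually_gap_eq_zero (N := n) (by simpa using hn) (fun u _ => hρ _) hu ?_
  rw [← extChartAt_symm_extChartAt_self (n := n) x] at hx
  exact hx

omit [RiemannianBundle (fun y : M => TangentSpace (𝓡 n) y)] hf hd in
theorem absUmbilicity_eq_abs_umbilicity {x : M} {Ω : Set (Coord n)} {T' : Coord n → Coord n}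
    (hF : IsPrincipalFrame (formL c m) c (inChart n f x) Ω T' (inChart n η x) (inChart n ζ x))
    {u : Coord n} (hu : u ∈ Ω) (huφ : u ∈ (extChartAt (𝓡 n) x).target)
    (hT : T' u = chartD x u (T ((extChartAt (𝓡 n) x).symm u)) ∨
        T' u = -chartD x u (T ((extChartAt (𝓡 n) x).symm u)))
    (hw : gap (formL c m) n ρ ζ ((extChartAt (𝓡 n) x).symm u) ≠ 0) :
    absUmbilicity c ρ T ζ ((extChartAt (𝓡 n) x).symm u)
      = |umbilicity (formL c m) T' (inChart n η x) (inChart n ζ x) u| := by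
  have hn0 : (n : ℝ) ≠ 0 := by exact_mod_cast (by omega : n ≠ 0)
  have hdiff : DifferentiableAt ℝ (gap (formL c m) n ρ (inChart n ζ x)) u :=
    hF.differentiableAt_gap hu n ρ
  have hderiv : fderiv ℝ (gap (formL c m) n ρ (inChart n ζ x)) u (T' u)
      = -(n * umbilicity (formL c m) T' (inChart n η x) (inChart n ζ x) u *
        gap (formL c m) n ρ ζ ((extChartAt (𝓡 n) x).symm u)) :=
    hdiff.lineDeriv_eq_fderiv.symm.trans
      (hF.hasLineDerivAt_gap_T (by simpa using hn) (fun u _ => hρ _) hu).lineDeriv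
  have hsign : |fderiv ℝ (gap (formL c m) n ρ (inChart n ζ x)) u
        (chartD x u (T ((extChartAt (𝓡 n) x).symm u)))|
      = |fderiv ℝ (gap (formL c m) n ρ (inChart n ζ x)) u (T' u)| := by
    rcases hT with h | h <;> simp only [h, map_neg, abs_neg]
  rw [absUmbilicity, directionalD_eq_fderiv_chart x huφ hdiff, abs_div]
  change |fderiv ℝ (gap (formL c m) n ρ (inChart n ζ x)) u _| / _ = _
  rw [hsign, hderiv, abs_neg, mul_right_comm, abs_mul,
    mul_div_cancel_left₀ _ (abs_ne_zero.2 (mul_ne_zero hn0 hw))]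

theorem exists_isPrincipalFrame_umbilicity_nonneg
    (hw : ∀ x, gap (formL c m) n ρ ζ x ≠ 0) (x : M) :
    ∃ (Ω : Set (Coord n)) (T' : Coord n → Coord n), extChartAt (𝓡 n) x x ∈ Ω ∧
      IsPrincipalFrame (formL c m) c (inChart n f x) Ω T' (inChart n η x) (inChart n ζ x) ∧
      (∀ u ∈ Ω, absUmbilicity c ρ T ζ ((extChartAt (𝓡 n) x).symm u)
        = |umbilicity (formL c m) T' (inChart n η x) (inChart n ζ x) u|) ∧
      0 ≤ umbilicity (formL c m) T' (inChart n η x) (inChart n ζ x) (extChartAt (𝓡 n) x x) := by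
  obtain ⟨Ω, T', hx, hΩ, hF, hT⟩ := exists_isPrincipalFrame hf hd hn x
  have habs : ∀ u ∈ Ω, absUmbilicity c ρ T ζ ((extChartAt (𝓡 n) x).symm u)
      = |umbilicity (formL c m) T' (inChart n η x) (inChart n ζ x) u| := fun u hu =>
    absUmbilicity_eq_abs_umbilicity hn hρ hF hu (hΩ hu) (hT u hu) (hw _)
  rcases le_total 0 (umbilicity (formL c m) T' (inChart n η x) (inChart n ζ x)
    (extChartAt (𝓡 n) x x)) with h | h
  · exact ⟨Ω, T', hx, hF, habs, h⟩
  · refine ⟨Ω, -T', hx, hF.neg, fun u hu => ?_, ?_⟩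
    · rw [umbilicity_neg, abs_neg, habs u hu]
    · rw [umbilicity_neg]
      exact neg_nonneg.2 h

theorem continuous_absUmbilicity (hw : ∀ x, gap (formL c m) n ρ ζ x ≠ 0) :
    Continuous (absUmbilicity c ρ T ζ) := by
  refine continuous_iff_continuousAt.2 fun x => continuousAt_of_chart (n := n) ?_
  obtain ⟨Ω, T', hx, hF, habs, -⟩ := exists_isPrincipalFrame_umbilicity_nonneg hf hd hn hρ hw x
  have hΩ : Ω ∈ 𝓝 (extChartAt (𝓡 n) x x) := hF.isOpen.mem_nhds hx
  exact (hF.contDiffOn_umbilicity.continuousOn.continuousAt hΩ).abs.congr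
    (eventually_of_mem hΩ fun u hu => (habs u hu).symm)

theorem exists_absUmbilicity_pos [Nonempty M] (hw : ∀ x, gap (formL c m) n ρ ζ x ≠ 0)
    (hcurv : ∀ x, form c (η x) (ζ x) + c < 0) : ∃ x, 0 < absUmbilicity c ρ T ζ x := by
  by_contra! hall
  obtain ⟨x⟩ := ‹Nonempty M›
  obtain ⟨Ω, T', hx, hF, habs, -⟩ := exists_isPrincipalFrame_umbilicity_nonneg hf hd hn hρ hw x
  have hzero : Set.EqOn (umbilicity (formL c m) T' (inChart n η x) (inChart n ζ x))
      (fun _ => 0) Ω := fun u hu => abs_nonpos_iff.1 (habs u hu ▸ hall _)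
  have hriccati := hF.riccati hx (by simpa using hn) (fun u _ => hρ _) fun u _ => hw _
  rw [fderiv_eq_zero_of_eqOn_const (𝕜 := ℝ) hF.isOpen hx hzero, hzero hx] at hriccati
  have := hcurv ((extChartAt (𝓡 n) x).symm (extChartAt (𝓡 n) x x))
  simp only [inChart, formL_apply, zero_apply] at hriccati
  linarith

end GlobalFrame

section Complete

open Filter Topology

theorem min_one_mul_le_of_le_pow_div {a q w w₀ : ℝ} {n : ℕ} (hn : n ≠ 0) (ha : 0 ≤ a) (hq : 0 ≤ q)
    (hw₀ : 0 < w₀) (hw : w₀ ≤ w) (h : q ≤ a ^ n / w) : min 1 (q * w₀) ≤ a := by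
  rcases le_total 1 a with h1 | h1
  · exact (min_le_left _ _).trans h1
  · calc min 1 (q * w₀) ≤ q * w₀ := min_le_right _ _
      _ ≤ q * w := mul_le_mul_of_nonneg_left hw hq
      _ ≤ a ^ n := (le_div_iff₀ (hw₀.trans_le hw)).1 h
      _ ≤ a := pow_le_of_le_one ha h1 hn

variable {n m : ℕ} {M : Type*} [MetricSpace M] [ChartedSpace (Coord n) M]
  [IsManifold (𝓡 n) ∞ M] [RiemannianBundle (fun y : M => TangentSpace (𝓡 n) y)]
  [IsRiemannianManifold (𝓡 n) M]
  {c : ℝ} {f : M → Ambient m} (hf : IsIsometricImmersion (n := n) c f)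
  {T : ∀ x : M, TangentSpace (𝓡 n) x} {η ζ : M → Ambient m}
  (hd : ∀ x, IsPrincipalDatum c f x (T x) (η x) (ζ x)) (hn : 3 ≤ n) {ρ : ℝ}
  (hρ : ∀ x, 2 * form c (η x) (ζ x) + ((n : ℝ) - 2) * form c (ζ x) (ζ x) = ρ)

include hf hd hn hρ

theorem exists_gap_add_mul_dist_lt (hw : ∀ x, 0 < gap (formL c m) n ρ ζ x) {x : M}
    (hcurv : form c (η x) (ζ x) + c < 0) (hΨ : 0 < absUmbilicity c ρ T ζ x) {δ : ℝ} (hδ : 0 ≤ δ)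
    (hδΨ : 2 * δ < n * absUmbilicity c ρ T ζ x * gap (formL c m) n ρ ζ x) :
    ∃ y, absUmbilicity c ρ T ζ x ^ n / gap (formL c m) n ρ ζ x
        ≤ absUmbilicity c ρ T ζ y ^ n / gap (formL c m) n ρ ζ y ∧
      gap (formL c m) n ρ ζ y + δ * dist x y < gap (formL c m) n ρ ζ x := by
  have hE : 3 ≤ Module.finrank ℝ (Coord n) := by simpa using hn
  have hsymm := extChartAt_symm_extChartAt_self (n := n) x
  obtain ⟨Ω, T', hx, hF, habs, hnonneg⟩ :=
    exists_isPrincipalFrame_umbilicity_nonneg hf hd hn hρ (fun x => (hw x).ne') x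
  set φ := extChartAt (𝓡 n) x
  have hΨx : absUmbilicity c ρ T ζ x
      = umbilicity (formL c m) T' (inChart n η x) (inChart n ζ x) (φ x) := by
    rw [← abs_of_nonneg hnonneg, ← habs _ hx, hsymm]
  have hwx : gap (formL c m) n ρ (inChart n ζ x) (φ x) = gap (formL c m) n ρ ζ x :=
    congrArg (gap (formL c m) n ρ ζ) hsymm
  have hcurvx : formL c m (inChart n η x (φ x)) (inChart n ζ x (φ x)) + c < 0 := by
    rw [inChart, inChart, hsymm]
    exact hcurv
  have hunit : ‖chartSymmD x (φ x) (T' (φ x))‖ < 2 := by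
    rw [norm_eq_sqrt_real_inner, ← hf.inducedMetric_inChart x (mem_extChartAt_target x),
      (hF.frame _ hx).unit, Real.sqrt_one]
    exact one_lt_two
  have hmem : ∀ᶠ s in 𝓝[>] (0 : ℝ), φ x + s • T' (φ x) ∈ Ω :=
    ((tendsto_add_smul_zero _ _).eventually (hF.isOpen.eventually_mem hx)).filter_mono
      nhdsWithin_le_nhds
  obtain ⟨s, hs, hQ, hgap, hdist⟩ := (hmem.and
    ((hF.eventually_umbilicity_pow_div_gap_lt hE hx (by omega) (fun u _ => hρ _)
      (fun u _ => hw _) hcurvx (hΨx ▸ hΨ)).and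
    ((hF.eventually_gap_add_mul_lt hE (N := n) (fun u _ => hρ _) hx
      (by rwa [← hΨx, hwx])).and (eventually_dist_chart_le hf x hunit)))).exists
  refine ⟨φ.symm (φ x + s • T' (φ x)), ?_, ?_⟩
  · rw [hΨx, ← hwx, habs _ hs, ← abs_pow]
    exact hQ.le.trans (div_le_div_of_nonneg_right (le_abs_self _) (hw _).le)
  · calc gap (formL c m) n ρ ζ (φ.symm (φ x + s • T' (φ x))) + δ * dist x _
        ≤ gap (formL c m) n ρ (inChart n ζ x) (φ x + s • T' (φ x)) + δ * (2 * s) :=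
          add_le_add_right (mul_le_mul_of_nonneg_left hdist hδ) _
      _ < gap (formL c m) n ρ (inChart n ζ x) (φ x) := by linarith
      _ = gap (formL c m) n ρ ζ x := hwx

theorem false_of_le_gap [CompleteSpace M] [Nonempty M] {w₀ : ℝ} (hw₀ : 0 < w₀)
    (hw : ∀ x, w₀ ≤ gap (formL c m) n ρ ζ x) (hcurv : ∀ x, form c (η x) (ζ x) + c < 0) :
    False := by
  have hn₀ : n ≠ 0 := by omega
  have hwpos : ∀ x, 0 < gap (formL c m) n ρ ζ x := fun x => hw₀.trans_le (hw x)
  have hwne : ∀ x, gap (formL c m) n ρ ζ x ≠ 0 := fun x => (hwpos x).ne'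
  let Q : M → ℝ := fun x => absUmbilicity c ρ T ζ x ^ n / gap (formL c m) n ρ ζ x
  have hQ : Continuous Q := ((continuous_absUmbilicity hf hd hn hρ hwne).pow n).div
    (continuous_gap hf hd hn ρ) hwne
  obtain ⟨x₁, hx₁⟩ := exists_absUmbilicity_pos hf hd hn hρ hwne hcurv
  have hq : 0 < Q x₁ := div_pos (pow_pos hx₁ n) (hwpos x₁)
  set ψ₀ := min 1 (Q x₁ * w₀)
  have hψ₀ : 0 < ψ₀ := lt_min one_pos (mul_pos hq hw₀)
  have hδ : 0 < n * ψ₀ * w₀ / 4 := by positivity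
  obtain ⟨x, hx, hmin⟩ := exists_forall_add_mul_dist_le_imp_eq
    (isClosed_le continuous_const hQ) ⟨x₁, le_refl (Q x₁)⟩ (continuous_gap hf hd hn ρ)
    (fun x _ => hw x) hδ
  have hψ : ψ₀ ≤ absUmbilicity c ρ T ζ x :=
    min_one_mul_le_of_le_pow_div hn₀ (abs_nonneg _) hq.le hw₀ (hw x) hx
  have hrate : n * ψ₀ * w₀ ≤ n * absUmbilicity c ρ T ζ x * gap (formL c m) n ρ ζ x := by
    have := hψ₀.trans_le hψ
    gcongr
    exact hw x
  obtain ⟨y, hy, hlt⟩ := exists_gap_add_mul_dist_lt hf hd hn hρ hwpos (hcurv x)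
    (hψ₀.trans_le hψ) hδ.le (by linarith)
  rw [hmin y (hx.trans hy) hlt.le, dist_self, mul_zero, add_zero] at hlt
  exact hlt.false

end Complete

section Compact

open Filter Topology

variable {n m : ℕ} {M : Type*} [TopologicalSpace M] [ChartedSpace (Coord n) M]
  [IsManifold (𝓡 n) ∞ M] [RiemannianBundle (fun y : M => TangentSpace (𝓡 n) y)]
  {c : ℝ} {f : M → Ambient m} (hf : IsIsometricImmersion (n := n) c f)
  {T : ∀ x : M, TangentSpace (𝓡 n) x} {η ζ : M → Ambient m}
  (hd : ∀ x, IsPrincipalDatum c f x (T x) (η x) (ζ x)) (hn : 3 ≤ n)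

include hf hd hn

theorem exists_fderiv_fderiv_inChart_eq {x : M} (hζ : ζ x = 0) :
    ∃ X γ, 0 < inducedMetric (formL c m) (inChart n f x) (extChartAt (𝓡 n) x x) X X ∧
      fderiv ℝ (fderiv ℝ (inChart n f x)) (extChartAt (𝓡 n) x x) X X
        = fderiv ℝ (inChart n f x) (extChartAt (𝓡 n) x x) γ
          - (c * inducedMetric (formL c m) (inChart n f x) (extChartAt (𝓡 n) x x) X X) • f x := by
  have hI := hf.isLocalImmersion x
  have hu : extChartAt (𝓡 n) x x ∈ (extChartAt (𝓡 n) x).target := mem_extChartAt_target x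
  have hframe := (hd _).isPrincipalFrameAt hf hu
  set t := chartD x (extChartAt (𝓡 n) x x) (T ((extChartAt (𝓡 n) x).symm (extChartAt (𝓡 n) x x)))
  obtain ⟨X, hX, hXt, -⟩ := exists_ne_zero_of_two_functionals (by simpa using hn)
    (inducedMetric (formL c m) (inChart n f x) (extChartAt (𝓡 n) x x) t).toLinearMap 0
  obtain ⟨γ, hγ⟩ := hframe.gauss_formula X X
  have hXt' : inducedMetric (formL c m) (inChart n f x) (extChartAt (𝓡 n) x x) X t = 0 :=
    (hI.inducedMetric_symm _ X t).trans hXt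
  refine ⟨X, γ, hI.pos _ hu X hX, ?_⟩
  rw [hγ, hXt', inChart, extChartAt_symm_extChartAt_self, hζ]
  simp only [smul_zero, add_zero, mul_zero, zero_smul]

theorem exists_fderiv_fderiv_le [CompactSpace M] [Nonempty M] (hζ : ∀ x, ζ x = 0)
    {P : Ambient m → ℝ} (hP : ContDiff ℝ 2 P) :
    ∃ (x : M) (Y : Ambient m), 0 < form c Y Y ∧
      fderiv ℝ (fderiv ℝ P) (f x) Y Y ≤ c * form c Y Y * fderiv ℝ P (f x) (f x) := by
  obtain ⟨x, -, hx⟩ := isCompact_univ.exists_isMaxOn Set.univ_nonempty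
    (hP.continuous.comp hf.smooth.continuous).continuousOn
  obtain ⟨X, γ, hX, hγ⟩ := exists_fderiv_fderiv_inChart_eq hf hd hn (hζ x)
  have hfx : inChart n f x (extChartAt (𝓡 n) x x) = f x :=
    congrArg f (extChartAt_symm_extChartAt_self x)
  have hI := hf.isLocalImmersion x
  have hu : extChartAt (𝓡 n) x x ∈ (extChartAt (𝓡 n) x).target := mem_extChartAt_target x
  have hF : ContDiffAt ℝ 2 (inChart n f x) (extChartAt (𝓡 n) x x) :=
    mod_cast contDiffAt_infty.1 (hI.smooth.contDiffAt (hI.isOpen.mem_nhds hu)) 2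
  have hmax : IsLocalMax (P ∘ inChart n f x) (extChartAt (𝓡 n) x x) :=
    Eventually.of_forall fun u => by
      rw [Function.comp_apply, Function.comp_apply, hfx]
      exact hx (Set.mem_univ _)
  have hfirst : fderiv ℝ P (f x) (fderiv ℝ (inChart n f x) (extChartAt (𝓡 n) x x) γ) = 0 := by
    have h := hmax.fderiv_eq_zero
    rw [fderiv_comp _ (hP.differentiable (by simp)).differentiableAt
      (hF.differentiableAt (by simp)), hfx] at h
    exact DFunLike.congr_fun h γ
  have hsecond := fderiv_fderiv_nonpos_of_isLocalMax hmax (hP.contDiffAt.comp _ hF) X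
  rw [fderiv_fderiv_comp hP.contDiffAt hF, hγ, hfx, map_sub, hfirst, map_smul,
    zero_sub, ← sub_eq_add_neg] at hsecond
  exact ⟨x, _, hX, sub_nonpos.1 hsecond⟩

theorem exists_zeta_ne_zero_of_eq_zero [CompactSpace M] [Nonempty M] (hc : c = 0) :
    ∃ x, ζ x ≠ 0 := by
  by_contra! hζ
  subst hc
  have hfderiv : fderiv ℝ (fun p => formL 0 m p p) = ⇑((2 : ℝ) • formL 0 m) := by
    funext p
    ext1 v
    have hid : DifferentiableAt ℝ (fun q : Ambient m => q) p := differentiableAt_id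
    rw [fderiv_bilinear_apply _ hid hid, fderiv_fun_id]
    simp only [ContinuousLinearMap.id_apply, smul_apply, formL_apply, form_symm 0 v p,
      smul_eq_mul, two_mul]
  obtain ⟨x, Y, hY, hle⟩ := exists_fderiv_fderiv_le hf hd hn hζ
    (P := fun p => formL 0 m p p) ((formL 0 m).contDiff.clm_apply contDiff_id)
  rw [hfderiv, ContinuousLinearMap.fderiv] at hle
  simp only [smul_apply, formL_apply, smul_eq_mul, zero_mul] at hle
  linarith

theorem exists_zeta_ne_zero_of_neg [CompactSpace M] [Nonempty M] (hc : c < 0) :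
    ∃ x, ζ x ≠ 0 := by
  by_contra! hζ
  let ℓ : Ambient m →L[ℝ] ℝ := ContinuousLinearMap.proj (R := ℝ)
    (φ := fun _ : Fin (m + 1) => ℝ) 0
  have hfderiv : fderiv ℝ ℓ = fun _ => ℓ := funext fun _ => ℓ.fderiv
  obtain ⟨x, Y, hY, hle⟩ := exists_fderiv_fderiv_le hf hd hn hζ ℓ.contDiff
  have hpos : 0 < f x 0 := by
    have := hf.mem_spaceForm x
    simp only [SpaceForm, Set.mem_ofPred_eq, if_neg hc.ne] at this
    exact this.2 hc
  rw [hfderiv, fderiv_const_apply] at hle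
  exact hle.not_gt (mul_neg_of_neg_of_pos (mul_neg_of_neg_of_pos hc hY) hpos)

theorem exists_zeta_ne_zero [CompactSpace M] [Nonempty M] (hc : c ≤ 0) : ∃ x, ζ x ≠ 0 :=
  hc.eq_or_lt.elim (exists_zeta_ne_zero_of_eq_zero hf hd hn) (exists_zeta_ne_zero_of_neg hf hd hn)

end Compact

section ConstantScalarCurvature

theorem exists_two_mul_form_add_eq {n m : ℕ} {M : Type*} [TopologicalSpace M]
    [ChartedSpace (Coord n) M] [IsManifold (𝓡 n) ∞ M]
    [RiemannianBundle (fun y : M => TangentSpace (𝓡 n) y)] {c : ℝ} {f : M → Ambient m}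
    (hf : IsIsometricImmersion (n := n) c f) {T : ∀ x : M, TangentSpace (𝓡 n) x}
    {η ζ : M → Ambient m} (hd : ∀ x, IsPrincipalDatum c f x (T x) (η x) (ζ x)) (hn : 2 ≤ n)
    {R : ℝ} (hR : ∀ x : M, scalarCurvature (n := n) x = R) :
    ∃ ρ, R = n * (n - 1) * c + (n - 1) * ρ ∧
      ∀ x, 2 * form c (η x) (ζ x) + ((n : ℝ) - 2) * form c (ζ x) (ζ x) = ρ := by
  have hn₂ : (2 : ℝ) ≤ n := by exact_mod_cast hn
  have hn₁ : (n : ℝ) - 1 ≠ 0 := by linarith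
  refine ⟨(R - n * (n - 1) * c) / (n - 1), by field_simp; ring, fun x => ?_⟩
  rw [eq_div_iff hn₁]
  linarith [hR x, scalarCurvature_eq hf hd x]

variable {n m : ℕ} {M : Type*} [MetricSpace M] [ChartedSpace (Coord n) M]
  [IsManifold (𝓡 n) ∞ M] [RiemannianBundle (fun y : M => TangentSpace (𝓡 n) y)]
  [IsRiemannianManifold (𝓡 n) M] [CompleteSpace M]
  {c : ℝ} {f : M → Ambient m} (hf : IsIsometricImmersion (n := n) c f)
  {T : ∀ x : M, TangentSpace (𝓡 n) x} {η ζ : M → Ambient m}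
  (hd : ∀ x, IsPrincipalDatum c f x (T x) (η x) (ζ x)) (hn : 3 ≤ n) {ρ : ℝ}
  (hρ : ∀ x, 2 * form c (η x) (ζ x) + ((n : ℝ) - 2) * form c (ζ x) (ζ x) = ρ)

include hf hd hn hρ

theorem rho_nonneg_of_nonpos [Nonempty M] (hc : c ≤ 0) : 0 ≤ ρ := by
  have hn₃ : (3 : ℝ) ≤ n := by exact_mod_cast hn
  by_contra! hneg
  refine false_of_le_gap hf hd hn hρ (neg_pos.2 hneg) (fun x => ?_) fun x => ?_
  · have := mul_nonneg (by linarith : (0 : ℝ) ≤ n) (form_zeta_nonneg hf hd x)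
    simp only [gap, formL_apply]
    linarith
  · have := mul_nonneg (by linarith : (0 : ℝ) ≤ n - 2) (form_zeta_nonneg hf hd x)
    linarith [hρ x]

theorem neg_two_mul_lt_rho_of_pos [Nonempty M] (hc : 0 < c) : -2 * c < ρ := by
  have hn₃ : (3 : ℝ) ≤ n := by exact_mod_cast hn
  by_contra! hle
  refine false_of_le_gap hf hd hn hρ (w₀ := 2 * c) (by linarith) (fun x => ?_) fun x => ?_
  · have := mul_nonneg (by linarith : (0 : ℝ) ≤ n) (form_zeta_nonneg hf hd x)
    simp only [gap, formL_apply]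
    linarith
  · have hζ : ζ x ≠ 0 := fun h => by
      have hη : form c (η x) (0 : Ambient m) = 0 := (formL c m (η x)).map_zero
      have hζ : form c (0 : Ambient m) 0 = 0 := (formL c m 0).map_zero
      have := hρ x
      rw [h, hη, hζ] at this
      linarith
    have := mul_pos (by linarith : (0 : ℝ) < n - 2) (form_zeta_pos hf hd hζ)
    linarith [hρ x]

theorem rho_pos_of_compactSpace [ConnectedSpace M] [CompactSpace M] (hc : c ≤ 0) :
    0 < ρ := by
  have hn₃ : (3 : ℝ) ≤ n := by exact_mod_cast hn
  refine (rho_nonneg_of_nonpos hf hd hn hρ hc).lt_of_ne' fun hρ₀ => ?_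
  subst hρ₀
  have hgap : ∀ x, gap (formL c m) n 0 ζ x = n * form c (ζ x) (ζ x) := fun x => sub_zero _
  obtain ⟨x₀, hx₀⟩ := exists_zeta_ne_zero hf hd hn hc
  have hpos₀ : 0 < gap (formL c m) n 0 ζ x₀ := by
    rw [hgap]
    exact mul_pos (by linarith) (form_zeta_pos hf hd hx₀)
  have hne : ∀ x, gap (formL c m) n 0 ζ x ≠ 0 := by
    rcases isClopen_iff.1 (isClopen_gap_eq_zero hf hd hn hρ) with h | h
    · exact Set.eq_empty_iff_forall_notMem.1 h
    · exact absurd (Set.eq_univ_iff_forall.1 h x₀) hpos₀.ne'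
  have hζ : ∀ x, 0 < form c (ζ x) (ζ x) := fun x =>
    (form_zeta_nonneg hf hd x).lt_of_ne' fun h => hne x (by rw [hgap, h, mul_zero])
  obtain ⟨x₁, -, hx₁⟩ := isCompact_univ.exists_isMinOn Set.univ_nonempty
    (continuous_gap hf hd hn 0).continuousOn
  refine false_of_le_gap hf hd hn hρ (w₀ := gap (formL c m) n 0 ζ x₁) ?_
    (fun x => hx₁ (Set.mem_univ x)) fun x => ?_
  · rw [hgap]
    exact mul_pos (by linarith) (hζ x₁)
  · have := mul_pos (by linarith : (0 : ℝ) < n - 2) (hζ x)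
    linarith [hρ x]

end ConstantScalarCurvature

theorem theorem1 {n k : ℕ} (hn : 3 ≤ n)
    {M : Type*} [MetricSpace M] [ChartedSpace (Coord n) M] [IsManifold (𝓡 n) ∞ M]
    [RiemannianBundle (fun x : M => TangentSpace (𝓡 n) x)]
    [IsContMDiffRiemannianBundle (𝓡 n) ∞ (Coord n) (fun x : M => TangentSpace (𝓡 n) x)]
    [IsRiemannianManifold (𝓡 n) M] [ConnectedSpace M] [CompleteSpace M]
    (R : ℝ) (hR : ∀ x : M, scalarCurvature (n := n) x = R)
    (c : ℝ) (f : M → Ambient (n + k)) (hf : IsIsometricImmersion (n := n) c f)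
    (hflat : FlatNormalBundle n c f) (hproper : IsProperImmersion n c f)
    (htype : HasType n c f ![1, n - 1]) :
    (c = 0 → 0 ≤ R ∧ (CompactSpace M → 0 < R)) ∧
    (0 < c → ((n : ℝ) - 1) * ((n : ℝ) - 2) * c < R) ∧
    (c < 0 → (n : ℝ) * ((n : ℝ) - 1) * c ≤ R ∧
      (CompactSpace M → (n : ℝ) * ((n : ℝ) - 1) * c < R)) := by
  choose T η ζ hd using htype.exists_isPrincipalDatum
  have hn₃ : (3 : ℝ) ≤ n := by exact_mod_cast hn
  have hn₁ : (0 : ℝ) < n - 1 := by linarith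
  obtain ⟨ρ, rfl, hρ⟩ := exists_two_mul_form_add_eq hf hd (by omega) hR
  have hnonneg (hc : c ≤ 0) : 0 ≤ ρ := rho_nonneg_of_nonpos hf hd hn hρ hc
  have hpos (hc : c ≤ 0) (hM : CompactSpace M) : 0 < ρ :=
    rho_pos_of_compactSpace hf hd hn hρ hc
  refine ⟨?_, fun hc => ?_, fun hc => ⟨?_, fun hM => ?_⟩⟩
  · rintro rfl
    simp only [mul_zero, zero_add]
    exact ⟨mul_nonneg hn₁.le (hnonneg le_rfl), fun hM => mul_pos hn₁ (hpos le_rfl hM)⟩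
  · linarith [mul_lt_mul_of_pos_left (neg_two_mul_lt_rho_of_pos hf hd hn hρ hc) hn₁]
  · exact le_add_of_nonneg_right (mul_nonneg hn₁.le (hnonneg hc.le))
  · exact lt_add_of_pos_right _ (mul_pos hn₁ (hpos hc.le hM))
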